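/- Notation: let $\mathbb D\subset\mathbb C$ be the open unit disc, $n\ge1$, and write points of $\mathbb D^n$ as $z=(z',z_n)$ with $z'\in\mathbb D^{n-1}$, $z_n\in\mathbb D$. A continuous function $f:\mathbb D^n\to\mathbb C$ satisfies condition (L) with exponent $p$ if there is a constant $M<\infty$ such that for every complex line $L$ that is parallel to a coordinate axis and meets $\mathbb D^n$ there is $A_L\in L^p(L\cap\mathbb D^n)$ with $$\bar\partial (f|_L)=A_L f\ \text{ on } L\cap\mathbb D^n \text{ in the sense of distributions},\qquad \|A_L\|_{L^p(L\cap\mathbb D^n)}\le M .$$ If $f$ satisfies (L) with $p>2$, then on each such $L$ there are continuous functions $u$ for which $e^{-u}f|_L$ is holomorphic on $L\cap\mathbb D^n$; the multiplicity of a zero of $f|_L$ is the order of vanishing of $e^{-u}f|_L$ there, which does not depend on the choice of $u$. A trivial extension of $\bar\partial f/f$ by $0$ on $f^{-1}(0)$ is a form $B=\sum_{j=1}^n B_j\,d\bar z_j$ on $\mathbb D^n$ such that for each $j$ the function $B_jf$ is locally integrable on $\mathbb D^n\setminus f^{-1}(0)$, $\partial f/\partial\bar z_j=B_jf$ on $\mathbb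 D^n\setminus f^{-1}(0)$ in the sense of distributions, and $B_j=0$ on $f^{-1}(0)$. These conditions determine $B$ up to its values on a set of measure zero. **Lemma.** Let $2<p\le\infty$ and let $f$ be a continuous function on $\mathbb D^n$ satisfying condition (L) with exponent $p$. Assume that for each $z'\in\mathbb D^{n-1}$ the function $f(z',\cdot)$ has exactly one zero $z_n=r(z')$ in $\mathbb D$, and that this zero has multiplicity $1$. Then a trivial extension $B=\sum_jB_j\,d\bar z_j$ of $\bar\partial f/f$ exists, it has locally integrable coefficients on $\mathbb D^n$ and is $\bar\partial$-closed on $\mathbb D^n$ in the sense of distributions (whichever representative is chosen), and $r$ is holomorphic on $\mathbb D^{n-1}$. -/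

import Mathlib

open MeasureTheory Set
open scoped ContDiff ENNReal NNReal

noncomputable section

namespace DbarLog

/-- The unit disc of `ℂ`. -/
def disc : Set ℂ := {w | ‖w‖ < 1}

/-- The unit polydisc of `ℂⁿ`. -/
def polydisc (n : ℕ) : Set (Fin n → ℂ) := {z | ∀ j, ‖z j‖ < 1}

section Weak

variable {E : Type*} [NormedAddCommGroup E] [NormedSpace ℂ E]

/-- Smooth (in the real sense) complex valued functions with compact support in `U`. -/
def IsTestFunction (U : Set E) (φ : E → ℂ) : Prop :=
  ContDiff ℝ ∞ φ ∧ HasCompactSupport φ ∧ tsupport φ ⊆ U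

/-- The Wirtinger derivative `(∂_e φ + i ∂_{ie} φ) / 2` of a differentiable function in the complex
direction `e`. For `e = 1` in `ℂ` this is `∂φ/∂z̄`, and for the `j`-th basis vector of `ℂⁿ` it is
`∂φ/∂z̄_j`. -/
def dbar (e : E) (φ : E → ℂ) (z : E) : ℂ :=
  (1 / 2 : ℂ) * (fderiv ℝ φ z e + Complex.I * fderiv ℝ φ z (Complex.I • e))

/-- On the open set `U`, the locally integrable function `u` has the locally integrable function `g`
as its Wirtinger derivative in the direction `e`, in the sense of distributions. -/
def HasWeakDbar [MeasureSpace E] (U : Set E) (e : E) (u g : E → ℂ) : Prop :=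
  LocallyIntegrableOn u U volume ∧ LocallyIntegrableOn g U volume ∧
    ∀ φ : E → ℂ, IsTestFunction U φ →
      ∫ z, u z * dbar e φ z = -∫ z, g z * φ z

end Weak

/-- The restriction of `f` to the line through `z` parallel to the `z_j`-axis, as a function of the
`j`-th coordinate. -/
def slice {n : ℕ} (f : (Fin n → ℂ) → ℂ) (j : Fin n) (z : Fin n → ℂ) (w : ℂ) : ℂ :=
  f (Function.update z j w)

/-- Condition (L) on the unit polydisc: there is a constant `M` such that on every line `L` which is
parallel to a coordinate axis and meets the polydisc, `∂̄(f|_L) = A_L f` in the sense of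
distributions, with `‖A_L‖_{L^p} ≤ M`. Such a line meets the polydisc in a unit disc. -/
def ConditionL {n : ℕ} (p : ℝ≥0∞) (f : (Fin n → ℂ) → ℂ) : Prop :=
  ∃ M : ℝ≥0, ∀ (j : Fin n), ∀ z ∈ polydisc n, ∃ A : ℂ → ℂ,
    MemLp A p (volume.restrict disc) ∧ eLpNorm A p (volume.restrict disc) ≤ M ∧
      HasWeakDbar disc 1 (slice f j z) (fun w => A w * slice f j z w)

/-- `u` is an integrating factor of `g` on the unit disc: `u` is continuous and `e^{-u} g` is
holomorphic. -/
def IsIntegratingFactor (g u : ℂ → ℂ) : Prop :=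
  ContinuousOn u disc ∧ DifferentiableOn ℂ (fun w => Complex.exp (-u w) * g w) disc

/-- The multiplicity of `a` as a zero of `g`: the order of vanishing at `a` of the holomorphic
function `e^{-u} g`, for an integrating factor `u` of `g`. It does not depend on `u`, hence the
universal quantifier. (Restrictions of functions with condition (L), `p > 2`, always have
integrating factors; existence is not part of the definition.) -/
def HasMultiplicity (g : ℂ → ℂ) (a : ℂ) (k : ℕ) : Prop :=
  ∀ u : ℂ → ℂ, IsIntegratingFactor g u →
    analyticOrderAt (fun w => Complex.exp (-u w) * g w) a = k

/-- The `(0,1)`-form `B = ∑ B_j dz̄_j` is the trivial extension of `∂̄f / f` to the polydisc: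
`∂f/∂z̄_j = B_j f` in the sense of distributions off the zero set of `f`, and `B` is zero on the
zero set. This determines `B` in the polydisc up to a set of measure zero. -/
def IsTrivialExtension {n : ℕ} (f : (Fin n → ℂ) → ℂ) (B : Fin n → (Fin n → ℂ) → ℂ) : Prop :=
  (∀ j, HasWeakDbar {z | z ∈ polydisc n ∧ f z ≠ 0} (Pi.single j 1) f (fun z => B j z * f z)) ∧
    ∀ j, ∀ z ∈ polydisc n, f z = 0 → B j z = 0

/-- The `(0,1)`-form `∑ B_j dz̄_j` has locally integrable coefficients on the polydisc and is
`∂̄`-closed there in the sense of distributions, that is, `∂B_k/∂z̄_j = ∂B_j/∂z̄_k`. -/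
def IsDbarClosed {n : ℕ} (B : Fin n → (Fin n → ℂ) → ℂ) : Prop :=
  (∀ j, LocallyIntegrableOn (B j) (polydisc n) volume) ∧
    ∀ j k, ∀ φ : (Fin n → ℂ) → ℂ, IsTestFunction (polydisc n) φ →
      ∫ z, B k z * dbar (Pi.single j 1) φ z = ∫ z, B j z * dbar (Pi.single k 1) φ z

end DbarLog

end

/-! There are three steps: square integrable coefficients for `∂̄f / f`, holomorphy of `r`, and
closedness, first off the zero set and then across it.

Coefficients. On a line `L`, Hölder's inequality bounds the pairing of `f` with `∂̄φ` by a constant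
times the `L²` norm of `f φ` on `L`. Integrating over parallel lines with Cauchy–Schwarz gives `|∫ f
∂φ/∂z̄_j| ≤ C ‖f φ‖_{L²}` (`enorm_integral_mul_dbar_le`). By Riesz representation there is `b_j ∈
L²` with `∂f/∂z̄_j = b_j f` on the whole polydisc (`exists_weakDbar_quotient`). Every trivial
extension agrees with `b_j` almost everywhere off the zeros, so it lies in `L²`.

Holomorphy of `r`. The Cauchy transform gives integrating factors `u` on lines with sup and Hölder
bounds independent of the line (`exists_integratingFactor`). On vertical lines this yields `f = e^u
(z_n - r(z')) K` with `K` holomorphic and zero free. A Rouché argument makes `r` continuous. Fix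
`z₀` and the height `c = r(z₀)`. The uniform bounds make `G(z') = e^u K` at height `c` continuous at
`z₀`, although `u` and `K` are chosen separately for each `z'` (`continuousAt_exp_mul`). On a line
through `z₀` at height `c`, `f = e^v H` with `H` holomorphic and zero at `z₀`, so `r = c - (e^v / G)
H` is complex differentiable at `z₀`: a continuous factor times a differentiable function vanishing
there. Osgood's lemma then applies.

Closedness. Where `f ≠ 0`, approximate `f` by smooth `v`; the forms `∂̄v / v` are closed and
closedness passes to the limit (`integral_mul_dbar_symm`). To cross the zero set, put `s = z_n -
r(z')` and multiply test functions by a cutoff vanishing on the tube `|s| ≤ 1/κ`. Its gradient is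
`O(κ)`, the tube `|s| ≤ 2/κ` has volume `O(κ⁻²)`, and the `L²` norm of the coefficients on this tube
tends to zero, so the error vanishes (`tendsto_integral_mul_dbar_cutoff`). -/

namespace DbarLog

open Filter Topology Metric

/-! ### Products with compactly supported functions -/

section Support

variable {X : Type*} [TopologicalSpace X] {U : Set X} {φ u : X → ℂ}

/-- A function continuous on an open set times a continuous function supported there. -/
theorem continuous_mul_of_tsupport_subset (hU : IsOpen U) (hu : ContinuousOn u U)
    (hφ : Continuous φ) (hs : tsupport φ ⊆ U) : Continuous (fun z => u z * φ z) := by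
  refine continuous_iff_continuousAt.2 fun z => ?_
  by_cases hz : z ∈ tsupport φ
  · exact (hu.continuousAt (hU.mem_nhds (hs hz))).mul hφ.continuousAt
  · have : (fun z => u z * φ z) =ᶠ[𝓝 z] fun _ => 0 := by
      filter_upwards [notMem_tsupport_iff_eventuallyEq.1 hz] with y hy
      simp [hy]
    exact continuousAt_const.congr this.symm

theorem integrable_mul_of_locallyIntegrableOn [T2Space X] [MeasurableSpace X] [BorelSpace X]
    {μ : Measure X} (hu : LocallyIntegrableOn u U μ)
    (hφ : Continuous φ) (hc : HasCompactSupport φ) (hs : tsupport φ ⊆ U) :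
    Integrable (fun z => u z * φ z) μ := by
  have h1 : IntegrableOn u (tsupport φ) μ := hu.integrableOn_compact_subset hs hc
  have h2 : IntegrableOn (fun z => u z * φ z) (tsupport φ) μ :=
    h1.mul_continuousOn hφ.continuousOn hc
  rwa [integrableOn_iff_integrable_of_support_subset] at h2
  intro z hz
  apply subset_tsupport
  intro h
  apply hz
  simp [h]

end Support

/-! ### Wirtinger derivatives, test functions and integration by parts -/

section Calculus

variable {E : Type*} [NormedAddCommGroup E] [NormedSpace ℂ E] {e e' : E} {U V : Set E}
  {φ ψ u : E → ℂ} {z : E}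

theorem dbar_mul (hφ : DifferentiableAt ℝ φ z) (hψ : DifferentiableAt ℝ ψ z) :
    dbar e (fun y => φ y * ψ y) z = φ z * dbar e ψ z + dbar e φ z * ψ z := by
  simp only [dbar, fderiv_fun_mul hφ hψ, add_apply,
    smul_apply, smul_eq_mul]
  ring

theorem dbar_add (hφ : DifferentiableAt ℝ φ z) (hψ : DifferentiableAt ℝ ψ z) :
    dbar e (fun y => φ y + ψ y) z = dbar e φ z + dbar e ψ z := by
  simp only [dbar, fderiv_fun_add hφ hψ, add_apply]
  ring

theorem dbar_const_mul (c : ℂ) (hφ : DifferentiableAt ℝ φ z) :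
    dbar e (fun y => c * φ y) z = c * dbar e φ z := by
  simp only [dbar, fderiv_const_mul hφ, smul_apply, smul_eq_mul]
  ring

theorem dbar_congr (h : φ =ᶠ[𝓝 z] ψ) : dbar e φ z = dbar e ψ z := by
  simp only [dbar, h.fderiv_eq]

theorem dbar_comp_of_hasDerivAt {h : ℂ → ℂ} {h' : ℂ} (hh : HasDerivAt h h' (φ z))
    (hφ : DifferentiableAt ℝ φ z) : dbar e (fun y => h (φ y)) z = h' * dbar e φ z := by
  have h2 : fderiv ℝ (fun y => h (φ y)) z = (fderiv ℝ h (φ z)).comp (fderiv ℝ φ z) := by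
    exact fderiv_comp z (hh.hasFDerivAt.restrictScalars ℝ).differentiableAt hφ
  have h3 : ∀ x, fderiv ℝ h (φ z) x = x * h' := by
    intro x
    rw [(hh.hasFDerivAt.restrictScalars ℝ).fderiv]
    simp
  simp only [dbar, h2, ContinuousLinearMap.comp_apply, h3]
  ring

theorem ContDiff.dbar (hφ : ContDiff ℝ ∞ φ) (e : E) : ContDiff ℝ ∞ (DbarLog.dbar e φ) := by
  have h : ContDiff ℝ ∞ (fderiv ℝ φ) := hφ.fderiv_right (by simp)
  unfold DbarLog.dbar
  fun_prop

theorem tsupport_dbar_subset (e : E) (φ : E → ℂ) : tsupport (dbar e φ) ⊆ tsupport φ := by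
  refine closure_minimal (fun z hz => ?_) (isClosed_tsupport φ)
  by_contra h
  apply hz
  have : φ =ᶠ[𝓝 z] fun _ => 0 := notMem_tsupport_iff_eventuallyEq.1 h
  rw [dbar_congr this]
  simp [dbar]

theorem IsTestFunction.dbar (hφ : IsTestFunction U φ) (e : E) :
    IsTestFunction U (DbarLog.dbar e φ) :=
  ⟨ContDiff.dbar hφ.1 e, hφ.2.1.mono' ((subset_tsupport _).trans (tsupport_dbar_subset e φ)),
    (tsupport_dbar_subset e φ).trans hφ.2.2⟩

theorem IsTestFunction.mono (hφ : IsTestFunction U φ) (h : U ⊆ V) : IsTestFunction V φ :=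
  ⟨hφ.1, hφ.2.1, hφ.2.2.trans h⟩

theorem IsTestFunction.mul_left (hφ : IsTestFunction U φ) (hψ : ContDiff ℝ ∞ ψ) :
    IsTestFunction U (fun z => ψ z * φ z) :=
  ⟨hψ.mul hφ.1, hφ.2.1.mul_left, (tsupport_mul_subset_right).trans hφ.2.2⟩

/-- A function which is smooth near the support of a test function may be multiplied with it. -/
theorem IsTestFunction.mul_left_of_contDiffOn (hφ : IsTestFunction U φ) (hV : IsOpen V)
    (hψ : ContDiffOn ℝ ∞ ψ V) (hs : tsupport φ ⊆ V) :
    IsTestFunction U (fun z => ψ z * φ z) := by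
  refine ⟨contDiff_iff_contDiffAt.2 fun z => ?_, hφ.2.1.mul_left,
    (tsupport_mul_subset_right).trans hφ.2.2⟩
  by_cases hz : z ∈ tsupport φ
  · exact (hψ.contDiffAt (hV.mem_nhds (hs hz))).mul hφ.1.contDiffAt
  · have : (fun z => ψ z * φ z) =ᶠ[𝓝 z] fun _ => 0 := by
      filter_upwards [notMem_tsupport_iff_eventuallyEq.1 hz] with y hy
      simp [hy]
    exact contDiffAt_const.congr_of_eventuallyEq this

theorem dbar_comm (hφ : ContDiff ℝ ∞ φ) (e e' : E) (z : E) :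
    dbar e (dbar e' φ) z = dbar e' (dbar e φ) z := by
  have h1 : Differentiable ℝ (fderiv ℝ φ) :=
    (hφ.fderiv_right (m := ∞) (by simp)).differentiable (by simp)
  have h2 : ∀ v : E, fderiv ℝ (fun y => fderiv ℝ φ y v) z = (fderiv ℝ (fderiv ℝ φ) z).flip v := by
    intro v
    ext x
    rw [fderiv_clm_apply h1.differentiableAt (differentiableAt_const v)]
    simp
  have h3 : ∀ a b : E, fderiv ℝ (fderiv ℝ φ) z a b = fderiv ℝ (fderiv ℝ φ) z b a := by
    have := (hφ.contDiffAt (x := z)).isSymmSndFDerivAt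
      (by simp only [minSmoothness_of_isRCLikeNormedField]; exact ENat.LEInfty.out)
    intro a b
    exact this a b
  have h4 : ∀ a b : E, fderiv ℝ (dbar b φ) z a = (1 / 2 : ℂ) * (fderiv ℝ (fderiv ℝ φ) z a b +
      Complex.I * fderiv ℝ (fderiv ℝ φ) z a (Complex.I • b)) := by
    intro a b
    have h5 : ∀ v : E, HasFDerivAt (fun y => fderiv ℝ φ y v) ((fderiv ℝ (fderiv ℝ φ) z).flip v) z :=
      fun v => by
        rw [← h2]
        exact (h1.differentiableAt.clm_apply (differentiableAt_const v)).hasFDerivAt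
    have h6 : HasFDerivAt (dbar b φ) _ z := ((h5 b).add ((h5 (Complex.I • b)).const_mul
      Complex.I)).const_mul (1 / 2 : ℂ)
    rw [h6.fderiv]
    simp only [smul_apply, add_apply, ContinuousLinearMap.flip_apply, smul_eq_mul]
  rw [dbar, h4, h4, dbar, h4, h4, h3 e' e, h3 (Complex.I • e') e, h3 e' (Complex.I • e),
    h3 (Complex.I • e') (Complex.I • e)]
  ring

theorem IsTestFunction.continuous (hφ : IsTestFunction U φ) : Continuous φ := hφ.1.continuous

theorem IsTestFunction.differentiable (hφ : IsTestFunction U φ) : Differentiable ℝ φ :=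
  hφ.1.differentiable (by simp)

theorem IsTestFunction.integrable_mul [MeasurableSpace E] [BorelSpace E]
    {μ : Measure E} (hφ : IsTestFunction U φ) (hu : LocallyIntegrableOn u U μ) :
    Integrable (fun z => u z * φ z) μ :=
  integrable_mul_of_locallyIntegrableOn hu hφ.continuous hφ.2.1 hφ.2.2

theorem dbar_comp_sub_left {φ : E → ℂ} (hφ : Differentiable ℝ φ) (e z t : E) :
    dbar e (fun y => φ (z - y)) t = -dbar e φ (z - t) := by
  have h : HasFDerivAt (fun y => φ (z - y)) ((fderiv ℝ φ (z - t)).comp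
      (-(ContinuousLinearMap.id ℝ E))) t :=
    (hφ (z - t)).hasFDerivAt.comp t ((hasFDerivAt_id t).const_sub z)
  simp only [dbar, h.fderiv, ContinuousLinearMap.comp_apply, neg_apply,
    ContinuousLinearMap.id_apply, map_neg]
  ring

variable [MeasureSpace E] [BorelSpace E] [FiniteDimensional ℂ E]
  [(volume : Measure E).IsAddHaarMeasure]

theorem integral_mul_dbar (hu : ContDiff ℝ ∞ u) (hφ : IsTestFunction U φ) (e : E) :
    ∫ z, u z * dbar e φ z = -∫ z, dbar e u z * φ z := by
  have : FiniteDimensional ℝ E := FiniteDimensional.complexToReal E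
  have hc : ∀ v : E, Continuous fun z => fderiv ℝ φ z v := fun v =>
    (hφ.1.continuous_fderiv (by simp)).clm_apply continuous_const
  have hcu : ∀ v : E, Continuous fun z => fderiv ℝ u z v := fun v =>
    (hu.continuous_fderiv (by simp)).clm_apply continuous_const
  have hs : ∀ v : E, HasCompactSupport fun z => fderiv ℝ φ z v := fun v =>
    hφ.2.1.fderiv_apply (𝕜 := ℝ) v
  have i1 : ∀ v : E, Integrable (fun z => fderiv ℝ u z v * φ z) := fun v =>
    ((hcu v).mul hφ.continuous).integrable_of_hasCompactSupport hφ.2.1.mul_left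
  have i2 : ∀ v : E, Integrable (fun z => u z * fderiv ℝ φ z v) := fun v =>
    (hu.continuous.mul (hc v)).integrable_of_hasCompactSupport (hs v).mul_left
  have i3 : Integrable (fun z => u z * φ z) :=
    (hu.continuous.mul hφ.continuous).integrable_of_hasCompactSupport hφ.2.1.mul_left
  have key : ∀ v : E, ∫ z, u z * fderiv ℝ φ z v = -∫ z, fderiv ℝ u z v * φ z := fun v =>
    integral_mul_fderiv_eq_neg_fderiv_mul_of_integrable (i1 v) (i2 v) i3
      (fun x _ => (hu.differentiable (by simp)).differentiableAt)
      (fun x _ => (hφ.1.differentiable (by simp)).differentiableAt)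
  have e1 : ∀ z, u z * dbar e φ z = (1 / 2 : ℂ) * (u z * fderiv ℝ φ z e) +
      (1 / 2 * Complex.I : ℂ) * (u z * fderiv ℝ φ z (Complex.I • e)) := fun z => by
    rw [dbar]; ring
  have e2 : ∀ z, dbar e u z * φ z = (1 / 2 : ℂ) * (fderiv ℝ u z e * φ z) +
      (1 / 2 * Complex.I : ℂ) * (fderiv ℝ u z (Complex.I • e) * φ z) := fun z => by
    rw [dbar]; ring
  simp_rw [e1, e2]
  rw [integral_add ((i2 _).const_mul _) ((i2 _).const_mul _),
    integral_add ((i1 _).const_mul _) ((i1 _).const_mul _)]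
  simp only [integral_const_mul, key]
  ring

end Calculus

/-! ### Mollification of weak solutions -/

section Mollification

open scoped Convolution
open ContinuousLinearMap (mul lsmul)

variable {E : Type*} [NormedAddCommGroup E] [NormedSpace ℂ E] [MeasureSpace E] [BorelSpace E]
  [FiniteDimensional ℂ E] [(volume : Measure E).IsAddHaarMeasure]

theorem dbar_convolution {v ρ : E → ℂ} (hv : LocallyIntegrable v) (hρ : ContDiff ℝ ∞ ρ)
    (hc : HasCompactSupport ρ) (e z : E) :
    dbar e (v ⋆[mul ℝ ℂ, volume] ρ) z = (v ⋆[mul ℝ ℂ, volume] dbar e ρ) z := by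
  have : FiniteDimensional ℝ E := FiniteDimensional.complexToReal E
  have hD := hc.hasFDerivAt_convolution_right (mul ℝ ℂ) hv (hρ.of_le (by simp)) z
  have hcont : Continuous (fderiv ℝ ρ) := hρ.continuous_fderiv (by simp)
  have hi : ∀ x : E, Integrable (fun t => v t * fderiv ℝ ρ (z - t) x) := fun x =>
    (hc.fderiv_apply (𝕜 := ℝ) x).convolutionExists_right (mul ℝ ℂ) hv
      (hcont.clm_apply continuous_const) z
  rw [dbar, hD.fderiv, convolution_precompR_apply _ hv (hc.fderiv ℝ) hcont,
    convolution_precompR_apply _ hv (hc.fderiv ℝ) hcont]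
  simp only [convolution_def, ContinuousLinearMap.mul_apply', dbar]
  rw [← integral_const_mul, ← integral_add (hi _) ((hi _).const_mul _), ← integral_const_mul]
  congr 1 with t
  ring

/-- Mollification: a continuous function on an open set is approximated, uniformly on a compact
subset, by smooth functions, with control of all its weak Wirtinger derivatives. -/
theorem exists_smooth_approx {U : Set E} (hU : IsOpen U) {u : E → ℂ} (hu : ContinuousOn u U)
    {K : Set E} (hK : IsCompact K) (hKU : K ⊆ U) :
    ∃ K', IsCompact K' ∧ K' ⊆ U ∧ ∀ δ > 0, ∃ v : E → ℂ, ContDiff ℝ ∞ v ∧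
      (∀ z ∈ K, ‖v z - u z‖ ≤ δ) ∧ ∀ e g, HasWeakDbar U e u g →
        (∫ z in K, ‖dbar e v z‖ ≤ ∫ z in K', ‖g z‖) ∧
        ((∀ z ∈ K', g z = 0) → ∀ z ∈ K, dbar e v z = 0) := by
  have : FiniteDimensional ℝ E := FiniteDimensional.complexToReal E
  have : ProperSpace E := FiniteDimensional.proper ℝ E
  obtain ⟨r, hr, hrU⟩ := hK.exists_cthickening_subset_open hU hKU
  have hK' : IsCompact (cthickening r K) := hK.cthickening
  refine ⟨cthickening r K, hK', hrU, fun δ hδ => ?_⟩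
  obtain ⟨η, hη, hηu⟩ := Metric.uniformContinuousOn_iff.1
    (hK'.uniformContinuousOn_of_continuous (hu.mono hrU)) δ hδ
  -- `r` keeps the averages inside the thickening, which does not depend on `δ`; `η` makes them
  -- `δ`-close to `u`.
  set s : ℝ := min r η with hs
  have hs0 : 0 < s := lt_min hr hη
  let b : ContDiffBump (0 : E) := ⟨s / 2, s, half_pos hs0, half_lt_self hs0⟩
  -- Truncation makes the convolution globally meaningful. For `z ∈ K` the kernel centred at `z`
  -- only sees the thickening, where `w = u`.
  set w : E → ℂ := (cthickening r K).indicator u with hw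
  have hwi : Integrable w :=
    ((hu.mono hrU).integrableOn_compact hK').integrable_indicator hK'.measurableSet
  set ρ : E → ℂ := fun z => (b.normed volume z : ℂ) with hρ
  have hρs : ContDiff ℝ ∞ ρ := Complex.ofRealCLM.contDiff.comp b.contDiff_normed
  have hρt : tsupport ρ ⊆ closedBall 0 s := by
    rw [show closedBall (0 : E) s = tsupport (b.normed volume) from b.tsupport_normed_eq.symm]
    refine closure_mono fun z hz h => hz ?_
    simp [hρ, h]
  have hρc : HasCompactSupport ρ := (isCompact_closedBall (0 : E) s).of_isClosed_subset
    (isClosed_tsupport ρ) hρt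
  have hball : ∀ z ∈ K, closedBall z s ⊆ cthickening r K := fun z hz =>
    (closedBall_subset_cthickening hz s).trans (cthickening_mono (min_le_left _ _) K)
  -- The translated kernel is a test function on `U`, so the weak equation shows that on `K` the
  -- derivative of the mollified `u` is the mollified `g`.
  have hformula : ∀ z ∈ K, ∀ e g, HasWeakDbar U e u g →
      dbar e (w ⋆[mul ℝ ℂ, volume] ρ) z = ∫ t, (cthickening r K).indicator g t * ρ (z - t) := by
    intro z hz e g hg
    have htest : IsTestFunction U fun t => ρ (z - t) := by
      have hsub : tsupport (fun t => ρ (z - t)) ⊆ closedBall z s := by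
        refine closure_minimal (fun t ht => ?_) isClosed_closedBall
        have := hρt (subset_tsupport ρ (show ρ (z - t) ≠ 0 from ht))
        rwa [mem_closedBall_zero_iff, ← dist_eq_norm, dist_comm] at this
      exact ⟨hρs.comp (contDiff_const.sub contDiff_id),
        (isCompact_closedBall z s).of_isClosed_subset (isClosed_tsupport _) hsub,
        hsub.trans ((hball z hz).trans hrU)⟩
    have hin : ∀ t, t ∉ cthickening r K → ρ (z - t) = 0 ∧ dbar e ρ (z - t) = 0 := by
      intro t ht
      have hnot : z - t ∉ tsupport ρ := by
        intro h
        apply ht (hball z hz _)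
        have := hρt h
        rwa [mem_closedBall_zero_iff, ← dist_eq_norm, dist_comm] at this
      exact ⟨image_eq_zero_of_notMem_tsupport hnot, image_eq_zero_of_notMem_tsupport
        fun h => hnot (tsupport_dbar_subset e ρ h)⟩
    rw [dbar_convolution hwi.locallyIntegrable hρs hρc, convolution_def]
    have h := hg.2.2 _ htest
    simp only [dbar_comp_sub_left (hρs.differentiable (by simp)), mul_neg, integral_neg,
      neg_inj] at h
    calc ∫ t, w t * dbar e ρ (z - t) = ∫ t, u t * dbar e ρ (z - t) := by
          congr 1 with t
          by_cases ht : t ∈ cthickening r K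
          · rw [hw, indicator_of_mem ht]
          · rw [(hin t ht).2, mul_zero, mul_zero]
      _ = ∫ t, g t * ρ (z - t) := h
      _ = _ := by
          congr 1 with t
          by_cases ht : t ∈ cthickening r K
          · rw [indicator_of_mem ht]
          · rw [(hin t ht).1, mul_zero, mul_zero]
  refine ⟨w ⋆[mul ℝ ℂ, volume] ρ, hρc.contDiff_convolution_right _ hwi.locallyIntegrable hρs,
    fun z hz => ?_, fun e g hg => ⟨?_, fun h0 z hz => ?_⟩⟩
  · have h1 : (w ⋆[mul ℝ ℂ, volume] ρ) z = (b.normed volume ⋆[lsmul ℝ ℝ, volume] w) z := by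
      rw [convolution_eq_swap]
      simp [convolution_def, hρ, mul_comm]
    have h2 : w z = u z := indicator_of_mem (self_subset_cthickening K hz) u
    rw [h1, ← dist_eq_norm, ← h2]
    refine b.dist_normed_convolution_le hwi.aestronglyMeasurable fun x hx => ?_
    have hx' : x ∈ cthickening r K := hball z hz (ball_subset_closedBall hx)
    rw [h2, hw, indicator_of_mem hx']
    exact (hηu x hx' z (self_subset_cthickening K hz)
      (lt_of_lt_of_le (mem_ball.1 hx) (min_le_right _ _))).le
  · set G : E → ℝ := (cthickening r K).indicator fun t => ‖g t‖ with hG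
    have hgi : IntegrableOn g (cthickening r K) := hg.2.1.integrableOn_compact_subset hrU hK'
    have hGi : Integrable G := (integrable_indicator_iff hK'.measurableSet).2 hgi.norm
    have hb : Integrable (b.normed volume) := b.integrable_normed
    have hconv : Integrable (G ⋆[mul ℝ ℝ, volume] b.normed volume) :=
      hGi.integrable_convolution (mul ℝ ℝ) hb
    -- A kernel of mass one preserves the integral, which gives the `L¹` bound with constant one.
    have hint : ∫ z, (G ⋆[mul ℝ ℝ, volume] b.normed volume) z = ∫ z in cthickening r K, ‖g z‖ := by
      rw [integral_convolution (mul ℝ ℝ) hGi hb, b.integral_normed]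
      simp [hG, integral_indicator hK'.measurableSet]
    have hnn : ∀ z, 0 ≤ (G ⋆[mul ℝ ℝ, volume] b.normed volume) z := fun z =>
      integral_nonneg fun t => mul_nonneg (indicator_nonneg (fun _ _ => norm_nonneg _) _)
        (b.nonneg_normed _)
    rw [← hint]
    refine le_trans ?_ (setIntegral_le_integral (s := K) hconv (ae_of_all _ hnn))
    refine integral_mono_of_nonneg (ae_of_all _ fun _ => norm_nonneg _) hconv.integrableOn
      ((ae_restrict_iff' hK.measurableSet).2 (ae_of_all _ fun z hz => ?_))
    simp only [hformula z hz e g hg, convolution_def, ContinuousLinearMap.mul_apply']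
    refine (norm_integral_le_integral_norm _).trans (le_of_eq ?_)
    congr 1 with t
    rw [norm_mul, norm_indicator_eq_indicator_norm, hρ]
    simp [hG, abs_of_nonneg (b.nonneg_normed _)]
  · rw [hformula z hz e g hg]
    have : (cthickening r K).indicator g = 0 := by
      ext t
      by_cases ht : t ∈ cthickening r K
      · rw [indicator_of_mem ht, h0 t ht]; rfl
      · rw [indicator_of_notMem ht]; rfl
    simp [this]

end Mollification

/-! ### Weyl's lemma -/

theorem isOpen_disc : IsOpen disc := isOpen_lt continuous_norm continuous_const

theorem disc_eq_ball : disc = ball (0 : ℂ) 1 := by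
  ext w; simp [disc]

theorem differentiableAt_of_dbar_eq_zero {v : ℂ → ℂ} {z : ℂ} (hv : DifferentiableAt ℝ v z)
    (h : dbar 1 v z = 0) : DifferentiableAt ℂ v z := by
  rw [differentiableAt_complex_iff_differentiableAt_real]
  refine ⟨hv, ?_⟩
  simp only [dbar, smul_eq_mul, mul_one] at h
  simp only [smul_eq_mul]
  linear_combination (-2 * Complex.I) * h + fderiv ℝ v z Complex.I * Complex.I_mul_I

/-- **Weyl's lemma** for the Cauchy-Riemann operator. -/
theorem differentiableOn_of_hasWeakDbar_zero {U : Set ℂ} (hU : IsOpen U) {u : ℂ → ℂ}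
    (hu : ContinuousOn u U) (h : HasWeakDbar U 1 u fun _ => 0) : DifferentiableOn ℂ u U := by
  intro z hz
  obtain ⟨r, hr, hrU⟩ := Metric.isOpen_iff.1 hU z hz
  have hKU : closedBall z (r / 2) ⊆ U := (closedBall_subset_ball (half_lt_self hr)).trans hrU
  -- The approximants have zero Wirtinger derivative on the closed ball, so they are holomorphic
  -- inside and `u` is their uniform limit.
  obtain ⟨K', -, -, hK'⟩ := exists_smooth_approx hU hu (isCompact_closedBall z (r / 2)) hKU
  choose v hv1 hv2 hv3 using fun n : ℕ => hK' (1 / ((n : ℝ) + 1)) Nat.one_div_pos_of_nat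
  have hlim : TendstoUniformlyOn v u atTop (ball z (r / 2)) := by
    rw [Metric.tendstoUniformlyOn_iff]
    intro ε hε
    obtain ⟨N, hN⟩ := exists_nat_one_div_lt hε
    filter_upwards [eventually_ge_atTop N] with n hn x hx
    rw [dist_comm, dist_eq_norm]
    exact (hv2 n x (ball_subset_closedBall hx)).trans_lt
      ((Nat.one_div_le_one_div hn).trans_lt hN)
  have hd : DifferentiableOn ℂ u (ball z (r / 2)) := by
    refine hlim.tendstoLocallyUniformlyOn.differentiableOn (Eventually.of_forall fun n x hx => ?_)
      isOpen_ball
    exact (differentiableAt_of_dbar_eq_zero ((hv1 n).differentiable (by simp) x)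
      ((hv3 n 1 _ h).2 (fun _ _ => rfl) x (ball_subset_closedBall hx))).differentiableWithinAt
  exact (hd.differentiableAt (ball_mem_nhds z (half_pos hr))).differentiableWithinAt

/-! ### The Cauchy–Pompeiu formula -/

section Pompeiu

open Real (cos sin)

theorem hasDerivAt_cos_add_sin_mul_I (θ : ℝ) :
    HasDerivAt (fun θ : ℝ => ((cos θ : ℂ) + sin θ * Complex.I))
      (Complex.I * ((cos θ : ℂ) + sin θ * Complex.I)) θ := by
  have h := ((Real.hasDerivAt_cos θ).ofReal_comp).add
    (((Real.hasDerivAt_sin θ).ofReal_comp).mul_const Complex.I)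
  refine h.congr_deriv ?_
  simp only [Complex.ofReal_neg]
  linear_combination -(sin θ : ℂ) * Complex.I_mul_I

theorem norm_cos_add_sin_mul_I (θ : ℝ) : ‖((cos θ : ℂ) + sin θ * Complex.I)‖ = 1 := by
  simp

/-- This expresses `∂̄` in the rotated frame `v, iv`. For unit `v` in the direction of `z` these are
the radial and angular directions of polar coordinates. -/
theorem fderiv_add_I_mul_fderiv (φ : ℂ → ℂ) (z v : ℂ) :
    (1 / 2 : ℂ) * (fderiv ℝ φ z v + Complex.I * fderiv ℝ φ z (Complex.I * v)) =
      (starRingEnd ℂ) v * dbar 1 φ z := by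
  have h1 : ∀ x y : ℝ, fderiv ℝ φ z (x + y * Complex.I) =
      x * fderiv ℝ φ z 1 + y * fderiv ℝ φ z Complex.I := by
    intro x y
    have : (x + y * Complex.I : ℂ) = x • (1 : ℂ) + y • Complex.I := by simp
    rw [this, map_add, map_smul, map_smul]
    simp
  have h2 : v = (v.re : ℂ) + (v.im : ℂ) * Complex.I := (Complex.re_add_im v).symm
  have h3 : Complex.I * v = ((-v.im : ℝ) : ℂ) + (v.re : ℂ) * Complex.I := by
    conv_lhs => rw [h2]
    push_cast
    linear_combination (v.im : ℂ) * Complex.I_mul_I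
  have h4 : (starRingEnd ℂ) v = (v.re : ℂ) - (v.im : ℂ) * Complex.I := by
    apply Complex.ext <;> simp
  have h5 : fderiv ℝ φ z v = v.re * fderiv ℝ φ z 1 + v.im * fderiv ℝ φ z Complex.I := by
    conv_lhs => rw [h2, h1]
  rw [h3, h1, h4, h5]
  simp only [dbar, smul_eq_mul, mul_one]
  push_cast
  linear_combination (v.im / 2 * fderiv ℝ φ z Complex.I : ℂ) * Complex.I_mul_I

/-- The **Cauchy-Pompeiu formula** for smooth functions with compact support. -/
theorem integral_inv_mul_dbar {φ : ℂ → ℂ} (hφ : ContDiff ℝ ∞ φ) (hc : HasCompactSupport φ) :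
    ∫ z, ((Real.pi : ℂ) * z)⁻¹ * dbar 1 φ z = -φ 0 := by
  set E : ℝ → ℂ := fun θ => (cos θ : ℂ) + sin θ * Complex.I with hE
  have hEc : Continuous E := by fun_prop
  obtain ⟨R, hR0, hR⟩ : ∃ R > 0, tsupport φ ⊆ ball 0 R := by
    obtain ⟨R, hR⟩ := hc.isBounded.subset_ball 0
    exact ⟨max R 1, by positivity, hR.trans (ball_subset_ball (le_max_left _ _))⟩
  have hzero : ∀ r : ℝ, R ≤ |r| → ∀ θ, (r * E θ : ℂ) ∉ tsupport φ := by
    intro r hr θ h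
    have := hR h
    rw [mem_ball_zero_iff, norm_mul, norm_cos_add_sin_mul_I] at this
    simp only [Complex.norm_real, Real.norm_eq_abs, mul_one] at this
    linarith
  have hDc : Continuous (fderiv ℝ φ) := hφ.continuous_fderiv (by simp)
  set T : Set (ℝ × ℝ) := Ioi (0 : ℝ) ×ˢ Ioo (-Real.pi) Real.pi with hT
  have hint : ∀ v : ℝ → ℂ, Continuous v →
      IntegrableOn (fun p : ℝ × ℝ => fderiv ℝ φ (p.1 * E p.2) (v p.2)) T := by
    intro v hv
    have h1 : IntegrableOn (fun p : ℝ × ℝ => fderiv ℝ φ (p.1 * E p.2) (v p.2))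
        (Icc 0 R ×ˢ Icc (-Real.pi) Real.pi) := by
      refine Continuous.continuousOn ?_ |>.integrableOn_compact (isCompact_Icc.prod isCompact_Icc)
      exact (hDc.comp (by fun_prop)).clm_apply (hv.comp continuous_snd)
    refine h1.of_forall_sdiff_eq_zero (measurableSet_Ioi.prod measurableSet_Ioo) ?_
    rintro ⟨r, θ⟩ ⟨⟨hr, hθ⟩, hn⟩
    have hr' : R ≤ |r| := by
      by_contra hlt
      push Not at hlt
      exact hn ⟨⟨(mem_Ioi.1 hr).le, (le_abs_self r).trans hlt.le⟩, hθ.1.le, hθ.2.le⟩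
    have : fderiv ℝ φ (r * E θ) = 0 := image_eq_zero_of_notMem_tsupport
      fun h => hzero r hr' θ (tsupport_fderiv_subset ℝ h)
    simp [this]
  have hdiff : Differentiable ℝ φ := hφ.differentiable (by simp)
  have hr_int : ∀ θ : ℝ, ∫ r in Ioi (0 : ℝ), fderiv ℝ φ (r * E θ) (E θ) = -φ 0 := by
    intro θ
    have hd : ∀ r : ℝ, HasDerivAt (fun r : ℝ => φ (r * E θ)) (fderiv ℝ φ (r * E θ) (E θ)) r := by
      intro r
      have h1 : HasDerivAt (fun r : ℝ => (r : ℂ) * E θ) (E θ) r := by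
        simpa using (Complex.ofRealCLM.hasDerivAt (x := r)).mul_const (E θ)
      exact (hdiff _).hasFDerivAt.comp_hasDerivAt r h1
    have hs : ContDiff ℝ 1 fun r : ℝ => φ (r * E θ) :=
      (hφ.of_le (by simp)).comp (Complex.ofRealCLM.contDiff.mul contDiff_const)
    have hcs : HasCompactSupport fun r : ℝ => φ (r * E θ) := by
      refine HasCompactSupport.intro (isCompact_Icc (a := -R) (b := R)) fun r hr => ?_
      refine image_eq_zero_of_notMem_tsupport (hzero r ?_ θ)
      by_contra hlt
      push Not at hlt
      exact hr (abs_le.1 hlt.le)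
    have := hcs.integral_Ioi_deriv_eq hs 0
    simp only [Complex.ofReal_zero, zero_mul] at this
    rw [← this]
    congr 1 with r
    exact (hd r).deriv.symm
  have hθ_int : ∀ r : ℝ, 0 < r →
      ∫ θ in Ioo (-Real.pi) Real.pi, fderiv ℝ φ (r * E θ) (Complex.I * E θ) = 0 := by
    intro r hr
    have hd : ∀ θ : ℝ, HasDerivAt (fun θ : ℝ => φ (r * E θ))
        (r * fderiv ℝ φ (r * E θ) (Complex.I * E θ)) θ := by
      intro θ
      have h1 : HasDerivAt (fun θ : ℝ => (r : ℂ) * E θ) (r • (Complex.I * E θ)) θ := by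
        rw [Complex.real_smul]
        exact (hasDerivAt_cos_add_sin_mul_I θ).const_mul (r : ℂ)
      have := (hdiff _).hasFDerivAt.comp_hasDerivAt θ h1
      rw [map_smul, Complex.real_smul] at this
      exact this
    have h := intervalIntegral.integral_eq_sub_of_hasDerivAt (a := -Real.pi) (b := Real.pi)
      (fun θ _ => hd θ) (Continuous.intervalIntegrable (continuous_const.mul
        ((hDc.comp (continuous_const.mul hEc)).clm_apply (continuous_const.mul hEc))) _ _)
    rw [intervalIntegral.integral_const_mul, intervalIntegral.integral_of_le
      (by linarith [Real.pi_pos]), ← integral_Ioc_eq_integral_Ioo] at *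
    have hE1 : E Real.pi = E (-Real.pi) := by simp [hE]
    rw [hE1, sub_self] at h
    exact (mul_eq_zero.1 h).resolve_left (by exact_mod_cast hr.ne')
  have hpolar : ∫ z, z⁻¹ * dbar 1 φ z = -(Real.pi : ℂ) * φ 0 := by
    rw [← Complex.integral_comp_polarCoord_symm]
    -- The Jacobian cancels the modulus of the pole, and the remaining phase turns `∂̄` into a
    -- radial and an angular derivative. The radial part integrates to `-φ 0` on every ray, the
    -- angular part to zero on every circle.
    have hfun : ∀ p ∈ polarCoord.target, p.1 • ((Complex.polarCoord.symm p)⁻¹ *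
        dbar 1 φ (Complex.polarCoord.symm p)) =
        (1 / 2 : ℂ) * fderiv ℝ φ (p.1 * E p.2) (E p.2) +
        (1 / 2 * Complex.I : ℂ) * fderiv ℝ φ (p.1 * E p.2) (Complex.I * E p.2) := by
      intro p hp
      have hp0 : (p.1 : ℂ) ≠ 0 := by exact_mod_cast (mem_Ioi.1 hp.1).ne'
      have hE2 : (starRingEnd ℂ) (E p.2) = (E p.2)⁻¹ :=
        (Complex.inv_eq_conj (norm_cos_add_sin_mul_I p.2)).symm
      have := fderiv_add_I_mul_fderiv φ (p.1 * E p.2) (E p.2)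
      rw [hE2] at this
      rw [Complex.polarCoord_symm_apply, Complex.real_smul]
      simp only [← hE] at *
      change (p.1 : ℂ) * ((p.1 * E p.2)⁻¹ * dbar 1 φ (p.1 * E p.2)) = _
      rw [mul_inv]
      calc (p.1 : ℂ) * ((p.1 : ℂ)⁻¹ * (E p.2)⁻¹ * dbar 1 φ (p.1 * E p.2))
          = (E p.2)⁻¹ * dbar 1 φ (p.1 * E p.2) := by field_simp
        _ = _ := by rw [← this]; ring
    rw [setIntegral_congr_fun polarCoord.open_target.measurableSet hfun, polarCoord_target]
    have i1 := hint E hEc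
    have i2 := hint (fun θ => Complex.I * E θ) (continuous_const.mul hEc)
    rw [integral_add (i1.const_mul _) (i2.const_mul _), integral_const_mul, integral_const_mul]
    have e2 : ∫ p in T, fderiv ℝ φ (p.1 * E p.2) (Complex.I * E p.2) = 0 := by
      rw [Measure.volume_eq_prod] at i2 ⊢
      rw [setIntegral_prod _ i2, setIntegral_congr_fun measurableSet_Ioi
        (g := fun _ => (0 : ℂ)) fun r hr => hθ_int r hr]
      simp
    have e1 : ∫ p in T, fderiv ℝ φ (p.1 * E p.2) (E p.2) = -(2 * Real.pi : ℂ) * φ 0 := by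
      rw [Measure.volume_eq_prod, hT, ← Measure.prod_restrict] at *
      rw [IntegrableOn, ← Measure.prod_restrict] at i1
      rw [integral_prod_symm _ i1]
      simp only [hr_int, integral_const]
      simp only [MeasurableSet.univ, measureReal_restrict_apply, univ_inter, Real.volume_real_Ioo,
        Complex.real_smul]
      rw [max_eq_left (by linarith [Real.pi_pos])]
      push_cast
      ring
    rw [e1, e2]
    ring
  have hpi : (Real.pi : ℂ) ≠ 0 := by exact_mod_cast Real.pi_ne_zero
  simp_rw [mul_inv, mul_assoc]
  rw [integral_const_mul, hpolar]
  field_simp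

end Pompeiu

/-! ### The Cauchy transform of `L^p` functions, `p > 2` -/

section CauchyTransform

open scoped Convolution
open ContinuousLinearMap (mul lsmul)

/-- If `‖a‖ ≤ ‖b‖`, then `‖a - b‖ ≤ 2‖b‖`; splitting `‖a - b‖` into its powers `α` and `1 - α`, the
second is absorbed by `‖b‖`. The conventions `0⁻¹ = 0` and `0 ^ (-(1 + α)) = 0` are compatible with
the estimate. It gives the Hölder continuity of the Cauchy transform. -/
theorem norm_inv_sub_inv_le (a b : ℂ) {α : ℝ} (h0 : 0 < α) (h1 : α < 1) :
    ‖a⁻¹ - b⁻¹‖ ≤ 2 * ‖a - b‖ ^ α * (‖a‖ ^ (-(1 + α)) + ‖b‖ ^ (-(1 + α))) := by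
  wlog hab : ‖a‖ ≤ ‖b‖ generalizing a b
  · have := this b a (le_of_not_ge hab)
    rwa [norm_sub_rev, norm_sub_rev a b, add_comm]
  rcases eq_or_ne b 0 with rfl | hb
  · have : a = 0 := by simpa using hab
    subst this
    simp only [sub_self, norm_zero]
    positivity
  have hb0 : 0 < ‖b‖ := norm_pos_iff.2 hb
  rcases eq_or_ne a 0 with rfl | ha
  · simp only [inv_zero, zero_sub, norm_neg, norm_inv]
    have : ‖b‖ ^ α * ‖b‖ ^ (-(1 + α)) = ‖b‖⁻¹ := by
      rw [← Real.rpow_add hb0, ← Real.rpow_neg_one]; congr 1; ring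
    have h2 : 0 ≤ ‖b‖ ^ α * ‖(0 : ℂ)‖ ^ (-(1 + α)) := by positivity
    have h3 : 0 ≤ ‖b‖⁻¹ := by positivity
    nlinarith
  have ha0 : 0 < ‖a‖ := norm_pos_iff.2 ha
  rcases eq_or_ne a b with rfl | hne
  · simp only [sub_self, norm_zero]
    positivity
  have hd : 0 < ‖a - b‖ := norm_pos_iff.2 (sub_ne_zero.2 hne)
  have hd2 : ‖a - b‖ ≤ 2 * ‖b‖ := (norm_sub_le a b).trans (by linarith)
  have e1 : ‖a⁻¹ - b⁻¹‖ = ‖a - b‖ * (‖a‖⁻¹ * ‖b‖⁻¹) := by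
    rw [inv_sub_inv ha hb, norm_div, norm_mul, norm_sub_rev, div_eq_mul_inv, mul_inv]
  have e2 : ‖a - b‖ = ‖a - b‖ ^ α * ‖a - b‖ ^ (1 - α) := by
    rw [← Real.rpow_add hd]; simp
  have e3 : ‖a - b‖ ^ (1 - α) ≤ 2 * ‖b‖ ^ (1 - α) := by
    calc ‖a - b‖ ^ (1 - α) ≤ (2 * ‖b‖) ^ (1 - α) :=
          Real.rpow_le_rpow hd.le hd2 (by linarith)
      _ = 2 ^ (1 - α) * ‖b‖ ^ (1 - α) := Real.mul_rpow (by norm_num) hb0.le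
      _ ≤ 2 * ‖b‖ ^ (1 - α) := by
          gcongr
          calc (2 : ℝ) ^ (1 - α) ≤ 2 ^ (1 : ℝ) :=
                Real.rpow_le_rpow_of_exponent_le (by norm_num) (by linarith)
            _ = 2 := Real.rpow_one 2
  have e4 : ‖b‖ ^ (1 - α) * ‖b‖⁻¹ ≤ ‖a‖ ^ (-α) := by
    rw [← Real.rpow_neg_one, ← Real.rpow_add hb0]
    calc ‖b‖ ^ (1 - α + -1) = ‖b‖ ^ (-α) := by congr 1; ring
      _ ≤ ‖a‖ ^ (-α) := Real.rpow_le_rpow_of_nonpos ha0 hab (by linarith)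
  have e5 : ‖a‖ ^ (-α) * ‖a‖⁻¹ = ‖a‖ ^ (-(1 + α)) := by
    rw [← Real.rpow_neg_one, ← Real.rpow_add ha0]; congr 1; ring
  calc ‖a⁻¹ - b⁻¹‖ = ‖a - b‖ ^ α * (‖a - b‖ ^ (1 - α) * ‖b‖⁻¹) * ‖a‖⁻¹ := by
        rw [e1]; nth_rewrite 1 [e2]; ring
    _ ≤ ‖a - b‖ ^ α * (2 * ‖b‖ ^ (1 - α) * ‖b‖⁻¹) * ‖a‖⁻¹ := by gcongr
    _ = 2 * ‖a - b‖ ^ α * ((‖b‖ ^ (1 - α) * ‖b‖⁻¹) * ‖a‖⁻¹) := by ring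
    _ ≤ 2 * ‖a - b‖ ^ α * (‖a‖ ^ (-α) * ‖a‖⁻¹) := by gcongr
    _ = 2 * ‖a - b‖ ^ α * ‖a‖ ^ (-(1 + α)) := by rw [e5]
    _ ≤ _ := by gcongr; exact le_add_of_nonneg_right (by positivity)

theorem integrableOn_norm_rpow_neg {s : ℝ} (hs : s < 2) (R : ℝ) :
    IntegrableOn (fun z : ℂ => ‖z‖ ^ (-s)) (ball 0 R) := by
  rw [integrableOn_fun_norm_addHaar volume (f := fun y : ℝ => y ^ (-s)),
    Complex.finrank_real_complex]
  rcases le_or_gt R 0 with hR | hR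
  · simp [Ioo_eq_empty_of_le hR]
  refine ((intervalIntegral.integrableOn_Ioo_rpow_iff (s := 1 - s) hR).2 (by linarith)).congr_fun
    (fun y hy => ?_) measurableSet_Ioo
  have : y ^ (1 - s) = y ^ (1 : ℝ) * y ^ (-s) := by
    rw [← Real.rpow_add hy.1]; congr 1
  simp [this]

/-- Hölder's inequality against a power of the distance to a point of the disc. -/
theorem exists_lintegral_mul_norm_rpow_le {p q : ℝ} (hpq : p.HolderConjugate q) {s : ℝ}
    (hs : s * q < 2) : ∃ C : ℝ≥0, ∀ A : ℂ → ℂ, AEStronglyMeasurable A →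
      (∀ t, t ∉ ball (0 : ℂ) 2 → A t = 0) → ∀ w ∈ disc,
        ∫⁻ t, ‖A t‖ₑ * ENNReal.ofReal (‖w - t‖ ^ (-s)) ≤
          C * eLpNorm A (ENNReal.ofReal p) := by
  -- Since `‖w‖ < 1` and `‖t‖ < 2`, the difference `w - t` stays in the ball of radius 3, so the
  -- bound does not depend on `w`.
  set J : ℝ≥0∞ := ∫⁻ t in ball (0 : ℂ) 3, ENNReal.ofReal (‖t‖ ^ (-s)) ^ q with hJ
  have hJfin : J < ⊤ := by
    have h := (integrableOn_norm_rpow_neg hs 3).2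
    rw [hasFiniteIntegral_iff_enorm] at h
    refine lt_of_le_of_lt (lintegral_mono fun t => ?_) h
    rw [ENNReal.ofReal_rpow_of_nonneg (by positivity) hpq.symm.nonneg,
      ← Real.rpow_mul (norm_nonneg _), ← ofReal_norm,
      Real.norm_of_nonneg (by positivity), neg_mul]
  have hCfin : J ^ (1 / q) ≠ ⊤ :=
    (ENNReal.rpow_lt_top_of_nonneg (one_div_nonneg.2 hpq.symm.nonneg) hJfin.ne).ne
  refine ⟨(J ^ (1 / q)).toNNReal, fun A hA hA0 w hw => ?_⟩
  rw [ENNReal.coe_toNNReal hCfin]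
  have hp : ENNReal.ofReal p ≠ 0 := by simpa using hpq.pos
  have hmeas : Measurable fun t : ℂ => ENNReal.ofReal (‖w - t‖ ^ (-s)) := by fun_prop
  have h1 : ∫⁻ t, ‖A t‖ₑ * ENNReal.ofReal (‖w - t‖ ^ (-s)) =
      ∫⁻ t, ‖A t‖ₑ * (ball w 3).indicator (fun t => ENNReal.ofReal (‖w - t‖ ^ (-s))) t := by
    congr 1 with t
    by_cases ht : t ∈ ball w 3
    · rw [indicator_of_mem ht]
    · rw [hA0 t, enorm_zero, zero_mul, zero_mul]
      intro h
      apply ht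
      have h1 : ‖t‖ < 2 := by simpa using h
      have h2 : ‖w‖ < 1 := hw
      rw [mem_ball, dist_eq_norm]
      exact (norm_sub_le _ _).trans_lt (by linarith)
  rw [h1]
  refine (ENNReal.lintegral_mul_le_Lp_mul_Lq volume hpq hA.enorm
    (hmeas.indicator measurableSet_ball).aemeasurable).trans (le_of_eq ?_)
  rw [mul_comm, eLpNorm_eq_lintegral_rpow_enorm_toReal hp ENNReal.ofReal_ne_top,
    ENNReal.toReal_ofReal hpq.nonneg]
  congr 2
  have h2 : ∀ t, (ball w 3).indicator (fun t => ENNReal.ofReal (‖w - t‖ ^ (-s))) t ^ q =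
      (ball (0 : ℂ) 3).indicator (fun t => ENNReal.ofReal (‖t‖ ^ (-s)) ^ q) (w - t) := by
    intro t
    have h3 : t ∈ ball w 3 ↔ w - t ∈ ball (0 : ℂ) 3 := by
      rw [mem_ball, dist_comm, dist_eq_norm, mem_ball_zero_iff]
    by_cases ht : t ∈ ball w 3
    · rw [indicator_of_mem ht, indicator_of_mem (h3.1 ht)]
    · rw [indicator_of_notMem ht, indicator_of_notMem (fun h => ht (h3.2 h)),
        ENNReal.zero_rpow_of_pos hpq.symm.pos]
  simp_rw [h2]
  rw [lintegral_sub_left_eq_self, lintegral_indicator measurableSet_ball]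

/-- The Cauchy kernel, the fundamental solution of `∂/∂z̄`. -/
noncomputable def cauchyKernel (z : ℂ) : ℂ := ((Real.pi : ℂ) * z)⁻¹

/-- The Cauchy transform, the convolution with the Cauchy kernel. -/
noncomputable def cauchyTransform (A : ℂ → ℂ) (w : ℂ) : ℂ := ∫ t, A t * cauchyKernel (w - t)

theorem measurable_cauchyKernel : Measurable cauchyKernel := by
  unfold cauchyKernel; fun_prop

theorem norm_cauchyKernel_le (z : ℂ) : ‖cauchyKernel z‖ ≤ ‖z‖ ^ (-(1 : ℝ)) := by
  rw [cauchyKernel, mul_inv, norm_mul, Real.rpow_neg_one, norm_inv, norm_inv, Complex.norm_real,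
    Real.norm_of_nonneg Real.pi_pos.le]
  refine mul_le_of_le_one_left (by positivity) (inv_le_one_of_one_le₀ ?_)
  linarith [Real.pi_gt_three]

theorem norm_cauchyKernel_sub_le (a b : ℂ) {α : ℝ} (h0 : 0 < α) (h1 : α < 1) :
    ‖cauchyKernel a - cauchyKernel b‖ ≤
      2 * ‖a - b‖ ^ α * (‖a‖ ^ (-(1 + α)) + ‖b‖ ^ (-(1 + α))) := by
  refine le_trans ?_ (norm_inv_sub_inv_le a b h0 h1)
  rw [cauchyKernel, cauchyKernel, mul_inv, mul_inv, ← mul_sub, norm_mul, norm_inv,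
    Complex.norm_real, Real.norm_of_nonneg Real.pi_pos.le]
  refine mul_le_of_le_one_left (by positivity) (inv_le_one_of_one_le₀ ?_)
  linarith [Real.pi_gt_three]

theorem locallyIntegrable_cauchyKernel : LocallyIntegrable cauchyKernel := by
  rw [locallyIntegrable_iff]
  intro K hK
  obtain ⟨R, hR⟩ := hK.isBounded.subset_ball 0
  refine IntegrableOn.mono_set ?_ hR
  exact Integrable.mono' (integrableOn_norm_rpow_neg one_lt_two R)
    measurable_cauchyKernel.aestronglyMeasurable (ae_of_all _ norm_cauchyKernel_le)

theorem cauchyTransform_eq_convolution (A : ℂ → ℂ) :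
    cauchyTransform A = cauchyKernel ⋆[mul ℝ ℂ, volume] A := by
  ext w
  rw [convolution_eq_swap]
  simp [cauchyTransform, mul_comm]

theorem contDiff_cauchyTransform {A : ℂ → ℂ} (hA : ContDiff ℝ ∞ A) (hc : HasCompactSupport A) :
    ContDiff ℝ ∞ (cauchyTransform A) := by
  rw [cauchyTransform_eq_convolution]
  exact hc.contDiff_convolution_right _ locallyIntegrable_cauchyKernel hA

theorem dbar_cauchyTransform {A : ℂ → ℂ} (hA : ContDiff ℝ ∞ A) (hc : HasCompactSupport A) (w : ℂ) :
    dbar 1 (cauchyTransform A) w = A w := by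
  rw [cauchyTransform_eq_convolution, dbar_convolution locallyIntegrable_cauchyKernel hA hc,
    convolution_def]
  have h1 : ContDiff ℝ ∞ fun t => A (w - t) := hA.comp (contDiff_const.sub contDiff_id)
  have h2 : HasCompactSupport fun t => A (w - t) :=
    hc.comp_homeomorph (Homeomorph.subLeft w)
  have h3 := integral_inv_mul_dbar h1 h2
  simp only [dbar_comp_sub_left (hA.differentiable (by simp)), mul_neg, integral_neg, neg_inj,
    sub_zero] at h3
  exact h3

/-- The basic estimates of the Cauchy transform of an `L^p` function, `p > 2`, supported in a fixed
ball: bounds for the function and its Hölder seminorm on the unit disc. -/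
theorem exists_cauchyTransform_bound {p : ℝ} (hp : 2 < p) :
    ∃ C : ℝ≥0, ∃ α : ℝ, 0 < α ∧ ∀ A : ℂ → ℂ, MemLp A (ENNReal.ofReal p) →
      (∀ t, t ∉ ball (0 : ℂ) 2 → A t = 0) →
        (∫⁻ t, ‖A t‖ₑ ≤ C * eLpNorm A (ENNReal.ofReal p)) ∧
        (∀ w ∈ disc, Integrable (fun t => A t * cauchyKernel (w - t))) ∧
        (∀ w ∈ disc, ‖cauchyTransform A w‖ₑ ≤ C * eLpNorm A (ENNReal.ofReal p)) ∧
        ∀ w ∈ disc, ∀ w' ∈ disc, ‖cauchyTransform A w - cauchyTransform A w'‖ₑ ≤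
          C * eLpNorm A (ENNReal.ofReal p) * ENNReal.ofReal (‖w - w'‖ ^ α) := by
  set q := p.conjExponent with hq
  have hpq : p.HolderConjugate q := Real.HolderConjugate.conjExponent (by linarith)
  have hq0 : 0 < q := hpq.symm.pos
  have hq1 : 1 < q := hpq.symm.lt
  have hq2 : q < 2 := by
    rw [hq, Real.conjExponent, div_lt_iff₀ (by linarith)]; linarith
  -- Integrability of the kernel to the power `q` needs `(1 + α) q < 2`, that is `α < 2 / q - 1`.
  -- This is half of that bound, and it is positive because `p > 2` gives `q < 2`.
  set α := 1 / q - 1 / 2 with hα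
  have hα0 : 0 < α := by
    have : 1 / 2 < 1 / q := one_div_lt_one_div_of_lt hq0 hq2
    linarith
  have hα1 : α < 1 := by
    have : 1 / q < 1 := by rw [div_lt_one hq0]; exact hq1
    linarith
  have hαq : (1 + α) * q < 2 := by
    rw [hα]; field_simp; linarith
  obtain ⟨C0, h0⟩ := exists_lintegral_mul_norm_rpow_le hpq (s := 0) (by linarith)
  obtain ⟨C1, h1⟩ := exists_lintegral_mul_norm_rpow_le hpq (s := 1) (by linarith)
  obtain ⟨C2, h2⟩ := exists_lintegral_mul_norm_rpow_le hpq hαq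
  -- `C0` serves the `L¹` bound, `C1` the sup bound, and `4 * C2` the Hölder bound: a factor 2 from
  -- the kernel estimate for each of its two terms.
  refine ⟨C0 + C1 + 4 * C2, α, hα0, fun A hA hA0 => ?_⟩
  set N := eLpNorm A (ENNReal.ofReal p) with hN
  have hNfin : N < ⊤ := hA.2
  have hm : ∀ w, AEStronglyMeasurable fun t => A t * cauchyKernel (w - t) := fun w =>
    hA.1.mul
      (measurable_cauchyKernel.comp (measurable_const.sub measurable_id)).aestronglyMeasurable
  have hle : ∀ w ∈ disc, ∫⁻ t, ‖A t * cauchyKernel (w - t)‖ₑ ≤ C1 * N := by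
    intro w hw
    refine le_trans (lintegral_mono fun t => ?_) (h1 A hA.1 hA0 w hw)
    rw [enorm_mul]
    gcongr
    rw [← ofReal_norm]
    exact ENNReal.ofReal_le_ofReal (norm_cauchyKernel_le _)
  have hint : ∀ w ∈ disc, Integrable (fun t => A t * cauchyKernel (w - t)) := fun w hw =>
    ⟨hm w, lt_of_le_of_lt (hle w hw) (ENNReal.mul_lt_top ENNReal.coe_lt_top hNfin)⟩
  refine ⟨?_, hint, fun w hw => ?_, fun w hw w' hw' => ?_⟩
  · have := h0 A hA.1 hA0 0 (by simp [disc])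
    simp only [neg_zero, Real.rpow_zero, ENNReal.ofReal_one, mul_one] at this
    refine this.trans ?_
    gcongr
    exact mod_cast (le_add_right (le_add_right le_rfl))
  · refine (enorm_integral_le_lintegral_enorm _).trans ((hle w hw).trans ?_)
    gcongr
    exact mod_cast (le_add_right (le_add_left le_rfl))
  · rw [cauchyTransform, cauchyTransform, ← integral_sub (hint w hw) (hint w' hw')]
    refine (enorm_integral_le_lintegral_enorm _).trans ?_
    have hpt : ∀ t, ‖A t * cauchyKernel (w - t) - A t * cauchyKernel (w' - t)‖ₑ ≤
        ENNReal.ofReal (2 * ‖w - w'‖ ^ α) * (‖A t‖ₑ * ENNReal.ofReal (‖w - t‖ ^ (-(1 + α)))) +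
        ENNReal.ofReal (2 * ‖w - w'‖ ^ α) *
          (‖A t‖ₑ * ENNReal.ofReal (‖w' - t‖ ^ (-(1 + α)))) := by
      intro t
      rw [← mul_sub, enorm_mul, ← mul_add, ← mul_add, mul_left_comm]
      gcongr
      rw [← ENNReal.ofReal_add (by positivity) (by positivity),
        ← ENNReal.ofReal_mul (by positivity),
        ← ofReal_norm]
      refine ENNReal.ofReal_le_ofReal ((norm_cauchyKernel_sub_le _ _ hα0 hα1).trans ?_)
      rw [sub_sub_sub_cancel_right]
    have hmm : ∀ w : ℂ, AEMeasurable
        fun t => ‖A t‖ₑ * ENNReal.ofReal (‖w - t‖ ^ (-(1 + α))) := fun w =>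
      hA.1.enorm.mul (by fun_prop)
    refine (lintegral_mono hpt).trans ?_
    rw [lintegral_add_left' ((hmm w).const_mul _), lintegral_const_mul'' _ (hmm w),
      lintegral_const_mul'' _ (hmm w')]
    calc _ ≤ ENNReal.ofReal (2 * ‖w - w'‖ ^ α) * (C2 * N) +
          ENNReal.ofReal (2 * ‖w - w'‖ ^ α) * (C2 * N) := by
          gcongr
          · exact h2 A hA.1 hA0 w hw
          · exact h2 A hA.1 hA0 w' hw'
      _ = ((4 * C2 : ℝ≥0) : ℝ≥0∞) * N * ENNReal.ofReal (‖w - w'‖ ^ α) := by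
          rw [ENNReal.ofReal_mul (by norm_num)]
          push_cast
          rw [ENNReal.ofReal_ofNat]
          ring
      _ ≤ _ := by
          gcongr
          exact le_add_left le_rfl

end CauchyTransform

/-! ### Integrating factors with uniform bounds -/

section IntegratingFactor

theorem volume_disc_lt_top : volume disc < ⊤ := by
  rw [disc_eq_ball]; exact measure_ball_lt_top

theorem continuousOn_of_holder {u : ℂ → ℂ} {U : Set ℂ} {C α : ℝ} (hα : 0 < α)
    (h : ∀ w ∈ U, ∀ w' ∈ U, ‖u w - u w'‖ ≤ C * ‖w - w'‖ ^ α) : ContinuousOn u U := by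
  intro w hw
  rw [ContinuousWithinAt, tendsto_iff_norm_sub_tendsto_zero]
  have h1 : Tendsto (fun x : ℂ => C * ‖x - w‖ ^ α) (𝓝[U] w) (𝓝 0) := by
    have : Continuous fun x : ℂ => C * ‖x - w‖ ^ α := by
      refine continuous_const.mul (Continuous.rpow_const (by fun_prop) fun _ => Or.inr hα.le)
    have h2 := this.tendsto w
    simp only [sub_self, norm_zero, Real.zero_rpow hα.ne', mul_zero] at h2
    exact h2.mono_left nhdsWithin_le_nhds
  refine squeeze_zero' (Eventually.of_forall fun _ => norm_nonneg _) ?_ h1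
  filter_upwards [self_mem_nhdsWithin] with x hx using h x hx w hw

theorem exists_smooth_cutoff_disc : ∃ χ : ℂ → ℂ, ContDiff ℝ ∞ χ ∧ HasCompactSupport χ ∧
    (∀ z ∈ disc, χ z = 1) ∧ (∀ z, z ∉ ball (0 : ℂ) 2 → χ z = 0) ∧ ∀ z, ‖χ z‖ ≤ 1 := by
  let b : ContDiffBump (0 : ℂ) := ⟨1, 2, one_pos, one_lt_two⟩
  refine ⟨fun z => (b z : ℂ), Complex.ofRealCLM.contDiff.comp b.contDiff,
    b.hasCompactSupport.comp_left (g := Complex.ofReal) rfl, fun z hz => ?_, fun z hz => ?_,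
    fun z => ?_⟩
  · have : z ∈ closedBall (0 : ℂ) b.rIn := by simpa using (show ‖z‖ < 1 from hz).le
    simp [b.one_of_mem_closedBall this]
  · have : b z = 0 := by
      apply b.zero_of_le_dist
      simpa using hz
    simp [this]
  · rw [Complex.norm_real, Real.norm_of_nonneg b.nonneg]
    exact b.le_one

/-- The cutoff confines the approximants to the fixed ball on which the Cauchy transform estimates
are uniform. It does not increase the error, because it equals 1 where `A` may be nonzero and has
norm at most 1. -/
theorem exists_smooth_approx_of_memLp {p : ℝ} (hp : 2 < p) {A : ℂ → ℂ}
    (hA : MemLp A (ENNReal.ofReal p)) (hA0 : ∀ t, t ∉ disc → A t = 0) {ε : ℝ} (hε : 0 < ε) :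
    ∃ D : ℂ → ℂ, ContDiff ℝ ∞ D ∧ HasCompactSupport D ∧ (∀ t, t ∉ ball (0 : ℂ) 2 → D t = 0) ∧
      eLpNorm (D - A) (ENNReal.ofReal p) ≤ ENNReal.ofReal ε := by
  obtain ⟨χ, hχ1, hχ2, hχ3, hχ4, hχ5⟩ := exists_smooth_cutoff_disc
  obtain ⟨g, hg1, hg2, hg3⟩ := hA.exist_eLpNorm_sub_le ENNReal.ofReal_ne_top
    (by rw [← ENNReal.ofReal_one]; exact ENNReal.ofReal_le_ofReal (by linarith)) hε
  refine ⟨fun z => χ z * g z, hχ1.mul hg2, hχ2.mul_right, fun t ht => by simp [hχ4 t ht], ?_⟩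
  refine le_trans (eLpNorm_mono fun t => ?_) hg3
  have h1 : A t = χ t * A t := by
    by_cases ht : t ∈ disc
    · rw [hχ3 t ht, one_mul]
    · rw [hA0 t ht, mul_zero]
  simp only [Pi.sub_apply]
  nth_rewrite 1 [h1]
  rw [← mul_sub, norm_mul, norm_sub_rev]
  exact mul_le_of_le_one_left (norm_nonneg _) (hχ5 t)

/-- The Cauchy transform of `A` is an integrating factor for solutions of `∂̄f = A f`. -/
theorem isIntegratingFactor_cauchyTransform {p : ℝ} (hp : 2 < p) {A f : ℂ → ℂ}
    (hA : MemLp A (ENNReal.ofReal p)) (hA0 : ∀ t, t ∉ disc → A t = 0) (hf : ContinuousOn f disc)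
    (h : HasWeakDbar disc 1 f fun w => A w * f w) :
    IsIntegratingFactor f (cauchyTransform A) := by
  obtain ⟨C, α, hα, hC⟩ := exists_cauchyTransform_bound hp
  have hd2 : disc ⊆ ball (0 : ℂ) 2 := by
    rw [disc_eq_ball]; exact ball_subset_ball (by norm_num)
  have hA2 : ∀ t, t ∉ ball (0 : ℂ) 2 → A t = 0 := fun t ht => hA0 t fun h => ht (hd2 h)
  obtain ⟨-, hAint, hAb, hAh⟩ := hC A hA hA2
  set N := eLpNorm A (ENNReal.ofReal p) with hN
  have hNfin : (C : ℝ≥0∞) * N ≠ ⊤ := (ENNReal.mul_lt_top ENNReal.coe_lt_top hA.2).ne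
  have hcont : ContinuousOn (cauchyTransform A) disc := by
    refine continuousOn_of_holder (C := (C * N).toReal) hα fun w hw w' hw' => ?_
    have := hAh w hw w' hw'
    rw [← ENNReal.ofReal_toReal hNfin, ← ENNReal.ofReal_mul ENNReal.toReal_nonneg,
      ← ofReal_norm, ENNReal.ofReal_le_ofReal_iff (by positivity)] at this
    exact this
  refine ⟨hcont, ?_⟩
  have hgc : ContinuousOn (fun w => Complex.exp (-cauchyTransform A w) * f w) disc :=
    (Complex.continuous_exp.comp_continuousOn hcont.neg).mul hf
  refine differentiableOn_of_hasWeakDbar_zero isOpen_disc hgc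
    ⟨hgc.locallyIntegrableOn isOpen_disc.measurableSet, locallyIntegrableOn_const _, fun φ hφ => ?_⟩
  simp only [zero_mul, integral_zero, neg_zero]
  -- For smooth `D n` the factor `exp (-cauchyTransform (D n))` may multiply a test function. The
  -- equation for `f` then leaves only an error containing `D n - A`, which tends to zero in `L¹`.
  choose D hD1 hD2 hD3 hD4 using fun n : ℕ =>
    exists_smooth_approx_of_memLp hp hA hA0 (ε := 1 / ((n : ℝ) + 1)) Nat.one_div_pos_of_nat
  have hDm : ∀ n, MemLp (D n) (ENNReal.ofReal p) := fun n =>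
    (hD1 n).continuous.memLp_of_hasCompactSupport (hD2 n)
  have hDA : ∀ n, MemLp (D n - A) (ENNReal.ofReal p) := fun n => (hDm n).sub hA
  have hDA0 : ∀ n t, t ∉ ball (0 : ℂ) 2 → (D n - A) t = 0 := fun n t ht => by
    simp [hD3 n t ht, hA2 t ht]
  have hsub : ∀ n, ∀ w ∈ disc, cauchyTransform (D n) w - cauchyTransform A w =
      cauchyTransform (D n - A) w := by
    intro n w hw
    rw [cauchyTransform, cauchyTransform, ← integral_sub
      ((hC (D n) (hDm n) (hD3 n)).2.1 w hw) (hAint w hw), cauchyTransform]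
    congr 1 with t
    simp [sub_mul]
  have hsub_le : ∀ n, ∀ w ∈ disc, ‖cauchyTransform (D n) w - cauchyTransform A w‖ ≤
      C * (1 / ((n : ℝ) + 1)) := by
    intro n w hw
    have h1 := (hC _ (hDA n) (hDA0 n)).2.2.1 w hw
    rw [← hsub n w hw] at h1
    have h2 := h1.trans (mul_le_mul_right (hD4 n) (C : ℝ≥0∞))
    rw [← ofReal_norm, ← ENNReal.ofReal_coe_nnreal, ← ENNReal.ofReal_mul C.coe_nonneg,
      ENNReal.ofReal_le_ofReal_iff (by positivity)] at h2
    exact h2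
  have hL1 : ∀ n, ∫ t, ‖(D n - A) t‖ ≤ C * (1 / ((n : ℝ) + 1)) := by
    intro n
    have h1 := (hC _ (hDA n) (hDA0 n)).1.trans (mul_le_mul_right (hD4 n) (C : ℝ≥0∞))
    rw [integral_norm_eq_lintegral_enorm (hDA n).1]
    rw [← ENNReal.ofReal_coe_nnreal, ← ENNReal.ofReal_mul C.coe_nonneg] at h1
    exact ENNReal.toReal_le_of_le_ofReal (by positivity) h1
  have hL1i : ∀ n, Integrable (D n - A) := by
    intro n
    refine ⟨(hDA n).1, lt_of_le_of_lt (hC _ (hDA n) (hDA0 n)).1 ?_⟩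
    exact ENNReal.mul_lt_top ENNReal.coe_lt_top (hDA n).2
  have hlim0 : Tendsto (fun n : ℕ => (C : ℝ) * (1 / ((n : ℝ) + 1))) atTop (𝓝 0) := by
    simpa using tendsto_one_div_add_atTop_nhds_zero_nat.const_mul (C : ℝ)
  have hptlim : ∀ w ∈ disc, Tendsto (fun n => cauchyTransform (D n) w) atTop
      (𝓝 (cauchyTransform A w)) := by
    intro w hw
    rw [tendsto_iff_norm_sub_tendsto_zero]
    exact squeeze_zero (fun _ => norm_nonneg _) (fun n => hsub_le n w hw) hlim0
  set M : ℝ := (C * N).toReal + C with hM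
  have hexp : ∀ n, ∀ w ∈ disc, ‖Complex.exp (-cauchyTransform (D n) w)‖ ≤ Real.exp M := by
    intro n w hw
    rw [Complex.norm_exp]
    refine Real.exp_le_exp.2 ((Complex.re_le_norm _).trans ?_)
    rw [norm_neg]
    have h1 := hAb w hw
    rw [← ENNReal.ofReal_toReal hNfin, ← ofReal_norm,
      ENNReal.ofReal_le_ofReal_iff ENNReal.toReal_nonneg] at h1
    have h2 := hsub_le n w hw
    have h3 : (C : ℝ) * (1 / ((n : ℝ) + 1)) ≤ C := by
      refine mul_le_of_le_one_right C.2 ?_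
      rw [div_le_one (by positivity)]
      linarith [(Nat.cast_nonneg n : (0 : ℝ) ≤ n)]
    have h4 := norm_sub_norm_le (cauchyTransform (D n) w) (cauchyTransform A w)
    linarith
  have hfφ : Continuous fun w => f w * φ w :=
    continuous_mul_of_tsupport_subset isOpen_disc hf hφ.continuous hφ.2.2
  obtain ⟨Q, hQ⟩ := hfφ.bounded_above_of_compact_support hφ.2.1.mul_left
  have hdφ := hφ.dbar (1 : ℂ)
  -- the identity for the smooth approximations
  have hid : ∀ n, ∫ w, Complex.exp (-cauchyTransform (D n) w) * f w * dbar 1 φ w =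
      ∫ w, Complex.exp (-cauchyTransform (D n) w) * (f w * φ w) * (D n - A) w := by
    intro n
    have hs := contDiff_cauchyTransform (hD1 n) (hD2 n)
    have hes : ContDiff ℝ ∞ fun w => Complex.exp (-cauchyTransform (D n) w) := hs.neg.cexp
    have hψ := hφ.mul_left hes
    have h1 := h.2.2 _ hψ
    have hdb : ∀ w, dbar 1 (fun w => Complex.exp (-cauchyTransform (D n) w) * φ w) w =
        Complex.exp (-cauchyTransform (D n) w) * dbar 1 φ w -
          Complex.exp (-cauchyTransform (D n) w) * D n w * φ w := by
      intro w
      have hdiff := hs.differentiable (by simp) w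
      have h2 : HasDerivAt (fun y => Complex.exp (-y)) (-Complex.exp (-cauchyTransform (D n) w))
          (cauchyTransform (D n) w) := by
        simpa using (hasDerivAt_neg (cauchyTransform (D n) w)).cexp
      rw [dbar_mul (hes.differentiable (by simp) w) (hφ.differentiable w),
        dbar_comp_of_hasDerivAt h2 hdiff, dbar_cauchyTransform (hD1 n) (hD2 n)]
      ring
    simp only [hdb] at h1
    have i1 : Integrable fun w => Complex.exp (-cauchyTransform (D n) w) * f w * dbar 1 φ w := by
      have := hdφ.integrable_mul (μ := volume) (u := fun w =>
        Complex.exp (-cauchyTransform (D n) w) * f w)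
        ((hes.continuous.continuousOn.mul hf).locallyIntegrableOn isOpen_disc.measurableSet)
      exact this
    have i2 : Integrable fun w => Complex.exp (-cauchyTransform (D n) w) * (f w * φ w) * D n w :=
      ((hes.continuous.mul hfφ).mul (hD1 n).continuous).integrable_of_hasCompactSupport
        (hD2 n).mul_left
    have i3 : Integrable fun w =>
        Complex.exp (-cauchyTransform (D n) w) * (f w * φ w) * (D n - A) w := by
      refine (hL1i n).bdd_mul (c := Real.exp M * Q) (hes.continuous.mul hfφ).aestronglyMeasurable
        (ae_of_all _ fun w => ?_)
      rw [norm_mul]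
      by_cases hw : w ∈ disc
      · exact mul_le_mul (hexp n w hw) (hQ w) (norm_nonneg _) (Real.exp_pos _).le
      · rw [image_eq_zero_of_notMem_tsupport fun hh => hw (hφ.2.2 hh), mul_zero, norm_zero,
          mul_zero]
        exact mul_nonneg (Real.exp_pos _).le ((norm_nonneg _).trans (hQ 0))
    have e1 : ∫ w, f w * (Complex.exp (-cauchyTransform (D n) w) * dbar 1 φ w -
          Complex.exp (-cauchyTransform (D n) w) * D n w * φ w) =
        (∫ w, Complex.exp (-cauchyTransform (D n) w) * f w * dbar 1 φ w) -
        ∫ w, Complex.exp (-cauchyTransform (D n) w) * (f w * φ w) * D n w := by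
      rw [← integral_sub i1 i2]
      congr 1 with w
      ring
    have e2 : ∫ w, A w * f w * (Complex.exp (-cauchyTransform (D n) w) * φ w) =
        (∫ w, Complex.exp (-cauchyTransform (D n) w) * (f w * φ w) * D n w) -
        ∫ w, Complex.exp (-cauchyTransform (D n) w) * (f w * φ w) * (D n - A) w := by
      rw [← integral_sub i2 i3]
      congr 1 with w
      simp only [Pi.sub_apply]
      ring
    rw [e1, e2] at h1
    linear_combination h1
  have hR : Tendsto (fun n => ∫ w, Complex.exp (-cauchyTransform (D n) w) * (f w * φ w) *
      (D n - A) w) atTop (𝓝 0) := by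
    refine squeeze_zero_norm (a := fun n : ℕ => Real.exp M * Q * (C * (1 / ((n : ℝ) + 1))))
      (fun n => ?_) (by simpa using hlim0.const_mul (Real.exp M * Q))
    calc _ ≤ ∫ w, Real.exp M * Q * ‖(D n - A) w‖ := by
          refine norm_integral_le_of_norm_le ((hL1i n).norm.const_mul _) (ae_of_all _ fun w => ?_)
          rw [norm_mul, norm_mul]
          by_cases hw : w ∈ disc
          · gcongr
            · exact hexp n w hw
            · exact hQ w
          · rw [image_eq_zero_of_notMem_tsupport fun hh => hw (hφ.2.2 hh), mul_zero, norm_zero,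
              mul_zero, zero_mul]
            have := (norm_nonneg _).trans (hQ 0)
            positivity
      _ ≤ _ := by
          rw [integral_const_mul]
          exact mul_le_mul_of_nonneg_left (hL1 n)
            (mul_nonneg (Real.exp_pos _).le ((norm_nonneg _).trans (hQ 0)))
  have hLlim : Tendsto (fun n => ∫ w, Complex.exp (-cauchyTransform (D n) w) * f w * dbar 1 φ w)
      atTop (𝓝 (∫ w, Complex.exp (-cauchyTransform A w) * f w * dbar 1 φ w)) := by
    have hfd : Continuous fun w => f w * dbar 1 φ w :=
      continuous_mul_of_tsupport_subset isOpen_disc hf hdφ.continuous hdφ.2.2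
    have hfdi : Integrable fun w => f w * dbar 1 φ w :=
      hfd.integrable_of_hasCompactSupport hdφ.2.1.mul_left
    refine tendsto_integral_of_dominated_convergence
      (fun w => Real.exp M * ‖f w * dbar 1 φ w‖) (fun n => ?_) (hfdi.norm.const_mul _)
      (fun n => ae_of_all _ fun w => ?_) (ae_of_all _ fun w => ?_)
    · simp only [mul_assoc]
      have hs := contDiff_cauchyTransform (hD1 n) (hD2 n)
      exact (hs.continuous.neg.cexp.mul hfd).aestronglyMeasurable
    · rw [mul_assoc, norm_mul]
      by_cases hw : w ∈ disc
      · gcongr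
        exact hexp n w hw
      · rw [image_eq_zero_of_notMem_tsupport fun hh => hw (hdφ.2.2 hh), mul_zero, norm_zero,
          mul_zero, mul_zero]
    · by_cases hw : w ∈ disc
      · exact ((((hptlim w hw).neg).cexp).mul_const _).mul_const _
      · rw [image_eq_zero_of_notMem_tsupport fun hh => hw (hdφ.2.2 hh)]
        simp
  simp only [hid] at hLlim
  exact tendsto_nhds_unique hLlim hR

/-- Uniform integrating factors for the equations `∂̄f = A f` with `A` bounded in `L^p`, `p > 2`. -/
theorem exists_integratingFactor {p : ℝ≥0∞} (hp : 2 < p) (M : ℝ≥0) :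
    ∃ C α : ℝ, 0 ≤ C ∧ 0 < α ∧ ∀ A : ℂ → ℂ, MemLp A p (volume.restrict disc) →
      eLpNorm A p (volume.restrict disc) ≤ M → ∃ u : ℂ → ℂ, (∀ w ∈ disc, ‖u w‖ ≤ C) ∧
        (∀ w ∈ disc, ∀ w' ∈ disc, ‖u w - u w'‖ ≤ C * ‖w - w'‖ ^ α) ∧
        ∀ f, ContinuousOn f disc → HasWeakDbar disc 1 f (fun w => A w * f w) →
          IsIntegratingFactor f u := by
  -- The estimates concern finite exponents; on the disc, which has finite measure, `p = ⊤` may be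
  -- lowered to 3.
  obtain ⟨p', hp'2, hp'⟩ : ∃ p' : ℝ, 2 < p' ∧ ENNReal.ofReal p' ≤ p := by
    rcases eq_or_ne p ⊤ with rfl | h
    · exact ⟨3, by norm_num, le_top⟩
    · refine ⟨p.toReal, ?_, ENNReal.ofReal_toReal_le⟩
      simpa using (ENNReal.toReal_lt_toReal (by simp) h).2 hp
  obtain ⟨C, α, hα, hC⟩ := exists_cauchyTransform_bound hp'2
  -- The Hölder factor between the exponents. For `p = ⊤` the conventions `p.toReal = 0` and `1 / 0
  -- = 0` give the right power.
  set V : ℝ≥0∞ := volume disc ^ (1 / p' - 1 / p.toReal) with hV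
  have : IsFiniteMeasure (volume.restrict disc) := ⟨by simpa using volume_disc_lt_top⟩
  have hVfin : V ≠ ⊤ := by
    refine (ENNReal.rpow_lt_top_of_nonneg ?_ volume_disc_lt_top.ne).ne
    rcases eq_or_ne p ⊤ with rfl | h
    · simp; linarith
    · rw [sub_nonneg]
      exact one_div_le_one_div_of_le (by linarith) (by
        simpa [ENNReal.toReal_ofReal (by linarith : (0 : ℝ) ≤ p')] using
          ENNReal.toReal_mono h hp')
  have hTfin : (C : ℝ≥0∞) * (M * V) ≠ ⊤ := by finiteness
  refine ⟨(C * (M * V)).toReal, α, ENNReal.toReal_nonneg, hα, fun A hA hAM => ?_⟩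
  set A' := disc.indicator A with hA'
  have hmeas : MeasurableSet disc := isOpen_disc.measurableSet
  have hnorm : eLpNorm A' (ENNReal.ofReal p') ≤ M * V := by
    rw [hA', eLpNorm_indicator_eq_eLpNorm_restrict hmeas]
    refine (eLpNorm_le_eLpNorm_mul_rpow_measure_univ hp' hA.1).trans ?_
    rw [ENNReal.toReal_ofReal (by linarith), Measure.restrict_apply_univ]
    gcongr
  have hmem : MemLp A' (ENNReal.ofReal p') := by
    rw [hA', memLp_indicator_iff_restrict hmeas]
    exact hA.mono_exponent hp'
  have h0 : ∀ t, t ∉ disc → A' t = 0 := fun t ht => indicator_of_notMem ht A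
  have hd2 : disc ⊆ ball (0 : ℂ) 2 := by
    rw [disc_eq_ball]; exact ball_subset_ball (by norm_num)
  obtain ⟨-, -, h1, h2⟩ := hC A' hmem fun t ht => h0 t fun h => ht (hd2 h)
  have hbd : (C : ℝ≥0∞) * eLpNorm A' (ENNReal.ofReal p') ≤ C * (M * V) := by gcongr
  refine ⟨cauchyTransform A', fun w hw => ?_, fun w hw w' hw' => ?_, fun f hf hfA => ?_⟩
  · have := (h1 w hw).trans hbd
    rwa [← ENNReal.ofReal_toReal hTfin, ← ofReal_norm,
      ENNReal.ofReal_le_ofReal_iff ENNReal.toReal_nonneg] at this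
  · have := (h2 w hw w' hw').trans (mul_le_mul_left hbd _)
    rwa [← ENNReal.ofReal_toReal hTfin, ← ofReal_norm, ← ENNReal.ofReal_mul
      ENNReal.toReal_nonneg, ENNReal.ofReal_le_ofReal_iff (by positivity)] at this
  · refine isIntegratingFactor_cauchyTransform hp'2 hmem h0 hf ⟨hfA.1, ?_, fun φ hφ => ?_⟩
    · refine (locallyIntegrableOn_congr ((ae_restrict_iff' hmeas).2 (ae_of_all _ fun w hw => ?_))).1
        hfA.2.1
      simp only [hA', indicator_of_mem hw]
    · rw [hfA.2.2 φ hφ]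
      congr 2 with w
      by_cases hw : w ∈ disc
      · simp only [hA', indicator_of_mem hw]
      · rw [image_eq_zero_of_notMem_tsupport fun hh => hw (hφ.2.2 hh), mul_zero, mul_zero]

end IntegratingFactor

/-! ### Coordinate lines and Fubini's theorem -/

section Slices

variable {n : ℕ}

theorem isOpen_polydisc (n : ℕ) : IsOpen (polydisc n) := by
  have : polydisc n = ⋂ j, {z | ‖z j‖ < 1} := by ext z; simp [polydisc]
  rw [this]
  exact isOpen_iInter_of_finite fun j => isOpen_lt (by fun_prop) continuous_const

theorem volume_polydisc_lt_top (n : ℕ) : volume (polydisc n) < ⊤ := by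
  refine lt_of_le_of_lt (measure_mono fun z hz => ?_)
    (measure_closedBall_lt_top (x := (0 : Fin n → ℂ)) (r := 1))
  rw [mem_closedBall_zero_iff, pi_norm_le_iff_of_nonneg zero_le_one]
  exact fun j => (hz j).le

theorem update_mem_polydisc {z : Fin n → ℂ} (hz : z ∈ polydisc n) (j : Fin n) {w : ℂ}
    (hw : w ∈ disc) : Function.update z j w ∈ polydisc n := by
  intro i
  rcases eq_or_ne i j with rfl | h
  · rw [Function.update_self]
    exact hw
  · rw [Function.update_of_ne h]
    exact hz i

theorem mem_disc_of_update_mem {z : Fin n → ℂ} {j : Fin n} {w : ℂ}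
    (h : Function.update z j w ∈ polydisc n) : w ∈ disc := by
  have := h j
  rwa [Function.update_self] at this

theorem continuousOn_slice {f : (Fin n → ℂ) → ℂ} (hf : ContinuousOn f (polydisc n)) (j : Fin n)
    {z : Fin n → ℂ} (hz : z ∈ polydisc n) : ContinuousOn (slice f j z) disc := by
  have hc : Continuous fun w : ℂ => Function.update z j w := continuous_const.update j continuous_id
  exact hf.comp hc.continuousOn fun _ hw => update_mem_polydisc hz j hw

theorem dbar_slice {φ : (Fin n → ℂ) → ℂ} (hφ : Differentiable ℝ φ) (j : Fin n) (z : Fin n → ℂ)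
    (w : ℂ) : dbar 1 (slice φ j z) w = dbar (Pi.single j 1) φ (Function.update z j w) := by
  have h : HasFDerivAt (slice φ j z) _ w :=
    (hφ (Function.update z j w)).hasFDerivAt.comp w (hasFDerivAt_update z w)
  have h1 : ∀ v : ℂ, (ContinuousLinearMap.pi (Pi.single j (ContinuousLinearMap.id ℝ ℂ)) :
      ℂ →L[ℝ] (Fin n → ℂ)) v = Pi.single j v := by
    intro v
    ext i
    rcases eq_or_ne i j with rfl | hij
    · simp
    · simp [hij]
  have h2 : (Complex.I • Pi.single j 1 : Fin n → ℂ) = Pi.single j Complex.I := by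
    rw [← Pi.single_smul]; simp
  rw [dbar, dbar, h.fderiv, h2]
  simp only [ContinuousLinearMap.comp_apply, h1, smul_eq_mul, mul_one]

theorem IsTestFunction.slice {φ : (Fin n → ℂ) → ℂ} (hφ : IsTestFunction (polydisc n) φ) (j : Fin n)
    (z : Fin n → ℂ) : IsTestFunction disc (DbarLog.slice φ j z) := by
  have hc : Continuous fun w : ℂ => Function.update z j w := continuous_const.update j continuous_id
  have hsub : tsupport (DbarLog.slice φ j z) ⊆ (fun w => Function.update z j w) ⁻¹' tsupport φ :=
    closure_minimal (fun w hw => subset_tsupport φ hw) ((isClosed_tsupport φ).preimage hc)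
  refine ⟨hφ.1.comp (contDiff_update _ z j), ?_, fun w hw => ?_⟩
  · refine (hφ.2.1.isCompact.image (continuous_apply j)).of_isClosed_subset (isClosed_tsupport _)
      fun w hw => ⟨_, hsub hw, by simp⟩
  · exact mem_disc_of_update_mem (hφ.2.2 (hsub hw))

theorem integral_eq_integral_slices {k : ℕ} (j : Fin (k + 1)) {F : (Fin (k + 1) → ℂ) → ℂ}
    (hF : Integrable F) :
    ∫ z, F z = ∫ y : Fin k → ℂ, ∫ w : ℂ, F (j.insertNth (α := fun _ => ℂ) w y) := by
  have h := (volume_preserving_piFinSuccAbove (fun _ : Fin (k + 1) => ℂ) j).symm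
  rw [← h.integral_comp', Measure.volume_eq_prod, integral_prod_symm]
  · rfl
  · exact h.integrable_comp_of_integrable hF

theorem lintegral_eq_lintegral_slices {k : ℕ} (j : Fin (k + 1)) {F : (Fin (k + 1) → ℂ) → ℝ≥0∞}
    (hF : Measurable F) :
    ∫⁻ z, F z = ∫⁻ y : Fin k → ℂ, ∫⁻ w : ℂ, F (j.insertNth (α := fun _ => ℂ) w y) := by
  have h := (volume_preserving_piFinSuccAbove (fun _ : Fin (k + 1) => ℂ) j).symm
  rw [← h.lintegral_comp hF, Measure.volume_eq_prod, lintegral_prod_symm]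
  · rfl
  · exact (hF.comp h.measurable).aemeasurable

theorem insertNth_eq_update {k : ℕ} (j : Fin (k + 1)) (w : ℂ) (y : Fin k → ℂ) :
    j.insertNth (α := fun _ => ℂ) w y =
      Function.update (j.insertNth (α := fun _ => ℂ) 0 y) j w := by
  simp

theorem insertNth_mem_polydisc {k : ℕ} (j : Fin (k + 1)) {w : ℂ} {y : Fin k → ℂ} :
    j.insertNth (α := fun _ => ℂ) w y ∈ polydisc (k + 1) ↔ w ∈ disc ∧ y ∈ polydisc k := by
  simp only [polydisc, mem_ofPred_eq, Fin.forall_iff_succAbove j, Fin.insertNth_apply_same,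
    Fin.insertNth_apply_succAbove, disc]

end Slices

/-! ### Square integrable coefficients by Riesz representation -/

section Representation

/-- The bound makes `T` factor through the range of `ι`, which need not be closed, so Hahn–Banach
precedes Riesz. In the application `ι φ = f φ`. -/
theorem exists_inner_representation {W H : Type*} [AddCommGroup W] [Module ℂ W]
    [NormedAddCommGroup H] [InnerProductSpace ℂ H] [CompleteSpace H] (ι : W →ₗ[ℂ] H)
    (T : W →ₗ[ℂ] ℂ) (C : ℝ) (h : ∀ φ, ‖T φ‖ ≤ C * ‖ι φ‖) :
    ∃ b : H, ∀ φ, T φ = inner ℂ b (ι φ) := by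
  obtain ⟨s, hs⟩ := ι.rangeRestrict.exists_rightInverse_of_surjective ι.range_rangeRestrict
  have hs' : ∀ x : LinearMap.range ι, ι (s x) = x := fun x => by
    have := congrArg Subtype.val (LinearMap.congr_fun hs x)
    simpa using this
  let L : LinearMap.range ι →L[ℂ] ℂ := (T ∘ₗ s).mkContinuous C fun x => by
    have := h (s x)
    rw [hs'] at this
    simpa using this
  obtain ⟨G, hG, -⟩ := exists_extension_norm_eq _ L
  refine ⟨(InnerProductSpace.toDual ℂ H).symm G, fun φ => ?_⟩
  rw [InnerProductSpace.toDual_symm_apply]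
  have h1 := hG ⟨ι φ, LinearMap.mem_range_self ι φ⟩
  simp only at h1
  rw [h1]
  -- `T` vanishes on the kernel of `ι`, so the choice of the section `s` is immaterial.
  have h2 : T (φ - s ⟨ι φ, LinearMap.mem_range_self ι φ⟩) = 0 := by
    have := h (φ - s ⟨ι φ, LinearMap.mem_range_self ι φ⟩)
    rw [map_sub ι, hs', sub_self, norm_zero, mul_zero] at this
    exact norm_le_zero_iff.1 this
  rw [map_sub, sub_eq_zero] at h2
  exact h2

variable {n : ℕ}

theorem integrable_mul_dbar {f φ : (Fin n → ℂ) → ℂ} (hf : ContinuousOn f (polydisc n))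
    (hφ : IsTestFunction (polydisc n) φ) (e : Fin n → ℂ) : Integrable fun z => f z * dbar e φ z :=
  (continuous_mul_of_tsupport_subset (isOpen_polydisc n) hf (hφ.dbar e).continuous
    (hφ.dbar e).2.2).integrable_of_hasCompactSupport (hφ.dbar e).2.1.mul_left

/-- Keeping the product `g φ` on the right, instead of `φ` alone, is what makes the function
represented later a coefficient of `f` rather than its derivative. -/
theorem enorm_integral_slice_le {M : ℝ≥0∞} {A g φ : ℂ → ℂ}
    (hA : AEStronglyMeasurable A (volume.restrict disc))
    (hAM : eLpNorm A 2 (volume.restrict disc) ≤ M) (hg : ContinuousOn g disc)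
    (hw : HasWeakDbar disc 1 g fun w => A w * g w) (hφ : IsTestFunction disc φ) :
    ‖∫ w, g w * dbar 1 φ w‖ₑ ≤ M * (∫⁻ w, ‖g w * φ w‖ₑ ^ (2 : ℝ)) ^ (1 / 2 : ℝ) := by
  have hc : Continuous fun w => g w * φ w :=
    continuous_mul_of_tsupport_subset isOpen_disc hg hφ.continuous hφ.2.2
  have h1 : ∫ w, A w * g w * φ w = ∫ w in disc, A w * (g w * φ w) := by
    rw [setIntegral_eq_integral_of_forall_compl_eq_zero]
    · simp only [mul_assoc]
    · intro w hwd
      rw [image_eq_zero_of_notMem_tsupport fun hh => hwd (hφ.2.2 hh), mul_zero, mul_zero]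
  rw [hw.2.2 φ hφ, enorm_neg, h1]
  refine (enorm_integral_le_lintegral_enorm _).trans ?_
  simp only [enorm_mul (A _)]
  refine (ENNReal.lintegral_mul_le_Lp_mul_Lq _ (p := 2) (q := 2)
    (Real.holderConjugate_iff.2 ⟨by norm_num, by norm_num⟩) hA.enorm
    hc.measurable.enorm.aemeasurable).trans ?_
  rw [eLpNorm_eq_lintegral_rpow_enorm_toReal two_ne_zero ENNReal.ofNat_ne_top,
    ENNReal.toReal_ofNat] at hAM
  gcongr
  exact Measure.restrict_le_self

/-- Only the uniform bound for the line integrals enters. The coefficients `A` are given line by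
line, without measurability in the line, and never have to be assembled into one function. -/
theorem enorm_integral_mul_dbar_le {p : ℝ≥0∞} (hp : 2 < p) {f : (Fin n → ℂ) → ℂ}
    (hf : ContinuousOn f (polydisc n)) (hL : ConditionL p f) :
    ∃ C : ℝ≥0, ∀ j, ∀ φ, IsTestFunction (polydisc n) φ →
      ‖∫ z, f z * dbar (Pi.single j 1) φ z‖ₑ ≤ C * eLpNorm (fun z => f z * φ z) 2 volume := by
  rcases n with _ | k
  · exact ⟨0, fun j => j.elim0⟩
  obtain ⟨M, hM⟩ := hL
  have : IsFiniteMeasure (volume.restrict disc) := ⟨by simpa using volume_disc_lt_top⟩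
  set V : ℝ≥0∞ := volume disc ^ (1 / 2 - 1 / p.toReal) with hV
  have hVfin : V ≠ ⊤ := by
    refine (ENNReal.rpow_lt_top_of_nonneg ?_ volume_disc_lt_top.ne).ne
    rcases eq_or_ne p ⊤ with rfl | h
    · simp
    · rw [sub_nonneg]
      exact one_div_le_one_div_of_le (by norm_num) (by simpa using ENNReal.toReal_mono h hp.le)
  have hPfin : volume (polydisc k) ^ (1 / 2 : ℝ) ≠ ⊤ :=
    (ENNReal.rpow_lt_top_of_nonneg (by norm_num) (volume_polydisc_lt_top k).ne).ne
  have hfin : M * V * volume (polydisc k) ^ (1 / 2 : ℝ) ≠ ⊤ := by finiteness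
  refine ⟨(M * V * volume (polydisc k) ^ (1 / 2 : ℝ)).toNNReal, fun j φ hφ => ?_⟩
  rw [ENNReal.coe_toNNReal hfin]
  have hc : Continuous fun z => f z * φ z :=
    continuous_mul_of_tsupport_subset (isOpen_polydisc _) hf hφ.continuous hφ.2.2
  set G : (Fin k → ℂ) → ℝ≥0∞ := fun y =>
    ∫⁻ w, ‖f (j.insertNth (α := fun _ => ℂ) w y) * φ (j.insertNth (α := fun _ => ℂ) w y)‖ₑ ^ (2 : ℝ)
    with hG
  have hGm : Measurable G := by
    have hins : Continuous fun p : (Fin k → ℂ) × ℂ =>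
        (j.insertNth (α := fun _ => ℂ) p.2 p.1 : Fin (k + 1) → ℂ) :=
      Continuous.finInsertNth j continuous_snd continuous_fst
    have : Measurable fun p : (Fin k → ℂ) × ℂ => ‖f (j.insertNth (α := fun _ => ℂ) p.2 p.1) *
        φ (j.insertNth (α := fun _ => ℂ) p.2 p.1)‖ₑ ^ (2 : ℝ) :=
      ((hc.comp hins).measurable.enorm).pow_const _
    exact this.lintegral_prod_right'
  have hslice : ∀ y : Fin k → ℂ, ‖∫ w : ℂ, f (j.insertNth (α := fun _ => ℂ) w y) *
      dbar (Pi.single j 1) φ (j.insertNth (α := fun _ => ℂ) w y)‖ₑ ≤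
      (polydisc k).indicator (fun y => M * V * G y ^ (1 / 2 : ℝ)) y := by
    intro y
    by_cases hy : y ∈ polydisc k
    · rw [indicator_of_mem hy]
      set z : Fin (k + 1) → ℂ := j.insertNth (α := fun _ => ℂ) 0 y with hz
      have hzm : z ∈ polydisc (k + 1) :=
        (insertNth_mem_polydisc j).2 ⟨by simp [disc], hy⟩
      obtain ⟨A, hA, hAM, hw⟩ := hM j z hzm
      have hA2 : eLpNorm A 2 (volume.restrict disc) ≤ M * V := by
        refine (eLpNorm_le_eLpNorm_mul_rpow_measure_univ hp.le hA.1).trans ?_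
        rw [Measure.restrict_apply_univ, ENNReal.toReal_ofNat]
        gcongr
      have h := enorm_integral_slice_le hA.1 hA2 (continuousOn_slice hf j hzm) hw (hφ.slice j z)
      simp only [dbar_slice hφ.differentiable, slice] at h
      have he : ∀ w, j.insertNth (α := fun _ => ℂ) w y = Function.update z j w :=
        fun w => insertNth_eq_update j w y
      simp only [hG, he]
      exact h
    · have h0 : ∀ w : ℂ, dbar (Pi.single j 1) φ (j.insertNth (α := fun _ => ℂ) w y) = 0 := fun w =>
        image_eq_zero_of_notMem_tsupport fun hh =>
          hy ((insertNth_mem_polydisc j).1 ((hφ.dbar _).2.2 hh)).2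
      simp [h0]
  rw [integral_eq_integral_slices j (integrable_mul_dbar hf hφ _)]
  calc _ ≤ ∫⁻ y, (polydisc k).indicator (fun y => M * V * G y ^ (1 / 2 : ℝ)) y :=
        (enorm_integral_le_lintegral_enorm _).trans (lintegral_mono hslice)
    -- The factor 1 prepares Cauchy–Schwarz over the base, which has finite volume.
    _ = M * V * ∫⁻ y in polydisc k, 1 * G y ^ (1 / 2 : ℝ) := by
        rw [lintegral_indicator (isOpen_polydisc k).measurableSet,
          lintegral_const_mul _ (hGm.pow_const _)]
        simp
    _ ≤ M * V * ((∫⁻ y in polydisc k, 1 ^ (2 : ℝ)) ^ (1 / 2 : ℝ) *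
          (∫⁻ y in polydisc k, (G y ^ (1 / 2 : ℝ)) ^ (2 : ℝ)) ^ (1 / 2 : ℝ)) := by
        gcongr
        exact ENNReal.lintegral_mul_le_Lp_mul_Lq _
          (Real.holderConjugate_iff.2 ⟨by norm_num, by norm_num⟩) aemeasurable_const
          (hGm.pow_const _).aemeasurable
    _ ≤ M * V * (volume (polydisc k) ^ (1 / 2 : ℝ) * (∫⁻ y, G y) ^ (1 / 2 : ℝ)) := by
        have h1 : ∀ y, (G y ^ (1 / 2 : ℝ)) ^ (2 : ℝ) = G y := fun y => by
          rw [← ENNReal.rpow_mul]; norm_num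
        simp only [h1, ENNReal.one_rpow, lintegral_const, Measure.restrict_apply_univ, one_mul]
        gcongr
        exact Measure.restrict_le_self
    _ = _ := by
        rw [eLpNorm_eq_lintegral_rpow_enorm_toReal two_ne_zero ENNReal.ofNat_ne_top,
          ENNReal.toReal_ofNat, lintegral_eq_lintegral_slices j (hc.measurable.enorm.pow_const _)]
        simp only [hG, mul_assoc]

/-- The test functions as a subspace. -/
def testFunctions (n : ℕ) : Submodule ℂ ((Fin n → ℂ) → ℂ) where
  carrier := {φ | IsTestFunction (polydisc n) φ}
  add_mem' {φ ψ} hφ hψ := ⟨hφ.1.add hψ.1, hφ.2.1.add hψ.2.1,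
    (tsupport_add φ ψ).trans (union_subset hφ.2.2 hψ.2.2)⟩
  zero_mem' := ⟨contDiff_const, HasCompactSupport.zero, by simp [tsupport]⟩
  smul_mem' c φ hφ := (IsTestFunction.mul_left hφ (ψ := fun _ => c) contDiff_const :)

/-- The coefficients of `∂̄f / f` are square integrable on the whole polydisc. -/
theorem exists_weakDbar_quotient {p : ℝ≥0∞} (hp : 2 < p) {f : (Fin n → ℂ) → ℂ}
    (hf : ContinuousOn f (polydisc n)) (hL : ConditionL p f) (j : Fin n) :
    ∃ b : (Fin n → ℂ) → ℂ, MemLp b 2 (volume.restrict (polydisc n)) ∧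
      ∀ φ, IsTestFunction (polydisc n) φ →
        ∫ z, f z * dbar (Pi.single j 1) φ z = -∫ z, b z * f z * φ z := by
  obtain ⟨C, hC⟩ := enorm_integral_mul_dbar_le hp hf hL
  have hc : ∀ φ : testFunctions n, Continuous fun z => f z * φ.1 z := fun φ =>
    continuous_mul_of_tsupport_subset (isOpen_polydisc n) hf φ.2.continuous φ.2.2.2
  have hm : ∀ φ : testFunctions n, MemLp (fun z => f z * φ.1 z) 2
      (volume.restrict (polydisc n)) := fun φ =>
    ((hc φ).memLp_of_hasCompactSupport φ.2.2.1.mul_left).restrict _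
  let ι : testFunctions n →ₗ[ℂ] Lp ℂ 2 (volume.restrict (polydisc n)) :=
    { toFun := fun φ => (hm φ).toLp
      map_add' := fun φ ψ => by
        rw [← MemLp.toLp_add]
        congr 1
        ext z
        exact mul_add _ _ _
      map_smul' := fun c φ => by
        rw [← MemLp.toLp_const_smul]
        congr 1
        ext z
        exact mul_left_comm _ _ _ }
  let T : testFunctions n →ₗ[ℂ] ℂ :=
    { toFun := fun φ => -∫ z, f z * dbar (Pi.single j 1) φ.1 z
      map_add' := fun φ ψ => by
        rw [← neg_add, ← integral_add (integrable_mul_dbar hf φ.2 _)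
          (integrable_mul_dbar hf ψ.2 _)]
        congr 2 with z
        rw [← mul_add]
        congr 1
        exact dbar_add (φ.2.differentiable z) (ψ.2.differentiable z)
      map_smul' := fun c φ => by
        rw [RingHom.id_apply, smul_eq_mul, mul_neg, ← integral_const_mul]
        congr 2 with z
        rw [mul_left_comm]
        congr 1
        exact dbar_const_mul c (φ.2.differentiable z) }
  have hT : ∀ φ, ‖T φ‖ ≤ C * ‖ι φ‖ := by
    intro φ
    have h1 := hC j φ.1 φ.2
    have h2 : eLpNorm (fun z => f z * φ.1 z) 2 volume =
        eLpNorm (fun z => f z * φ.1 z) 2 (volume.restrict (polydisc n)) := by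
      rw [eLpNorm_restrict_eq_of_support_subset]
      intro z hz
      exact φ.2.2.2 (subset_tsupport φ.1 (right_ne_zero_of_mul hz))
    have h3 : ‖ι φ‖ = (eLpNorm (fun z => f z * φ.1 z) 2 (volume.restrict (polydisc n))).toReal :=
      Lp.norm_toLp _ (hm φ)
    rw [h3]
    rw [h2] at h1
    have h4 := ENNReal.toReal_mono (ENNReal.mul_ne_top ENNReal.coe_ne_top (hm φ).2.ne) h1
    rw [ENNReal.toReal_mul, toReal_enorm] at h4
    simpa [T] using h4
  obtain ⟨b, hb⟩ := exists_inner_representation ι T C hT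
  -- The inner product is conjugate linear in its first argument, hence the conjugate.
  refine ⟨fun z => (starRingEnd ℂ) (b z), (Lp.memLp b).star, fun φ hφ => ?_⟩
  have h1 := hb ⟨φ, hφ⟩
  have h2 : -∫ z, f z * dbar (Pi.single j 1) φ z = inner ℂ b (ι ⟨φ, hφ⟩) := h1
  rw [← neg_eq_iff_eq_neg, h2, L2.inner_def]
  have h3 : ∫ z, (starRingEnd ℂ) (b z) * f z * φ z =
      ∫ z in polydisc n, (starRingEnd ℂ) (b z) * f z * φ z := by
    refine (setIntegral_eq_integral_of_forall_compl_eq_zero fun z hz => ?_).symm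
    rw [image_eq_zero_of_notMem_tsupport fun hh => hz (hφ.2.2 hh), mul_zero]
  rw [h3]
  refine integral_congr_ae ?_
  filter_upwards [(hm ⟨φ, hφ⟩).coeFn_toLp] with z hz
  change inner ℂ (b z) ((hm ⟨φ, hφ⟩).toLp _ z) = _
  rw [hz, RCLike.inner_apply]
  ring

end Representation

/-! ### Existence and square integrability of trivial extensions -/

section TrivialExtension

variable {n : ℕ} {f : (Fin n → ℂ) → ℂ} {B : Fin n → (Fin n → ℂ) → ℂ}

theorem isOpen_nonvanishing (hf : ContinuousOn f (polydisc n)) :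
    IsOpen {z | z ∈ polydisc n ∧ f z ≠ 0} :=
  hf.isOpen_inter_preimage (isOpen_polydisc n) isOpen_ne

theorem locallyIntegrableOn_of_memLp_two {U : Set (Fin n → ℂ)} {b : (Fin n → ℂ) → ℂ}
    (hU : IsOpen U) (hb : MemLp b 2 (volume.restrict U)) : LocallyIntegrableOn b U := by
  rw [locallyIntegrableOn_iff hU.isLocallyClosed]
  intro k hkU hk
  have h1 : MemLp b 2 (volume.restrict k) := hb.mono_measure (Measure.restrict_mono hkU le_rfl)
  have : IsFiniteMeasure (volume.restrict k) := ⟨by simpa using hk.measure_lt_top⟩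
  exact h1.integrable (by norm_num)

theorem exists_isTrivialExtension {p : ℝ≥0∞} (hp : 2 < p) (hf : ContinuousOn f (polydisc n))
    (hL : ConditionL p f) : ∃ B : Fin n → (Fin n → ℂ) → ℂ, IsTrivialExtension f B := by
  classical
  choose b hb1 hb2 using exists_weakDbar_quotient hp hf hL
  have hU := isOpen_nonvanishing hf
  have hsub : {z | z ∈ polydisc n ∧ f z ≠ 0} ⊆ polydisc n := fun z hz => hz.1
  -- Resetting the coefficient to zero on the zero set does not change its product with `f`, so the
  -- weak equation survives.
  have heq : ∀ j z, (if f z = 0 then 0 else b j z) * f z = b j z * f z := by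
    intro j z
    by_cases h : f z = 0 <;> simp [h]
  refine ⟨fun j z => if f z = 0 then 0 else b j z, fun j => ⟨?_, ?_, fun φ hφ => ?_⟩,
    fun j z _ h => if_pos h⟩
  · exact (hf.mono hsub).locallyIntegrableOn hU.measurableSet
  · simp only [heq]
    exact ((locallyIntegrableOn_of_memLp_two (isOpen_polydisc n) (hb1 j)).mono_set hsub).mul_continuousOn
      (hf.mono hsub)
      hU.isLocallyClosed
  · simp only [heq]
    exact hb2 j φ (hφ.mono hsub)

/-- All trivial extensions of `∂̄f / f` are square integrable. -/
theorem IsTrivialExtension.memLp {p : ℝ≥0∞} (hp : 2 < p) (hf : ContinuousOn f (polydisc n))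
    (hL : ConditionL p f) (hB : IsTrivialExtension f B) (j : Fin n) :
    MemLp (B j) 2 (volume.restrict (polydisc n)) := by
  obtain ⟨b, hb1, hb2⟩ := exists_weakDbar_quotient hp hf hL j
  set U := {z | z ∈ polydisc n ∧ f z ≠ 0} with hUdef
  have hU : IsOpen U := isOpen_nonvanishing hf
  have hsub : U ⊆ polydisc n := fun z hz => hz.1
  have hbf : LocallyIntegrableOn (fun z => b z * f z) U :=
    ((locallyIntegrableOn_of_memLp_two (isOpen_polydisc n) hb1).mono_set hsub).mul_continuousOn
      (hf.mono hsub)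
      hU.isLocallyClosed
  have hBf := (hB.1 j).2.1
  -- Both products are the weak derivative of `f` on `U`, hence equal almost everywhere; dividing by
  -- `f ≠ 0` then compares the coefficients.
  have hae : ∀ᵐ z, z ∈ U → B j z * f z - b z * f z = 0 := by
    refine hU.ae_eq_zero_of_integral_contDiff_smul_eq_zero (hBf.sub hbf) fun g hg hgc hgs => ?_
    have hφ : IsTestFunction U fun z => (g z : ℂ) := by
      have hts : tsupport (fun z => (g z : ℂ)) ⊆ tsupport g :=
        closure_mono fun z hz h => hz (by simp [h])
      exact ⟨Complex.ofRealCLM.contDiff.comp hg, hgc.of_isClosed_subset (isClosed_tsupport _) hts,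
        hts.trans hgs⟩
    have h1 := (hB.1 j).2.2 _ hφ
    rw [hb2 _ (hφ.mono hsub), neg_inj] at h1
    have h2 : ∀ z, g z • (B j z * f z - b z * f z) = B j z * f z * g z - b z * f z * g z := by
      intro z
      rw [Complex.real_smul]
      ring
    simp only [h2]
    rw [integral_sub (hφ.integrable_mul hBf) (hφ.integrable_mul hbf), h1, sub_self]
  have hBb : B j =ᵐ[volume.restrict (polydisc n)] U.indicator b := by
    filter_upwards [ae_restrict_of_ae hae, ae_restrict_mem (isOpen_polydisc n).measurableSet]
      with z hz hzp
    by_cases h : f z = 0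
    · rw [hB.2 j z hzp h, indicator_of_notMem fun hh => hh.2 h]
    · have hzU : z ∈ U := ⟨hzp, h⟩
      rw [indicator_of_mem hzU]
      have := hz hzU
      rw [← sub_mul] at this
      exact sub_eq_zero.1 ((mul_eq_zero.1 this).resolve_right h)
  exact (hb1.indicator hU.measurableSet).ae_eq hBb.symm

end TrivialExtension

/-! ### Closedness off the zero set -/

section Closedness

variable {E : Type*} [NormedAddCommGroup E] [NormedSpace ℂ E] [MeasureSpace E] [BorelSpace E]
  [FiniteDimensional ℂ E] [(volume : Measure E).IsAddHaarMeasure]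

theorem dbar_inv_mul {E : Type*} [NormedAddCommGroup E] [NormedSpace ℂ E] {v ψ : E → ℂ} {z : E}
    (hv : DifferentiableAt ℝ v z) (hψ : DifferentiableAt ℝ ψ z) (h0 : v z ≠ 0) (e : E) :
    dbar e (fun z => (v z)⁻¹ * ψ z) z =
      (v z)⁻¹ * dbar e ψ z - (v z)⁻¹ ^ 2 * (dbar e v z * ψ z) := by
  rw [dbar_mul (φ := fun z => (v z)⁻¹) (hv.inv h0) hψ,
    dbar_comp_of_hasDerivAt (hasDerivAt_inv h0) hv]
  ring

/-- The logarithmic form of a smooth function is `∂̄`-closed. -/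
theorem integral_dbar_div_symm {U : Set E} {v φ : E → ℂ} (hv : ContDiff ℝ ∞ v)
    (hφ : IsTestFunction U φ) (hv0 : ∀ z ∈ tsupport φ, v z ≠ 0) (e e' : E) :
    ∫ z, (v z)⁻¹ * (dbar e' v z * dbar e φ z - dbar e v z * dbar e' φ z) = 0 := by
  have hW : IsOpen {z | v z ≠ 0} := isOpen_ne.preimage hv.continuous
  have hinv : ContDiffOn ℝ ∞ (fun z => (v z)⁻¹) {z | v z ≠ 0} :=
    hv.contDiffOn.inv fun z hz => hz
  have hψ : IsTestFunction U fun z => (v z)⁻¹ * φ z :=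
    hφ.mul_left_of_contDiffOn hW hinv hv0
  -- Testing the derivatives of `v` against `v⁻¹ φ` leaves second derivatives, which are symmetric.
  -- In the expanded difference the `v⁻²` terms cancel.
  have key : ∀ a b : E, ∫ z, dbar b v z * dbar a (fun z => (v z)⁻¹ * φ z) z =
      -∫ z, dbar a (dbar b v) z * ((v z)⁻¹ * φ z) := fun a b =>
    integral_mul_dbar (ContDiff.dbar hv b) hψ a
  have hsymm : ∫ z, dbar e' v z * dbar e (fun z => (v z)⁻¹ * φ z) z =
      ∫ z, dbar e v z * dbar e' (fun z => (v z)⁻¹ * φ z) z := by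
    rw [key, key]
    simp only [dbar_comm hv e e']
  have hi : ∀ a b : E, Integrable fun z => dbar b v z * dbar a (fun z => (v z)⁻¹ * φ z) z :=
    fun a b => ((ContDiff.dbar hv b).continuous.mul
      (hψ.dbar a).continuous).integrable_of_hasCompactSupport (hψ.dbar a).2.1.mul_left
  rw [← sub_eq_zero, ← integral_sub (hi _ _) (hi _ _)] at hsymm
  rw [← hsymm]
  congr 1 with z
  by_cases hz : z ∈ tsupport φ
  · have hd := fun a : E => dbar_inv_mul (hv.differentiable (by simp) z) (hφ.differentiable z)
      (hv0 z hz) a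
    rw [hd, hd]
    ring
  · have h0 : ∀ a, dbar a φ z = 0 := fun a =>
      image_eq_zero_of_notMem_tsupport fun h => hz (tsupport_dbar_subset a φ h)
    have h1 : ∀ a, dbar a (fun z => (v z)⁻¹ * φ z) z = 0 := fun a =>
      image_eq_zero_of_notMem_tsupport fun h =>
        hz (tsupport_mul_subset_right (tsupport_dbar_subset a _ h))
    simp [h0, h1]

/-- The logarithmic form of a nowhere vanishing continuous function with weak Wirtinger derivatives
is `∂̄`-closed. -/
theorem integral_mul_dbar_symm {U : Set E} (hU : IsOpen U) {f b b' φ : E → ℂ} {e e' : E}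
    (hf : ContinuousOn f U) (hf0 : ∀ z ∈ U, f z ≠ 0)
    (hb : HasWeakDbar U e f fun z => b z * f z) (hb' : HasWeakDbar U e' f fun z => b' z * f z)
    (hφ : IsTestFunction U φ) :
    ∫ z, b' z * dbar e φ z = ∫ z, b z * dbar e' φ z := by
  obtain ⟨K', hK', hK'U, happ⟩ := exists_smooth_approx hU hf hφ.2.1.isCompact hφ.2.2
  set K := tsupport φ with hK
  have hKm : MeasurableSet K := hφ.2.1.isCompact.measurableSet
  obtain ⟨c, hc, hcf⟩ : ∃ c > 0, ∀ z ∈ K, c ≤ ‖f z‖ :=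
    hφ.2.1.isCompact.exists_forall_le' (hf.mono hφ.2.2).norm
      fun z hz => norm_pos_iff.2 (hf0 z (hφ.2.2 hz))
  obtain ⟨S, hS⟩ := (hφ.dbar e).continuous.bounded_above_of_compact_support (hφ.dbar e).2.1
  obtain ⟨S', hS'⟩ := (hφ.dbar e').continuous.bounded_above_of_compact_support (hφ.dbar e').2.1
  have hS0 : 0 ≤ S := (norm_nonneg _).trans (hS 0)
  have hS0' : 0 ≤ S' := (norm_nonneg _).trans (hS' 0)
  set N := ∫ z in K', ‖b z * f z‖ with hN
  set N' := ∫ z in K', ‖b' z * f z‖ with hN'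
  set P := ∫ z in K, ‖b z * f z‖ with hP
  set P' := ∫ z in K, ‖b' z * f z‖ with hP'
  -- With `‖f‖ ≥ c` and `‖v‖ ≥ c / 2` on `K`: the first term uses `‖v‖⁻² ≤ 4 / c²` and the `L¹`
  -- bounds for the derivatives of `v`; the second comes from `‖f⁻¹ - v⁻¹‖ ≤ 2 δ / c²`.
  set Q := 4 / c ^ 2 * (S * N' + S' * N) + 2 / c ^ 2 * (S * P' + S' * P) with hQ
  have hbound : ∀ δ : ℝ, 0 < δ → δ ≤ c / 2 →
      ‖(∫ z, b' z * dbar e φ z) - ∫ z, b z * dbar e' φ z‖ ≤ Q * δ := by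
    intro δ hδ hδc
    obtain ⟨v, hv, hvf, hvd⟩ := happ δ hδ
    have hvl : ∀ z ∈ K, c / 2 ≤ ‖v z‖ := fun z hz => by
      have h1 := hcf z hz
      have h2 := hvf z hz
      have h3 := norm_sub_norm_le (f z) (v z)
      rw [norm_sub_rev] at h3
      linarith
    have hv0 : ∀ z ∈ K, v z ≠ 0 := fun z hz => norm_pos_iff.1 (by linarith [hvl z hz])
    have hW : IsOpen {z | v z ≠ 0} := isOpen_ne.preimage hv.continuous
    have hinv : ContDiffOn ℝ ∞ (fun z => (v z)⁻¹) {z | v z ≠ 0} :=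
      hv.contDiffOn.inv fun z hz => hz
    have hsub : ∀ a : E, tsupport (dbar a φ) ⊆ K := fun a => tsupport_dbar_subset a φ
    have hout : ∀ a : E, ∀ z ∉ K, dbar a φ z = 0 := fun a z hz =>
      image_eq_zero_of_notMem_tsupport fun h => hz (hsub a h)
    have hψ : ∀ a : E, IsTestFunction U fun z => (v z)⁻¹ * dbar a φ z := fun a =>
      (hφ.dbar a).mul_left_of_contDiffOn hW hinv fun z hz => hv0 z (hsub a hz)
    -- the weak equations tested against `v⁻¹ ∂φ`
    have hweak : ∀ a a' : E, ∀ g : E → ℂ, HasWeakDbar U a f g →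
        ∫ z, g z * ((v z)⁻¹ * dbar a' φ z) = -(∫ z, f z * ((v z)⁻¹ * dbar a (dbar a' φ) z)) +
          ∫ z, f z * ((v z)⁻¹ ^ 2 * (dbar a v z * dbar a' φ z)) := by
      intro a a' g hg
      have h1 := hg.2.2 _ (hψ a')
      have hd : ∀ z, f z * dbar a (fun z => (v z)⁻¹ * dbar a' φ z) z =
          f z * ((v z)⁻¹ * dbar a (dbar a' φ) z) -
            f z * ((v z)⁻¹ ^ 2 * (dbar a v z * dbar a' φ z)) := by
        intro z
        by_cases hz : z ∈ K
        · rw [dbar_inv_mul (hv.differentiable (by simp) z) ((hφ.dbar a').differentiable z)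
            (hv0 z hz), mul_sub]
        · have h0 : dbar a (fun z => (v z)⁻¹ * dbar a' φ z) z = 0 :=
            image_eq_zero_of_notMem_tsupport fun h =>
              hz (hsub a' (tsupport_mul_subset_right (tsupport_dbar_subset a _ h)))
          have h2 : dbar a (dbar a' φ) z = 0 :=
            image_eq_zero_of_notMem_tsupport fun h => hz (hsub a' (tsupport_dbar_subset a _ h))
          rw [h0, h2, hout a' z hz]
          simp
      have i1 : Integrable fun z => f z * ((v z)⁻¹ * dbar a (dbar a' φ) z) :=
        (((hφ.dbar a').dbar a).mul_left_of_contDiffOn hW hinv fun z hz =>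
          hv0 z (hsub a' (tsupport_dbar_subset a _ hz))).integrable_mul hg.1
      have i2 : Integrable fun z => f z * ((v z)⁻¹ ^ 2 * (dbar a v z * dbar a' φ z)) := by
        have := ((hφ.dbar a').mul_left (ContDiff.dbar hv a)).mul_left_of_contDiffOn hW
          (hinv.pow 2) fun z hz => hv0 z (hsub a' (tsupport_mul_subset_right hz))
        exact this.integrable_mul hg.1
      simp only [hd] at h1
      rw [integral_sub i1 i2] at h1
      linear_combination h1
    have hI := hweak e' e _ hb'
    have hI' := hweak e e' _ hb
    have hsm := integral_dbar_div_symm hv hφ hv0 e e'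
    have j1 : ∀ a a' : E, Integrable fun z => f z * ((v z)⁻¹ ^ 2 * (dbar a v z * dbar a' φ z)) := by
      intro a a'
      have := ((hφ.dbar a').mul_left (ContDiff.dbar hv a)).mul_left_of_contDiffOn hW
        (hinv.pow 2) fun z hz => hv0 z (hsub a' (tsupport_mul_subset_right hz))
      exact this.integrable_mul hb.1
    have j2 : Integrable fun z =>
        (v z)⁻¹ * (dbar e' v z * dbar e φ z - dbar e v z * dbar e' φ z) := by
      have h1 : ∀ a a' : E, Integrable fun z => (v z)⁻¹ * (dbar a v z * dbar a' φ z) := by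
        intro a a'
        have := ((hφ.dbar a').mul_left (ContDiff.dbar hv a)).mul_left_of_contDiffOn hW
          hinv fun z hz => hv0 z (hsub a' (tsupport_mul_subset_right hz))
        exact this.continuous.integrable_of_hasCompactSupport this.2.1
      simp only [mul_sub]
      exact (h1 e' e).sub (h1 e e')
    -- The second derivatives of `φ` cancel by symmetry. Subtracting the vanishing integral for the
    -- smooth form replaces the factor `f` by `f - v`, which is at most `δ` on `K`, while the
    -- derivatives of `v` are bounded only in `L¹`.
    have hD : (∫ z, b' z * f z * ((v z)⁻¹ * dbar e φ z)) -
        ∫ z, b z * f z * ((v z)⁻¹ * dbar e' φ z) =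
        ∫ z, (f z - v z) * ((v z)⁻¹ ^ 2 *
          (dbar e' v z * dbar e φ z - dbar e v z * dbar e' φ z)) := by
      rw [hI, hI']
      simp only [dbar_comm hφ.1 e' e]
      have : ∀ z, (f z - v z) * ((v z)⁻¹ ^ 2 *
          (dbar e' v z * dbar e φ z - dbar e v z * dbar e' φ z)) =
          (f z * ((v z)⁻¹ ^ 2 * (dbar e' v z * dbar e φ z)) -
            f z * ((v z)⁻¹ ^ 2 * (dbar e v z * dbar e' φ z))) -
          (v z)⁻¹ * (dbar e' v z * dbar e φ z - dbar e v z * dbar e' φ z) := by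
        intro z
        by_cases hz : z ∈ K
        · have := hv0 z hz
          field_simp
        · simp [hout _ z hz]
      have j3 : Integrable fun z => f z * ((v z)⁻¹ ^ 2 * (dbar e' v z * dbar e φ z)) -
          f z * ((v z)⁻¹ ^ 2 * (dbar e v z * dbar e' φ z)) := (j1 e' e).sub (j1 e e')
      simp only [this]
      rw [integral_sub j3 j2, hsm, integral_sub (j1 e' e) (j1 e e')]
      ring
    have hDbound : ‖∫ z, (f z - v z) * ((v z)⁻¹ ^ 2 *
          (dbar e' v z * dbar e φ z - dbar e v z * dbar e' φ z))‖ ≤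
        δ * (4 / c ^ 2) * (S * N' + S' * N) := by
      rw [← setIntegral_eq_integral_of_forall_compl_eq_zero (s := K)
        fun z hz => by simp [hout _ z hz]]
      have hvi : ∀ a : E, IntegrableOn (fun z => ‖dbar a v z‖) K := fun a =>
        (ContDiff.dbar hv a).continuous.norm.continuousOn.integrableOn_compact hφ.2.1.isCompact
      calc _ ≤ ∫ z in K, δ * (4 / c ^ 2) * (S * ‖dbar e' v z‖ + S' * ‖dbar e v z‖) := by
            refine norm_integral_le_of_norm_le
              ((((hvi e').const_mul S).add ((hvi e).const_mul S')).const_mul _)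
              ((ae_restrict_iff' hKm).2 (ae_of_all _ fun z hz => ?_))
            rw [norm_mul, norm_mul, norm_pow, norm_inv, norm_sub_rev, mul_assoc δ]
            gcongr
            · exact hvf z hz
            · have : (‖v z‖⁻¹) ≤ 2 / c := by
                rw [inv_le_comm₀ (by linarith [hvl z hz]) (by positivity), inv_div]
                exact hvl z hz
              calc ‖v z‖⁻¹ ^ 2 ≤ (2 / c) ^ 2 := by gcongr
                _ = 4 / c ^ 2 := by ring
            · refine (norm_sub_le _ _).trans ?_
              rw [norm_mul, norm_mul, mul_comm S, mul_comm S']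
              gcongr
              · exact hS z
              · exact hS' z
        _ ≤ _ := by
            rw [integral_const_mul, integral_add ((hvi e').const_mul S) ((hvi e).const_mul S'),
              integral_const_mul, integral_const_mul]
            gcongr
            · exact (hvd e' _ hb').1
            · exact (hvd e _ hb).1
    have happrox : ∀ b : E → ℂ, ∀ T : ℝ, LocallyIntegrableOn (fun z => b z * f z) U →
        ∀ a' : E, (∀ z, ‖dbar a' φ z‖ ≤ T) →
        ‖(∫ z, b z * dbar a' φ z) - ∫ z, b z * f z * ((v z)⁻¹ * dbar a' φ z)‖ ≤
          δ * (2 / c ^ 2) * (T * ∫ z in K, ‖b z * f z‖) := by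
      intro b T hbf a' hT
      have hT0 : 0 ≤ T := (norm_nonneg _).trans (hT 0)
      have e1 : ∀ z, b z * dbar a' φ z = b z * f z * ((f z)⁻¹ * dbar a' φ z) := by
        intro z
        by_cases hz : z ∈ K
        · have := hf0 z (hφ.2.2 hz)
          field_simp
        · simp [hout _ z hz]
      have k1 : Integrable fun z => b z * f z * ((f z)⁻¹ * dbar a' φ z) :=
        integrable_mul_of_locallyIntegrableOn hbf (continuous_mul_of_tsupport_subset hU
          (hf.inv₀ hf0) (hφ.dbar a').continuous (hφ.dbar a').2.2) (hφ.dbar a').2.1.mul_left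
          (tsupport_mul_subset_right.trans (hφ.dbar a').2.2)
      have k2 : Integrable fun z => b z * f z * ((v z)⁻¹ * dbar a' φ z) :=
        (hψ a').integrable_mul hbf
      simp only [e1]
      rw [← integral_sub k1 k2, ← setIntegral_eq_integral_of_forall_compl_eq_zero (s := K)
        fun z hz => by simp [hout _ z hz]]
      calc _ ≤ ∫ z in K, δ * (2 / c ^ 2) * (T * ‖b z * f z‖) := by
            refine norm_integral_le_of_norm_le
              (((hbf.integrableOn_compact_subset hφ.2.2 hφ.2.1.isCompact).norm.const_mul
                T).const_mul _) ((ae_restrict_iff' hKm).2 (ae_of_all _ fun z hz => ?_))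
            have hfz := hf0 z (hφ.2.2 hz)
            have e2 : b z * f z * ((f z)⁻¹ * dbar a' φ z) - b z * f z * ((v z)⁻¹ * dbar a' φ z) =
                ((f z)⁻¹ - (v z)⁻¹) * (dbar a' φ z * (b z * f z)) := by ring
            rw [e2, norm_mul, norm_mul]
            gcongr
            · rw [inv_sub_inv hfz (hv0 z hz), norm_div, norm_mul]
              calc ‖v z - f z‖ / (‖f z‖ * ‖v z‖) ≤ δ / (c * (c / 2)) := by
                    gcongr
                    · exact hvf z hz
                    · exact hcf z hz
                    · exact hvl z hz
                _ = δ * (2 / c ^ 2) := by field_simp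
            · exact hT z
        _ = _ := by rw [integral_const_mul, integral_const_mul]
    have hA := happrox b' S hb'.2.1 e hS
    have hA' := happrox b S' hb.2.1 e' hS'
    rw [← hD] at hDbound
    calc ‖(∫ z, b' z * dbar e φ z) - ∫ z, b z * dbar e' φ z‖
        = ‖((∫ z, b' z * dbar e φ z) - ∫ z, b' z * f z * ((v z)⁻¹ * dbar e φ z)) +
          ((∫ z, b' z * f z * ((v z)⁻¹ * dbar e φ z)) -
            ∫ z, b z * f z * ((v z)⁻¹ * dbar e' φ z)) -
          ((∫ z, b z * dbar e' φ z) - ∫ z, b z * f z * ((v z)⁻¹ * dbar e' φ z))‖ := by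
          congr 1; ring
      _ ≤ δ * (2 / c ^ 2) * (S * P') + δ * (4 / c ^ 2) * (S * N' + S' * N) +
          δ * (2 / c ^ 2) * (S' * P) :=
          (norm_sub_le _ _).trans (add_le_add ((norm_add_le _ _).trans (add_le_add hA hDbound)) hA')
      _ = Q * δ := by rw [hQ]; ring
  have hlim : Tendsto (fun δ : ℝ => Q * δ) (𝓝[>] 0) (𝓝 0) := by
    have : Tendsto (fun δ : ℝ => Q * δ) (𝓝 0) (𝓝 (Q * 0)) :=
      (continuous_const.mul continuous_id).tendsto 0
    rw [mul_zero] at this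
    exact this.mono_left nhdsWithin_le_nhds
  have h0 : ‖(∫ z, b' z * dbar e φ z) - ∫ z, b z * dbar e' φ z‖ ≤ 0 := by
    refine ge_of_tendsto hlim ?_
    filter_upwards [Ioc_mem_nhdsGT (half_pos hc)] with δ hδ using hbound δ hδ.1 hδ.2
  exact sub_eq_zero.1 (norm_le_zero_iff.1 h0)

end Closedness

/-! ### Osgood's lemma and smoothness -/

section Osgood

variable {n : ℕ} {g : (Fin n → ℂ) → ℂ}

/-- Continuous functions on the polydisc which are holomorphic in each variable. -/
structure IsSeparatelyHolomorphic (g : (Fin n → ℂ) → ℂ) : Prop where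
  continuousOn : ContinuousOn g (polydisc n)
  differentiableOn_slice : ∀ j, ∀ z ∈ polydisc n, DifferentiableOn ℂ (slice g j z) disc

/-- The complex partial derivative in the `j`-th variable. -/
noncomputable def partialDeriv (j : Fin n) (g : (Fin n → ℂ) → ℂ) (z : Fin n → ℂ) : ℂ :=
  deriv (slice g j z) (z j)

theorem partialDeriv_update (j : Fin n) (g : (Fin n → ℂ) → ℂ) (z : Fin n → ℂ) (w : ℂ) :
    partialDeriv j g (Function.update z j w) = deriv (slice g j z) w := by
  have : slice g j (Function.update z j w) = slice g j z := by
    ext t; simp [slice]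
  rw [partialDeriv, this, Function.update_self]

theorem IsSeparatelyHolomorphic.hasDerivAt_slice (hg : IsSeparatelyHolomorphic g) (j : Fin n)
    {z : Fin n → ℂ} (hz : z ∈ polydisc n) {w : ℂ} (hw : w ∈ disc) :
    HasDerivAt (slice g j z) (partialDeriv j g (Function.update z j w)) w := by
  rw [partialDeriv_update]
  exact ((hg.differentiableOn_slice j z hz).differentiableAt
    (isOpen_disc.mem_nhds hw)).hasDerivAt

theorem continuous_update_prod (j : Fin n) :
    Continuous fun q : (Fin n → ℂ) × ℂ => Function.update q.1 j q.2 :=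
  continuous_fst.update j continuous_snd

/-- Continuity in parameters gives locally uniform convergence of slices. -/
theorem tendstoLocallyUniformlyOn_slice {X : Type*} [TopologicalSpace X] {U : Set X} (hU : IsOpen U)
    {F : X → ℂ → ℂ} {V : Set ℂ} (hV : IsOpen V)
    (hF : ContinuousOn (Function.uncurry F) (U ×ˢ V)) {x : X} (hx : x ∈ U) :
    TendstoLocallyUniformlyOn F (F x) (𝓝 x) V := by
  rw [tendstoLocallyUniformlyOn_iff_forall_isCompact hV]
  intro K hKV hK u hu
  obtain ⟨v, hv, h⟩ := hK.mem_uniformity_of_prod (hF.mono (prod_mono le_rfl hKV)) hx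
    (symm_le_uniformity hu)
  rw [hU.nhdsWithin_eq hx] at hv
  filter_upwards [hv] with y hy w hw using h y hy w hw

/-- Slices depend on the base point continuously in the locally uniform sense, and for holomorphic
functions locally uniform convergence passes to derivatives. -/
theorem IsSeparatelyHolomorphic.continuousOn_partialDeriv (hg : IsSeparatelyHolomorphic g)
    (j : Fin n) : ContinuousOn (partialDeriv j g) (polydisc n) := by
  intro z hz
  have hcont : ContinuousOn (Function.uncurry (slice g j)) (polydisc n ×ˢ disc) :=
    hg.continuousOn.comp (continuous_update_prod j).continuousOn
      fun q hq => update_mem_polydisc hq.1 j hq.2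
  have h1 := tendstoLocallyUniformlyOn_slice (isOpen_polydisc n) isOpen_disc hcont hz
  have h2 := h1.deriv (by
    filter_upwards [(isOpen_polydisc n).mem_nhds hz] with y hy using
      hg.differentiableOn_slice j y hy) isOpen_disc
  have h3 : ContinuousWithinAt (deriv (slice g j z)) disc (z j) :=
    ((hg.differentiableOn_slice j z hz).deriv isOpen_disc).continuousOn (z j) (hz j)
  have h4 := h2.tendsto_comp h3 (hz j)
    (show Tendsto (fun y : Fin n → ℂ => y j) (𝓝 z) (𝓝[disc] (z j)) by
      rw [isOpen_disc.nhdsWithin_eq (hz j)]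
      exact (continuous_apply j).tendsto z)
  exact ContinuousAt.continuousWithinAt h4

/-- Coordinates are moved one at a time: `P s y` takes those in `s` from `y` and the others from
`z`. Each move is controlled by the mean value inequality and the continuity of the partial
derivative. -/
theorem IsSeparatelyHolomorphic.hasFDerivAt (hg : IsSeparatelyHolomorphic g) {z : Fin n → ℂ}
    (hz : z ∈ polydisc n) :
    HasFDerivAt g (∑ j, partialDeriv j g z • ContinuousLinearMap.proj (R := ℂ) (φ := fun _ => ℂ) j)
      z := by
  classical
  set P : Finset (Fin n) → (Fin n → ℂ) → Fin n → ℂ := fun s y i => if i ∈ s then y i else z i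
    with hP
  have hPc : ∀ s, Continuous (P s) := by
    intro s
    refine continuous_pi fun i => ?_
    by_cases h : i ∈ s
    · simpa [hP, h] using continuous_apply i
    · simpa [hP, h] using continuous_const
  have hPz : ∀ s, P s z = z := fun s => by ext i; simp [hP]
  have key : ∀ s : Finset (Fin n), (fun y => g (P s y) - g z -
      ∑ i ∈ s, partialDeriv i g z * (y i - z i)) =o[𝓝 z] fun y => y - z := by
    intro s
    induction s using Finset.induction_on with
    | empty =>
      have h1 : ∀ y, P ∅ y = z := fun y => by ext i; simp [hP]
      simp [h1]
    | insert j s hj ih =>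
      have h1 : ∀ y, P (insert j s) y = Function.update (P s y) j (y j) := by
        intro y
        ext i
        rcases eq_or_ne i j with rfl | h
        · simp [hP]
        · simp [hP, h]
      have h2 : ∀ y, P s y = Function.update (P s y) j (z j) := by
        intro y
        ext i
        rcases eq_or_ne i j with rfl | h
        · simp [hP, hj]
        · simp [h]
      have hc2 : Continuous fun q : (Fin n → ℂ) × ℂ => Function.update (P s q.1) j q.2 :=
        ((hPc s).comp continuous_fst).update j continuous_snd
      have hlim : Tendsto (fun q : (Fin n → ℂ) × ℂ => Function.update (P s q.1) j q.2)
          (𝓝 z ×ˢ 𝓝 (z j)) (𝓝 z) := by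
        rw [← nhds_prod_eq]
        have := hc2.tendsto (z, z j)
        simpa [hPz] using this
      have hstep : (fun y => g (Function.update (P s y) j (y j)) -
          g (Function.update (P s y) j (z j)) - partialDeriv j g z * (y j - z j)) =o[𝓝 z]
          fun y => y j - z j := by
        rw [Asymptotics.isLittleO_iff]
        intro ε hε
        have h3 := ((hg.continuousOn_partialDeriv j).continuousAt
          ((isOpen_polydisc n).mem_nhds hz)).tendsto.comp hlim
        have h4 := ((Metric.tendsto_nhds.1 h3) ε hε).and
          (hlim.eventually ((isOpen_polydisc n).mem_nhds hz))
        obtain ⟨pa, hpa, pb, hpb, hab⟩ := eventually_prod_iff.1 h4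
        obtain ⟨δ, hδ, hδb⟩ := Metric.eventually_nhds_iff_ball.1 hpb
        filter_upwards [hpa, (continuous_apply j).tendsto z (ball_mem_nhds (z j) hδ)] with y hy hyj
        have hmv := (convex_ball (z j) δ).norm_image_sub_le_of_norm_hasDerivWithin_le
          (f := fun t => g (Function.update (P s y) j t) - partialDeriv j g z * t) (C := ε)
          (f' := fun t => partialDeriv j g (Function.update (P s y) j t) - partialDeriv j g z * 1)
          (fun t ht => by
            have hq := (hab hy (hδb t ht)).2
            have := hg.hasDerivAt_slice j hq (mem_disc_of_update_mem hq)
            have h5 : slice g j (Function.update (P s y) j t) =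
                fun t => g (Function.update (P s y) j t) := by
              ext t; simp [slice]
            rw [h5, Function.update_idem] at this
            exact this.hasDerivWithinAt.sub ((hasDerivWithinAt_id t _).const_mul _))
          (fun t ht => by
            have := (hab hy (hδb t ht)).1
            rw [dist_eq_norm] at this
            simpa using this.le) (mem_ball_self hδ) hyj
        refine le_of_eq_of_le ?_ hmv
        congr 1
        ring
      have hO : (fun y : Fin n → ℂ => y j - z j) =O[𝓝 z] fun y => y - z :=
        Asymptotics.isBigO_of_le _ fun y => norm_le_pi_norm (y - z) j
      refine (ih.add (hstep.trans_isBigO hO)).congr_left fun y => ?_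
      rw [Finset.sum_insert hj, h1 y, ← h2 y]
      ring
  have h := key Finset.univ
  rw [hasFDerivAt_iff_isLittleO]
  refine h.congr_left fun y => ?_
  have h1 : P Finset.univ y = y := by ext i; simp [hP]
  simp [h1]

/-- **Osgood's lemma**. -/
theorem IsSeparatelyHolomorphic.differentiableOn (hg : IsSeparatelyHolomorphic g) :
    DifferentiableOn ℂ g (polydisc n) := fun _ hz =>
  (hg.hasFDerivAt hz).differentiableAt.differentiableWithinAt

theorem IsSeparatelyHolomorphic.partialDeriv (hg : IsSeparatelyHolomorphic g) (j : Fin n) :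
    IsSeparatelyHolomorphic (partialDeriv j g) := by
  refine ⟨hg.continuousOn_partialDeriv j, fun i z hz => ?_⟩
  rcases eq_or_ne i j with rfl | hij
  · have : slice (DbarLog.partialDeriv i g) i z = deriv (slice g i z) := by
      ext w; exact partialDeriv_update i g z w
    rw [this]
    exact (hg.differentiableOn_slice i z hz).deriv isOpen_disc
  -- the derivative is a locally uniform limit of difference quotients
  set Q : ℂ → ℂ → ℂ := fun t a =>
    (g (Function.update (Function.update z i a) j t) - g (Function.update z i a)) / (t - z j)
    with hQ
  have hup : ∀ t ∈ disc, ∀ a ∈ disc,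
      Function.update (Function.update z i a) j t ∈ polydisc n := fun t ht a ha =>
    update_mem_polydisc (update_mem_polydisc hz i ha) j ht
  have hzj : ∀ a, Function.update (Function.update z i a) j (z j) = Function.update z i a := by
    intro a
    ext k
    rcases eq_or_ne k j with rfl | h
    · simp [hij.symm]
    · simp [h]
  have hcont : ContinuousOn (Function.uncurry fun t a =>
      DbarLog.partialDeriv j g (Function.update (Function.update z i a) j t)) (disc ×ˢ disc) := by
    refine (hg.continuousOn_partialDeriv j).comp (Continuous.continuousOn ?_)
      fun q hq => hup q.1 hq.1 q.2 hq.2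
    exact ((continuous_const (y := z)).update i continuous_snd).update j continuous_fst
  have hlim : TendstoLocallyUniformlyOn Q (slice (DbarLog.partialDeriv j g) i z) (𝓝[≠] (z j))
      disc := by
    rw [tendstoLocallyUniformlyOn_iff_forall_isCompact isOpen_disc]
    intro K hKd hK
    rw [Metric.tendstoUniformlyOn_iff]
    intro ε hε
    have h1 := (tendstoLocallyUniformlyOn_iff_forall_isCompact isOpen_disc).1
      (tendstoLocallyUniformlyOn_slice isOpen_disc isOpen_disc hcont (hz j)) K hKd hK
    rw [Metric.tendstoUniformlyOn_iff] at h1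
    obtain ⟨δ, hδ, hδd⟩ := Metric.eventually_nhds_iff_ball.1
      ((h1 (ε / 2) (half_pos hε)).and (isOpen_disc.mem_nhds (hz j)))
    filter_upwards [mem_nhdsWithin_of_mem_nhds (ball_mem_nhds (z j) hδ),
      self_mem_nhdsWithin] with t ht htne a ha
    have hne : t - z j ≠ 0 := sub_ne_zero.2 htne
    have hder : ∀ s ∈ ball (z j) δ, HasDerivWithinAt (slice g j (Function.update z i a))
        (DbarLog.partialDeriv j g (Function.update (Function.update z i a) j s))
        (ball (z j) δ) s := fun s hs =>
      (hg.hasDerivAt_slice j (update_mem_polydisc hz i (hKd ha)) (hδd s hs).2).hasDerivWithinAt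
    set c := DbarLog.partialDeriv j g (Function.update z i a) with hc
    have hmv := (convex_ball (z j) δ).norm_image_sub_le_of_norm_hasDerivWithin_le
      (f := fun s => slice g j (Function.update z i a) s - c * s) (C := ε / 2)
      (fun s hs => (hder s hs).sub ((hasDerivWithinAt_id s _).const_mul c))
      (fun s hs => by
        have := (hδd s hs).1 a ha
        rw [hzj, dist_comm, dist_eq_norm] at this
        simpa using this.le) (mem_ball_self hδ) ht
    have h2 : slice g j (Function.update z i a) t - c * t -
        (slice g j (Function.update z i a) (z j) - c * z j) = (Q t a - c) * (t - z j) := by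
      simp only [hQ, slice, hzj]
      field_simp
      ring
    rw [h2, norm_mul] at hmv
    have h3 := le_of_mul_le_mul_right hmv (norm_pos_iff.2 hne)
    rw [dist_comm, dist_eq_norm]
    exact h3.trans_lt (half_lt_self hε)
  refine hlim.differentiableOn ?_ isOpen_disc
  filter_upwards [mem_nhdsWithin_of_mem_nhds (isOpen_disc.mem_nhds (hz j))] with t ht
  have hcomm : ∀ a, Function.update (Function.update z i a) j t =
      Function.update (Function.update z j t) i a := fun a => Function.update_comm hij _ _ _
  have h1 : DifferentiableOn ℂ (slice g i (Function.update z j t)) disc :=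
    hg.differentiableOn_slice i _ (update_mem_polydisc hz j ht)
  simp only [hQ, hcomm]
  exact (h1.sub (hg.differentiableOn_slice i z hz)).div_const _

/-- Partial derivatives stay in the class, so differentiation can be iterated. Smoothness of `r` is
needed because the cutoff near the zero set is a function of `z_n - r(z')`. -/
theorem IsSeparatelyHolomorphic.contDiffOn (hg : IsSeparatelyHolomorphic g) :
    ContDiffOn ℂ ∞ g (polydisc n) := by
  rw [contDiffOn_infty]
  intro k
  induction k generalizing g with
  | zero => exact contDiffOn_zero.2 hg.continuousOn
  | succ k ih =>
    rw [show ((k + 1 : ℕ) : WithTop ℕ∞) = (k : WithTop ℕ∞) + 1 by norm_cast,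
      contDiffOn_succ_iff_fderiv_of_isOpen (isOpen_polydisc n)]
    refine ⟨hg.differentiableOn, by simp, ?_⟩
    refine ContDiffOn.congr (f := fun z => ∑ j, DbarLog.partialDeriv j g z •
      ContinuousLinearMap.proj (R := ℂ) (φ := fun _ => ℂ) j) ?_
      fun z hz => (hg.hasFDerivAt hz).fderiv
    exact ContDiffOn.sum fun j _ => (ih (hg.partialDeriv j)).smul contDiffOn_const

end Osgood

/-! ### Continuity and holomorphy of the zero -/

section Zeros

theorem convex_disc : Convex ℝ disc := by
  rw [disc_eq_ball]; exact convex_ball _ _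

/-- A winding number argument. Subtracting `iθ` from the logarithm along the circle leaves a
continuous logarithm of the constant `ε`, so its increments are integer multiples of `2πi` and it
should be constant, yet it changes by `-2πi` after one turn. -/
theorem not_continuousOn_log_sphere {L : ℂ → ℂ} {a : ℂ} {ε : ℝ} (hε : 0 < ε)
    (hL : ContinuousOn L (sphere a ε)) (h : ∀ w ∈ sphere a ε, Complex.exp (L w) = w - a) :
    False := by
  let l : ℝ → ℂ := fun θ => L (circleMap a ε θ) - θ * Complex.I
  have hl : Continuous l := by
    refine Continuous.sub ?_ (by fun_prop)
    exact hL.comp_continuous (continuous_circleMap a ε) fun θ => circleMap_mem_sphere a hε.le θ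
  have hexp : ∀ θ, Complex.exp (l θ) = ε := fun θ => by
    simp only [l]
    rw [Complex.exp_sub, h _ (circleMap_mem_sphere a hε.le θ), circleMap_sub_center, circleMap_zero]
    field_simp [Complex.exp_ne_zero]
  let q : ℝ → ℝ := fun θ => (l θ - l 0).im / (2 * Real.pi)
  have hq : Continuous q := by
    have := Complex.continuous_im.comp (hl.sub (continuous_const (y := l 0)))
    exact this.div_const _
  have hint : ∀ θ, ∃ n : ℤ, q θ = n := fun θ => by
    have h1 : Complex.exp (l θ - l 0) = 1 := by
      rw [Complex.exp_sub, hexp, hexp, div_self]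
      exact_mod_cast hε.ne'
    obtain ⟨n, hn⟩ := Complex.exp_eq_one_iff.1 h1
    refine ⟨n, ?_⟩
    have : (l θ - l 0).im = n * (2 * Real.pi) := by rw [hn]; simp
    simp only [q, this]
    field_simp [Real.pi_ne_zero]
  have h0 : q 0 = 0 := by simp [q]
  have h2 : q (2 * Real.pi) = -1 := by
    have : l (2 * Real.pi : ℝ) - l 0 = -(2 * Real.pi : ℝ) * Complex.I := by
      have h3 : circleMap a ε (2 * Real.pi) = circleMap a ε 0 := by
        simpa using (periodic_circleMap a ε) 0
      simp only [l, h3]; push_cast; ring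
    simp only [q, this]
    have hp := Real.pi_ne_zero
    simp [hp]
  have hmem : (-1 / 2 : ℝ) ∈ Icc (q (2 * Real.pi)) (q 0) := by rw [h0, h2]; norm_num
  obtain ⟨θ, -, hθ⟩ := intermediate_value_Icc' (by positivity) hq.continuousOn hmem
  obtain ⟨n, hn⟩ := hint θ
  rw [hθ] at hn
  have h5 : ((2 * n : ℤ) : ℝ) = (-1 : ℤ) := by push_cast; linarith
  have := Int.cast_injective h5
  omega

theorem mem_slitPlane_of_norm_sub_one_lt {q : ℂ} (h : ‖q - 1‖ < 1) : q ∈ Complex.slitPlane := by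
  have := Complex.mem_slitPlane_of_norm_lt_one h
  simpa using this

/-- A weak form of Rouché's theorem, for continuous functions with a single simple zero. -/
theorem norm_sub_le_of_rouche {g₀ g₁ : ℂ → ℂ} {a₀ a₁ : ℂ} {ε : ℝ} (hε : 0 < ε)
    (hg₀ : ContinuousOn g₀ disc) (hg₁ : ContinuousOn g₁ disc) (h₀ : ∀ w ∈ disc, g₀ w ≠ 0)
    (h₁ : ∀ w ∈ disc, g₁ w ≠ 0) (hS : sphere a₀ ε ⊆ disc)
    (h : ∀ w ∈ sphere a₀ ε, ‖g₁ w * (w - a₁) - g₀ w * (w - a₀)‖ < ‖g₀ w * (w - a₀)‖) :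
    ‖a₁ - a₀‖ ≤ ε := by
  -- With `a₁` outside the circle, `w - a₁`, `g₀`, `g₁` and the quotient `q` all have continuous
  -- logarithms on the circle, and therefore so does `w - a₀`.
  by_contra! hlt
  have hsc : IsSimplyConnected disc := by
    have : ContractibleSpace disc := convex_disc.contractibleSpace ⟨0, by simp [disc]⟩
    exact (inferInstance : SimplyConnectedSpace disc)
  obtain ⟨L₀, hL₀, hL₀'⟩ := Complex.exists_continuousOn_eqOn_exp_comp hsc isOpen_disc hg₀
    (by rintro ⟨w, hw, hw'⟩; exact h₀ w hw hw')
  obtain ⟨L₁, hL₁, hL₁'⟩ := Complex.exists_continuousOn_eqOn_exp_comp hsc isOpen_disc hg₁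
    (by rintro ⟨w, hw, hw'⟩; exact h₁ w hw hw')
  have hne : ∀ w ∈ sphere a₀ ε, w - a₀ ≠ 0 := fun w hw h0 => by
    rw [mem_sphere, dist_eq_norm, h0, norm_zero] at hw
    exact hε.ne hw
  have ha : a₀ - a₁ ≠ 0 := fun h0 => by
    rw [← neg_sub, neg_eq_zero] at h0
    rw [h0, norm_zero] at hlt; linarith
  let q : ℂ → ℂ := fun w => g₁ w * (w - a₁) / (g₀ w * (w - a₀))
  have hg0ne : ∀ w ∈ sphere a₀ ε, g₀ w * (w - a₀) ≠ 0 := fun w hw =>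
    mul_ne_zero (h₀ w (hS hw)) (hne w hw)
  have hq : ContinuousOn q (sphere a₀ ε) :=
    ((hg₁.mono hS).mul (by fun_prop)).div ((hg₀.mono hS).mul (by fun_prop)) hg0ne
  have hq1 : ∀ w ∈ sphere a₀ ε, q w ∈ Complex.slitPlane := fun w hw => by
    apply mem_slitPlane_of_norm_sub_one_lt
    have : q w - 1 = (g₁ w * (w - a₁) - g₀ w * (w - a₀)) / (g₀ w * (w - a₀)) := by
      simp only [q]; rw [sub_div, div_self (hg0ne w hw)]
    rw [this, norm_div, div_lt_one (norm_pos_iff.2 (hg0ne w hw))]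
    exact h w hw
  -- Chosen so that `w - a₁ = (a₀ - a₁) * s w`, with `s` within distance 1 of the value 1 on the
  -- circle.
  let s : ℂ → ℂ := fun w => 1 + (w - a₀) / (a₀ - a₁)
  have hs1 : ∀ w ∈ sphere a₀ ε, s w ∈ Complex.slitPlane := fun w hw => by
    apply mem_slitPlane_of_norm_sub_one_lt
    simp only [s, add_sub_cancel_left]
    rw [norm_div, div_lt_one (norm_pos_iff.2 ha), ← dist_eq_norm, mem_sphere.1 hw, norm_sub_rev]
    exact hlt
  have hs : Continuous s := by fun_prop
  refine not_continuousOn_log_sphere (a := a₀) hε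
    (L := fun w => L₁ w - L₀ w - Complex.log (q w) + Complex.log (a₀ - a₁) + Complex.log (s w))
    ?_ fun w hw => ?_
  · refine (((((hL₁.mono hS).sub (hL₀.mono hS)).sub (hq.clog hq1)).add continuousOn_const)).add
      (hs.continuousOn.clog hs1)
  · have e0 : Complex.exp (L₀ w) = g₀ w := hL₀' (hS hw)
    have e1 : Complex.exp (L₁ w) = g₁ w := hL₁' (hS hw)
    rw [Complex.exp_add, Complex.exp_add, Complex.exp_sub, Complex.exp_sub, e0, e1,
      Complex.exp_log (Complex.slitPlane_ne_zero (hq1 w hw)), Complex.exp_log ha,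
      Complex.exp_log (Complex.slitPlane_ne_zero (hs1 w hw))]
    have hqne := Complex.slitPlane_ne_zero (hq1 w hw)
    have e2 : (a₀ - a₁) * s w = w - a₁ := by simp only [s]; field_simp; ring
    have e3 : q w * (g₀ w * (w - a₀)) = g₁ w * (w - a₁) := div_mul_cancel₀ _ (hg0ne w hw)
    rw [mul_assoc, e2, div_div, div_mul_eq_mul_div, ← e3]
    have := h₀ w (hS hw)
    field_simp

/-- Factoring out the zero from a function of the form `exp u * H`, with `H` holomorphic and having
a simple zero. -/
theorem exists_eq_sub_mul {H : ℂ → ℂ} {a : ℂ} (hH : DifferentiableOn ℂ H disc) (ha : a ∈ disc)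
    (h0 : ∀ w ∈ disc, H w = 0 ↔ w = a) (hord : analyticOrderAt H a = 1) :
    ∃ K, DifferentiableOn ℂ K disc ∧ (∀ w ∈ disc, K w ≠ 0) ∧ ∀ w ∈ disc, H w = (w - a) * K w := by
  have hn : disc ∈ 𝓝 a := isOpen_disc.mem_nhds ha
  have hHa : H a = 0 := (h0 a ha).2 rfl
  have hfac : ∀ w, H w = (w - a) * dslope H a w := fun w => by
    have := sub_smul_dslope H a w
    rw [hHa, sub_zero, smul_eq_mul] at this
    exact this.symm
  refine ⟨dslope H a, (Complex.differentiableOn_dslope hn).2 hH, fun w hw hw0 => ?_,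
    fun w _ => hfac w⟩
  have hHw : H w = 0 := by rw [hfac, hw0, mul_zero]
  -- A zero of `dslope H a` in the disc can only be `a`, where the value is the derivative of `H`,
  -- nonzero because the order is 1.
  have hwa := (h0 w hw).1 hHw
  subst hwa
  have han : AnalyticAt ℂ H w := hH.analyticAt hn
  obtain ⟨k, hk, hk0, hke⟩ := (han.analyticOrderAt_eq_natCast (n := 1)).1 (by exact_mod_cast hord)
  have hd : HasDerivAt H (k w) w := by
    have h1 : HasDerivAt (fun z => (z - w) * k z) (1 * k w + (w - w) * deriv k w) w :=
      ((hasDerivAt_id w).sub_const w).mul hk.differentiableAt.hasDerivAt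
    refine HasDerivAt.congr_of_eventuallyEq (by simpa using h1) ?_
    filter_upwards [hke] with z hz
    simpa using hz
  rw [dslope_same, hd.deriv] at hw0
  exact hk0 hw0

variable {m : ℕ} {p : ℝ≥0∞} {f : (Fin (m + 1) → ℂ) → ℂ} {r : (Fin m → ℂ) → ℂ}

theorem snoc_mem_polydisc {z' : Fin m → ℂ} {w : ℂ} :
    Fin.snoc (α := fun _ => ℂ) z' w ∈ polydisc (m + 1) ↔ z' ∈ polydisc m ∧ w ∈ disc := by
  simp only [polydisc, disc, mem_ofPred_eq]
  rw [Fin.forall_fin_succ']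
  simp

theorem slice_last_snoc (z' : Fin m → ℂ) (c : ℂ) :
    slice f (Fin.last m) (Fin.snoc (α := fun _ => ℂ) z' c) =
      fun w => f (Fin.snoc (α := fun _ => ℂ) z' w) := by
  funext w
  simp [slice, Fin.update_snoc_last]

/-- The constants `C` and `α` serve all `z'` at once. Since `u` and `K` are chosen for each `z'`
separately, this uniformity has to replace any regularity in `z'`. -/
theorem exists_factorization (hp : 2 < p) (hf : ContinuousOn f (polydisc (m + 1)))
    (hL : ConditionL p f)
    (hr : ∀ z' ∈ polydisc m, r z' ∈ disc ∧
      ∀ w ∈ disc, f (Fin.snoc (α := fun _ => ℂ) z' w) = 0 ↔ w = r z')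
    (hmult : ∀ z' ∈ polydisc m,
      HasMultiplicity (fun w => f (Fin.snoc (α := fun _ => ℂ) z' w)) (r z') 1) :
    ∃ C α : ℝ, 0 ≤ C ∧ 0 < α ∧ ∃ u K : (Fin m → ℂ) → ℂ → ℂ, ∀ z' ∈ polydisc m,
      (∀ w ∈ disc, ‖u z' w‖ ≤ C) ∧
      (∀ w ∈ disc, ∀ w' ∈ disc, ‖u z' w - u z' w'‖ ≤ C * ‖w - w'‖ ^ α) ∧
      DifferentiableOn ℂ (K z') disc ∧ (∀ w ∈ disc, K z' w ≠ 0) ∧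
      ∀ w ∈ disc, f (Fin.snoc (α := fun _ => ℂ) z' w) =
        Complex.exp (u z' w) * ((w - r z') * K z' w) := by
  obtain ⟨M, hM⟩ := hL
  obtain ⟨C, α, hC, hα, hu⟩ := exists_integratingFactor hp M
  refine ⟨C, α, hC, hα, ?_⟩
  have key : ∀ z' : Fin m → ℂ, ∃ u K : ℂ → ℂ, z' ∈ polydisc m → (∀ w ∈ disc, ‖u w‖ ≤ C) ∧
      (∀ w ∈ disc, ∀ w' ∈ disc, ‖u w - u w'‖ ≤ C * ‖w - w'‖ ^ α) ∧
      DifferentiableOn ℂ K disc ∧ (∀ w ∈ disc, K w ≠ 0) ∧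
      ∀ w ∈ disc, f (Fin.snoc (α := fun _ => ℂ) z' w) =
        Complex.exp (u w) * ((w - r z') * K w) := by
    intro z'
    by_cases hz' : z' ∈ polydisc m
    swap
    · exact ⟨0, 0, fun h => absurd h hz'⟩
    have hz : Fin.snoc (α := fun _ => ℂ) z' 0 ∈ polydisc (m + 1) :=
      snoc_mem_polydisc.2 ⟨hz', by simp [disc]⟩
    obtain ⟨A, hA, hAM, hw⟩ := hM (Fin.last m) _ hz
    obtain ⟨u, hu1, hu2, hu3⟩ := hu A hA hAM
    have hif := hu3 _ (continuousOn_slice hf (Fin.last m) hz) hw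
    rw [slice_last_snoc] at hif
    have hord := hmult z' hz' u hif
    obtain ⟨K, hK, hK0, hKf⟩ := exists_eq_sub_mul hif.2 (hr z' hz').1
      (fun w hw => by
        rw [mul_eq_zero, or_iff_right (Complex.exp_ne_zero _)]
        exact (hr z' hz').2 w hw) (by simpa using hord)
    refine ⟨u, K, fun _ => ⟨hu1, hu2, hK, hK0, fun w hw => ?_⟩⟩
    rw [← hKf w hw, ← mul_assoc, ← Complex.exp_add, add_neg_cancel, Complex.exp_zero, one_mul]
  choose u K huK using key
  exact ⟨u, K, huK⟩

theorem continuousAt_comp_snoc (hf : ContinuousOn f (polydisc (m + 1))) {z' : Fin m → ℂ} {w : ℂ}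
    (hz' : z' ∈ polydisc m) (hw : w ∈ disc) :
    ContinuousAt (fun x : (Fin m → ℂ) × ℂ => f (Fin.snoc (α := fun _ => ℂ) x.1 x.2)) (z', w) := by
  have h1 : ContinuousAt (fun x : (Fin m → ℂ) × ℂ => Fin.snoc (α := fun _ => ℂ) x.1 x.2)
      (z', w) := by
    refine Continuous.continuousAt ?_
    exact Continuous.finSnoc continuous_fst continuous_snd
  have h2 : ContinuousAt f (Fin.snoc (α := fun _ => ℂ) z' w) :=
    hf.continuousAt ((isOpen_polydisc _).mem_nhds (snoc_mem_polydisc.2 ⟨hz', hw⟩))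
  exact ContinuousAt.comp (g := f) h2 h1

/-- On a small circle about `r z₀` the function `f(z₀, ·)` has no zero; by compactness Rouché's
condition holds there for all `z'` near `z₀`, which traps `r z'` in the closed disc. -/
theorem continuousOn_zero (hf : ContinuousOn f (polydisc (m + 1)))
    (hr : ∀ z' ∈ polydisc m, r z' ∈ disc)
    {g : (Fin m → ℂ) → ℂ → ℂ} (hg : ∀ z' ∈ polydisc m, ContinuousOn (g z') disc)
    (hg0 : ∀ z' ∈ polydisc m, ∀ w ∈ disc, g z' w ≠ 0)
    (hfg : ∀ z' ∈ polydisc m, ∀ w ∈ disc,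
      f (Fin.snoc (α := fun _ => ℂ) z' w) = g z' w * (w - r z')) :
    ContinuousOn r (polydisc m) := by
  intro z₀ hz₀
  refine ContinuousAt.continuousWithinAt ?_
  rw [Metric.continuousAt_iff']
  intro η hη
  obtain ⟨ρ, hρ, hball⟩ := Metric.isOpen_iff.1 isOpen_disc _ (hr z₀ hz₀)
  let ε := min (η / 2) (ρ / 2)
  have hε : 0 < ε := by positivity
  have hS : sphere (r z₀) ε ⊆ disc := fun w hw => hball (by
    rw [mem_ball, mem_sphere.1 hw]
    exact lt_of_le_of_lt (min_le_right _ _) (by linarith))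
  have hev : ∀ᶠ z' in 𝓝 z₀, ∀ w ∈ sphere (r z₀) ε,
      ‖f (Fin.snoc (α := fun _ => ℂ) z' w) - f (Fin.snoc (α := fun _ => ℂ) z₀ w)‖ <
        ‖f (Fin.snoc (α := fun _ => ℂ) z₀ w)‖ := by
    refine (isCompact_sphere (r z₀) ε).eventually_forall_of_forall_eventually fun w hw => ?_
    have h1 := continuousAt_comp_snoc hf hz₀ (hS hw)
    have h2 : ContinuousAt (fun x : (Fin m → ℂ) × ℂ => f (Fin.snoc (α := fun _ => ℂ) z₀ x.2))
        (z₀, w) := by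
      have h3 : ContinuousAt (fun x : (Fin m → ℂ) × ℂ => (z₀, x.2)) (z₀, w) := by fun_prop
      exact ContinuousAt.comp (f := fun x : (Fin m → ℂ) × ℂ => (z₀, x.2)) (x := (z₀, w))
        (g := fun x : (Fin m → ℂ) × ℂ => f (Fin.snoc (α := fun _ => ℂ) x.1 x.2)) h1 h3
    refine (h1.sub h2).norm.eventually_lt h2.norm ?_
    simp only [Pi.sub_apply, sub_self, norm_zero]
    rw [norm_pos_iff, hfg z₀ hz₀ w (hS hw)]
    refine mul_ne_zero (hg0 z₀ hz₀ w (hS hw)) fun h0 => ?_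
    rw [mem_sphere, dist_eq_norm, h0, norm_zero] at hw
    exact hε.ne hw
  filter_upwards [hev, (isOpen_polydisc m).mem_nhds hz₀] with z' hz' hzm
  rw [dist_eq_norm]
  refine lt_of_le_of_lt (norm_sub_le_of_rouche (g₀ := g z₀) (g₁ := g z') hε (hg z₀ hz₀) (hg z' hzm)
    (hg0 z₀ hz₀) (hg0 z' hzm) hS fun w hw => ?_)
    (lt_of_le_of_lt (min_le_left _ _) (half_lt_self hη))
  rw [← hfg z₀ hz₀ w (hS hw), ← hfg z' hzm w (hS hw)]
  exact hz' w hw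

/-- A bound for the modulus of continuity of `exp u * K` in terms of the Hölder seminorm of `u` and
the size of `exp u * (w - a) * K` on a circle. -/
theorem norm_exp_mul_sub_le {u K : ℂ → ℂ} {C α ρ F : ℝ} {a c : ℂ} (hρ : 0 < ρ)
    (hball : closedBall c ρ ⊆ disc) (hac : ‖a - c‖ ≤ ρ / 2)
    (hu : ∀ w ∈ disc, ‖u w‖ ≤ C)
    (hu' : ∀ w ∈ disc, ∀ w' ∈ disc, ‖u w - u w'‖ ≤ C * ‖w - w'‖ ^ α)
    (hK : DifferentiableOn ℂ K disc)
    (hF : ∀ w ∈ sphere c ρ, ‖Complex.exp (u w) * ((w - a) * K w)‖ ≤ F)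
    {w : ℂ} (hw : w ∈ ball c ρ) (hw1 : C * ‖w - c‖ ^ α ≤ 1) :
    ‖Complex.exp (u w) * K w - Complex.exp (u c) * K c‖ ≤
      Real.exp C * (Real.exp C * F / (ρ / 2)) * (2 * (C * ‖w - c‖ ^ α) + 2 / ρ * ‖w - c‖) := by
  set N := Real.exp C * F / (ρ / 2) with hN
  have hexp : ∀ w ∈ disc, ‖Complex.exp (u w)‖ ≤ Real.exp C := fun w hw => by
    rw [Complex.norm_exp]
    exact Real.exp_le_exp.2 ((Complex.re_le_norm _).trans (hu w hw))
  have hexp' : ∀ w ∈ disc, Real.exp (-C) ≤ ‖Complex.exp (u w)‖ := fun w hw => by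
    rw [Complex.norm_exp]
    refine Real.exp_le_exp.2 ?_
    have h1 := (abs_le.1 ((Complex.abs_re_le_norm (u w)).trans (hu w hw))).1
    linarith
  -- On the circle `‖w - a‖ ≥ ρ / 2`, so the factor `w - a` can be divided out; the maximum
  -- principle carries the bound inside.
  have hsph : ∀ w ∈ sphere c ρ, ‖K w‖ ≤ N := fun w hw => by
    have h1 := hF w hw
    have hwd := hball (sphere_subset_closedBall hw)
    have h2 : ρ / 2 ≤ ‖w - a‖ := by
      have h3 : ‖w - c‖ ≤ ‖w - a‖ + ‖a - c‖ := norm_sub_le_norm_sub_add_norm_sub _ _ _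
      rw [← dist_eq_norm w c, mem_sphere.1 hw] at h3
      linarith
    rw [norm_mul, norm_mul] at h1
    have h4 : Real.exp (-C) * (ρ / 2 * ‖K w‖) ≤ F := le_trans (by
      have := hexp' w hwd
      gcongr) h1
    rw [hN, le_div_iff₀ (by positivity)]
    have h5 := mul_le_mul_of_nonneg_left h4 (Real.exp_pos C).le
    rw [← mul_assoc, ← Real.exp_add, add_neg_cancel, Real.exp_zero, one_mul] at h5
    linarith
  have hbdd : ∀ w ∈ closedBall c ρ, ‖K w‖ ≤ N := fun w hw => by
    have hd : DiffContOnCl ℂ K (ball c ρ) := by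
      refine DifferentiableOn.diffContOnCl ?_
      exact hK.mono ((closure_ball_subset_closedBall).trans hball)
    refine Complex.norm_le_of_forall_mem_frontier_norm_le isBounded_ball hd (fun z hz => ?_) ?_
    · rw [frontier_ball c hρ.ne'] at hz
      exact hsph z hz
    · rwa [closure_ball c hρ.ne']
  have hwd : w ∈ disc := hball (ball_subset_closedBall hw)
  have hcd : c ∈ disc := hball (mem_closedBall_self hρ.le)
  have hKc := hbdd c (mem_closedBall_self hρ.le)
  have hKw := hbdd w (ball_subset_closedBall hw)
  have hN0 : 0 ≤ N := (norm_nonneg _).trans hKc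
  -- Schwarz's lemma: `K` maps the ball of radius `ρ` into the closed ball of radius `2 N` about `K
  -- c`.
  have hlip : ‖K w - K c‖ ≤ N * (2 / ρ * ‖w - c‖) := by
    have := Complex.dist_le_div_mul_dist_of_mapsTo_ball (f := K) (c := c) (R₁ := ρ) (R₂ := 2 * N)
      (hK.mono (ball_subset_closedBall.trans hball)) (fun z hz => by
        rw [mem_closedBall, dist_eq_norm]
        have := norm_sub_le (K z) (K c)
        have := hbdd z (ball_subset_closedBall hz)
        linarith) hw
    rw [dist_eq_norm, dist_eq_norm] at this
    refine this.trans (le_of_eq ?_)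
    ring
  have hexpd : ‖Complex.exp (u w) - Complex.exp (u c)‖ ≤ Real.exp C * (2 * (C * ‖w - c‖ ^ α)) := by
    have e : Complex.exp (u w) - Complex.exp (u c) =
        Complex.exp (u c) * (Complex.exp (u w - u c) - 1) := by
      rw [mul_sub, ← Complex.exp_add, add_sub_cancel, mul_one]
    have h1 := hu' w hwd c hcd
    rw [e, norm_mul]
    refine mul_le_mul (hexp c hcd) ?_ (norm_nonneg _) (Real.exp_pos C).le
    refine (Complex.norm_exp_sub_one_le (h1.trans hw1)).trans ?_
    linarith
  calc ‖Complex.exp (u w) * K w - Complex.exp (u c) * K c‖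
      = ‖(Complex.exp (u w) - Complex.exp (u c)) * K w + Complex.exp (u c) * (K w - K c)‖ := by
        congr 1; ring
    _ ≤ ‖Complex.exp (u w) - Complex.exp (u c)‖ * ‖K w‖ + ‖Complex.exp (u c)‖ * ‖K w - K c‖ := by
        refine (norm_add_le _ _).trans ?_
        rw [norm_mul, norm_mul]
    _ ≤ Real.exp C * (2 * (C * ‖w - c‖ ^ α)) * N + Real.exp C * (N * (2 / ρ * ‖w - c‖)) := by
        refine add_le_add (mul_le_mul hexpd hKw (norm_nonneg _) ((norm_nonneg _).trans hexpd))
          (mul_le_mul (hexp c hcd) hlip (norm_nonneg _) (Real.exp_pos C).le)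
    _ = _ := by ring

/-- Away from the zero, `exp u * K` is the quotient `f / (w - r z')`, continuous in `z'`; at height
`r z₀` this quotient degenerates. The modulus of continuity in `w`, uniform in `z'`, transfers
continuity from the nearby height `r z₀ + δ`. -/
theorem continuousAt_exp_mul {C α : ℝ} (hα : 0 < α) (hf : ContinuousOn f (polydisc (m + 1)))
    (hr : ∀ z' ∈ polydisc m, r z' ∈ disc) (hrc : ContinuousOn r (polydisc m))
    {u K : (Fin m → ℂ) → ℂ → ℂ}
    (hu : ∀ z' ∈ polydisc m, ∀ w ∈ disc, ‖u z' w‖ ≤ C)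
    (hu' : ∀ z' ∈ polydisc m, ∀ w ∈ disc, ∀ w' ∈ disc, ‖u z' w - u z' w'‖ ≤ C * ‖w - w'‖ ^ α)
    (hK : ∀ z' ∈ polydisc m, DifferentiableOn ℂ (K z') disc)
    (hfK : ∀ z' ∈ polydisc m, ∀ w ∈ disc, f (Fin.snoc (α := fun _ => ℂ) z' w) =
        Complex.exp (u z' w) * ((w - r z') * K z' w))
    {z₀ : Fin m → ℂ} (hz₀ : z₀ ∈ polydisc m) :
    ContinuousAt (fun z' => Complex.exp (u z' (r z₀)) * K z' (r z₀)) z₀ := by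
  set c := r z₀ with hc
  have hcd : c ∈ disc := hr z₀ hz₀
  have hnhds := (isOpen_polydisc m).mem_nhds hz₀
  have hrz : ContinuousAt r z₀ := hrc.continuousAt hnhds
  obtain ⟨ρ₁, hρ₁, hball₁⟩ := Metric.isOpen_iff.1 isOpen_disc _ hcd
  obtain ⟨ρ, hρ, hρ'⟩ := exists_between hρ₁
  have hball : closedBall c ρ ⊆ disc := (closedBall_subset_ball hρ').trans hball₁
  have hf₀ : ContinuousOn (fun w => f (Fin.snoc (α := fun _ => ℂ) z₀ w)) (sphere c ρ) :=
    fun w hw => by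
      have h1 := continuousAt_comp_snoc hf hz₀ (hball (sphere_subset_closedBall hw))
      have h2 : ContinuousAt (fun x : ℂ => (z₀, x)) w := by fun_prop
      exact (ContinuousAt.comp (f := fun x : ℂ => (z₀, x)) (x := w)
        (g := fun x : (Fin m → ℂ) × ℂ => f (Fin.snoc (α := fun _ => ℂ) x.1 x.2))
        h1 h2).continuousWithinAt
  obtain ⟨F, hF⟩ := (isCompact_sphere c ρ).exists_bound_of_continuousOn hf₀
  have hev : ∀ᶠ z' in 𝓝 z₀, ∀ w ∈ sphere c ρ,
      ‖f (Fin.snoc (α := fun _ => ℂ) z' w)‖ < F + 1 := by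
    refine (isCompact_sphere c ρ).eventually_forall_of_forall_eventually fun w hw => ?_
    have h1 := continuousAt_comp_snoc hf hz₀ (hball (sphere_subset_closedBall hw))
    refine h1.norm.eventually_lt continuousAt_const ?_
    exact lt_of_le_of_lt (hF w hw) (lt_add_one F)
  have hrev : ∀ᶠ z' in 𝓝 z₀, ‖r z' - c‖ ≤ ρ / 2 := by
    filter_upwards [Metric.continuousAt_iff'.1 hrz (ρ / 2) (half_pos hρ)] with z' hz'
    rw [← dist_eq_norm]; exact hz'.le
  rw [Metric.continuousAt_iff']
  intro η hη
  let modul : ℝ → ℝ := fun δ =>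
    Real.exp C * (Real.exp C * (F + 1) / (ρ / 2)) * (2 * (C * δ ^ α) + 2 / ρ * δ)
  have hpow : Tendsto (fun δ : ℝ => C * δ ^ α) (𝓝[>] 0) (𝓝 0) := by
    have h1 : Continuous fun δ : ℝ => C * δ ^ α :=
      continuous_const.mul (continuous_id.rpow_const fun _ => Or.inr hα.le)
    have h2 := h1.tendsto 0
    rw [Real.zero_rpow hα.ne', mul_zero] at h2
    exact h2.mono_left nhdsWithin_le_nhds
  have hmod : Tendsto modul (𝓝[>] 0) (𝓝 0) := by
    have h1 : Tendsto (fun δ : ℝ => 2 / ρ * δ) (𝓝[>] 0) (𝓝 0) := by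
      have h2 : Tendsto (fun δ : ℝ => 2 / ρ * δ) (𝓝 0) (𝓝 (2 / ρ * 0)) := by
        exact Continuous.tendsto (by fun_prop) 0
      rw [mul_zero] at h2
      exact h2.mono_left nhdsWithin_le_nhds
    have h3 := ((hpow.const_mul 2).add h1).const_mul
      (Real.exp C * (Real.exp C * (F + 1) / (ρ / 2)))
    simpa using h3
  -- `modul` depends only on `C`, `α`, `ρ` and `F`, so one `δ` works for all `z'` near `z₀`.
  obtain ⟨δ, ⟨⟨hδ1, hδm⟩, hδρ⟩, hδ0⟩ := (((hpow.eventually_le_const one_pos).and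
    (hmod.eventually_lt_const (show (0 : ℝ) < η / 3 by positivity))).and
      ((eventually_lt_nhds hρ).filter_mono nhdsWithin_le_nhds) |>.and self_mem_nhdsWithin).exists
  have hδ0 : 0 < δ := hδ0
  have hδn : ‖(c + δ) - c‖ = δ := by simp [abs_of_pos hδ0]
  have hwb : c + δ ∈ ball c ρ := by rw [mem_ball, dist_eq_norm, hδn]; exact hδρ
  have hwd : c + δ ∈ disc := hball (ball_subset_closedBall hwb)
  have hest : ∀ z' ∈ polydisc m, ‖r z' - c‖ ≤ ρ / 2 →
      (∀ w ∈ sphere c ρ, ‖f (Fin.snoc (α := fun _ => ℂ) z' w)‖ < F + 1) →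
      ‖Complex.exp (u z' (c + δ)) * K z' (c + δ) - Complex.exp (u z' c) * K z' c‖ < η / 3 := by
    intro z' hz' h1 h2
    have h3 := norm_exp_mul_sub_le (F := F + 1) hρ hball h1 (hu z' hz') (hu' z' hz') (hK z' hz')
      (fun w hw => by
        rw [← hfK z' hz' w (hball (sphere_subset_closedBall hw))]
        exact (h2 w hw).le) hwb (by rw [hδn]; exact hδ1)
    rw [hδn] at h3
    exact lt_of_le_of_lt h3 hδm
  have hQ : ContinuousAt (fun z' => f (Fin.snoc (α := fun _ => ℂ) z' (c + δ)) / (c + δ - r z'))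
      z₀ := by
    have h1 := continuousAt_comp_snoc hf hz₀ hwd
    have h2 : ContinuousAt (fun x : Fin m → ℂ => (x, c + (δ : ℂ))) z₀ := by fun_prop
    refine ContinuousAt.div (ContinuousAt.comp (f := fun x : Fin m → ℂ => (x, c + (δ : ℂ)))
      (x := z₀) (g := fun x : (Fin m → ℂ) × ℂ => f (Fin.snoc (α := fun _ => ℂ) x.1 x.2)) h1 h2)
      (continuousAt_const.sub hrz) ?_
    rw [← hc, add_sub_cancel_left]
    exact_mod_cast hδ0.ne'
  have hQe : ∀ z' ∈ polydisc m, r z' ≠ c + δ →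
      f (Fin.snoc (α := fun _ => ℂ) z' (c + δ)) / (c + δ - r z') =
        Complex.exp (u z' (c + δ)) * K z' (c + δ) := fun z' hz' hne => by
    rw [hfK z' hz' _ hwd]
    have := sub_ne_zero.2 hne.symm
    field_simp
  have hne₀ : r z₀ ≠ c + δ := by
    rw [← hc]
    intro h
    have h1 : (δ : ℂ) = 0 := by simpa using h
    exact hδ0.ne' (by exact_mod_cast h1)
  filter_upwards [hev, hrev, hnhds, hrz.eventually_ne hne₀,
    Metric.continuousAt_iff'.1 hQ (η / 3) (by positivity)] with z' h1 h2 hz' h3 h4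
  rw [hQe z' hz' h3, hQe z₀ hz₀ hne₀, dist_eq_norm] at h4
  have h5 := hest z' hz' h2 h1
  have h6 := hest z₀ hz₀ (by rw [← hc, sub_self, norm_zero]; positivity)
    (fun w hw => lt_of_le_of_lt (hF w hw) (lt_add_one F))
  rw [dist_eq_norm]
  rw [norm_sub_rev] at h5
  have h7 := norm_sub_le_norm_sub_add_norm_sub (Complex.exp (u z' c) * K z' c)
    (Complex.exp (u z' (c + δ)) * K z' (c + δ)) (Complex.exp (u z₀ c) * K z₀ c)
  have h8 := norm_sub_le_norm_sub_add_norm_sub (Complex.exp (u z' (c + δ)) * K z' (c + δ))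
    (Complex.exp (u z₀ (c + δ)) * K z₀ (c + δ)) (Complex.exp (u z₀ c) * K z₀ c)
  linarith

/-- The difference quotient of the product at `a` is `q` times that of `H`, so continuity of `q` is
enough. -/
theorem differentiableAt_mul_of_eq_zero {q H : ℂ → ℂ} {a : ℂ} (hq : ContinuousAt q a)
    (hH : DifferentiableAt ℂ H a) (h0 : H a = 0) : DifferentiableAt ℂ (fun w => q w * H w) a := by
  have h1 : HasDerivAt (fun w => q w * H w) (q a * deriv H a) a := by
    rw [hasDerivAt_iff_tendsto_slope]
    have h2 := (hasDerivAt_iff_tendsto_slope.1 hH.hasDerivAt)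
    refine ((hq.tendsto.mono_left nhdsWithin_le_nhds).mul h2).congr fun w => ?_
    simp only [slope_def_field, h0, mul_zero, sub_zero]
    ring
  exact h1.differentiableAt

/-- The zero depends holomorphically on the remaining variables, separately in each of them. -/
theorem isSeparatelyHolomorphic_zero (hp : 2 < p) (hf : ContinuousOn f (polydisc (m + 1)))
    (hL : ConditionL p f)
    (hr : ∀ z' ∈ polydisc m, r z' ∈ disc ∧
      ∀ w ∈ disc, f (Fin.snoc (α := fun _ => ℂ) z' w) = 0 ↔ w = r z')
    (hmult : ∀ z' ∈ polydisc m,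
      HasMultiplicity (fun w => f (Fin.snoc (α := fun _ => ℂ) z' w)) (r z') 1) :
    IsSeparatelyHolomorphic r := by
  obtain ⟨C, α, -, hα, u, K, huK⟩ := exists_factorization hp hf hL hr hmult
  have hcu : ∀ z' ∈ polydisc m, ContinuousOn (u z') disc := fun z' hz' =>
    continuousOn_of_holder hα (huK z' hz').2.1
  have hrd : ∀ z' ∈ polydisc m, r z' ∈ disc := fun z' hz' => (hr z' hz').1
  have hrc : ContinuousOn r (polydisc m) := by
    refine continuousOn_zero (g := fun z' w => Complex.exp (u z' w) * K z' w) hf hrd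
      (fun z' hz' => (hcu z' hz').cexp.mul (huK z' hz').2.2.1.continuousOn)
      (fun z' hz' w hw => mul_ne_zero (Complex.exp_ne_zero _) ((huK z' hz').2.2.2.1 w hw))
      fun z' hz' w hw => ?_
    rw [(huK z' hz').2.2.2.2 w hw]; ring
  refine ⟨hrc, fun j z hz ζ hζ => DifferentiableAt.differentiableWithinAt ?_⟩
  set z₀ := Function.update z j ζ with hz₀
  have hz₀m : z₀ ∈ polydisc m := update_mem_polydisc hz j hζ
  set c := r z₀ with hc
  have hcd : c ∈ disc := hrd z₀ hz₀m
  -- At the fixed height `c = r z₀`, `f = (c - r z') G(z')` with `G = exp u * K`. Continuity of `G`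
  -- is available only at `z₀`, which suffices since `ζ` is arbitrary.
  have hGc := continuousAt_exp_mul hα hf hrd hrc (fun z' hz' => (huK z' hz').1)
    (fun z' hz' => (huK z' hz').2.1) (fun z' hz' => (huK z' hz').2.2.1)
    (fun z' hz' => (huK z' hz').2.2.2.2) hz₀m
  have hG0 : ∀ z' ∈ polydisc m, Complex.exp (u z' c) * K z' c ≠ 0 := fun z' hz' =>
    mul_ne_zero (Complex.exp_ne_zero _) ((huK z' hz').2.2.2.1 c hcd)
  obtain ⟨M, hM⟩ := hL
  obtain ⟨C₁, α₁, -, hα₁, hint⟩ := exists_integratingFactor hp M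
  have hzc : Fin.snoc (α := fun _ => ℂ) z c ∈ polydisc (m + 1) := snoc_mem_polydisc.2 ⟨hz, hcd⟩
  -- A second integrating factor `v`, now on the line through `(z₀, c)` in the `j`-th direction of
  -- the base.
  obtain ⟨A, hA, hAM, hwk⟩ := hM j.castSucc _ hzc
  obtain ⟨v, -, hv2, hv3⟩ := hint A hA hAM
  have hif := hv3 _ (continuousOn_slice hf j.castSucc hzc) hwk
  have hsl : ∀ w, slice f j.castSucc (Fin.snoc (α := fun _ => ℂ) z c) w =
      f (Fin.snoc (α := fun _ => ℂ) (Function.update z j w) c) := fun w => by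
    rw [slice, Fin.snoc_update]
  have hH0 : Complex.exp (-v ζ) * slice f j.castSucc (Fin.snoc (α := fun _ => ℂ) z c) ζ = 0 := by
    rw [hsl, ← hz₀, ((hr z₀ hz₀m).2 c hcd).2 rfl, mul_zero]
  have hvc : ContinuousAt v ζ := hif.1.continuousAt (isOpen_disc.mem_nhds hζ)
  have hup : ContinuousAt (fun w => Function.update z j w) ζ :=
    (continuous_const.update j continuous_id).continuousAt
  have hq : ContinuousAt (fun w => Complex.exp (v w) / (Complex.exp (u (Function.update z j w) c) *
      K (Function.update z j w) c)) ζ :=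
    hvc.cexp.div (ContinuousAt.comp (f := fun w => Function.update z j w) (x := ζ) hGc hup)
      (hG0 z₀ hz₀m)
  -- This is `r = c - (exp v / G) * (exp (-v) * f)` along the line; the last factor is holomorphic
  -- and vanishes at `ζ`.
  have hd := (differentiableAt_const c).sub (differentiableAt_mul_of_eq_zero hq
    (hif.2.differentiableAt (isOpen_disc.mem_nhds hζ)) hH0)
  refine hd.congr_of_eventuallyEq ?_
  filter_upwards [isOpen_disc.mem_nhds hζ] with w hw
  have hwm := update_mem_polydisc hz j hw
  have h1 := hG0 _ hwm
  simp only [Pi.sub_apply]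
  rw [hsl, (huK _ hwm).2.2.2.2 c hcd, slice, Complex.exp_neg]
  have h2 := Complex.exp_ne_zero (v w)
  have h3 := (huK _ hwm).2.2.2.1 c hcd
  have h4 := Complex.exp_ne_zero (u (Function.update z j w) c)
  field_simp
  ring

end Zeros

/-! ### Removing the zero set -/

section Removable

theorem exists_smooth_cutoff_away_from_zero : ∃ η : ℂ → ℂ, ContDiff ℝ ∞ η ∧
    (∀ t, ‖t‖ ≤ 1 → η t = 0) ∧ (∀ t, 2 ≤ ‖t‖ → η t = 1) ∧ (∀ t, ‖η t‖ ≤ 1) ∧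
    ∃ D, ∀ t, ‖fderiv ℝ η t‖ ≤ D := by
  let b : ContDiffBump (0 : ℂ) := ⟨1, 2, one_pos, one_lt_two⟩
  have hb : ContDiff ℝ ∞ fun t : ℂ => (b t : ℂ) := Complex.ofRealCLM.contDiff.comp b.contDiff
  have hbc : HasCompactSupport fun t : ℂ => (b t : ℂ) :=
    b.hasCompactSupport.comp_left (g := Complex.ofReal) rfl
  refine ⟨fun t => 1 - (b t : ℂ), contDiff_const.sub hb, fun t ht => ?_, fun t ht => ?_,
    fun t => ?_, ?_⟩
  · have : t ∈ closedBall (0 : ℂ) b.rIn := by simpa using ht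
    simp [b.one_of_mem_closedBall this]
  · have : b t = 0 := b.zero_of_le_dist (by simpa using ht)
    simp [this]
  · beta_reduce
    rw [← Complex.ofReal_one, ← Complex.ofReal_sub, Complex.norm_real, Real.norm_eq_abs, abs_le]
    have h1 : b t ≤ 1 := b.le_one
    have h2 : 0 ≤ b t := b.nonneg
    constructor <;> linarith
  · obtain ⟨D, hD⟩ := (hb.continuous_fderiv (by simp)).bounded_above_of_compact_support
      (hbc.fderiv (𝕜 := ℝ))
    refine ⟨D, fun t => ?_⟩
    rw [fderiv_const_sub, norm_neg]
    exact hD t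

variable {E : Type*} [NormedAddCommGroup E] [NormedSpace ℂ E]

theorem norm_dbar_le (e : E) (φ : E → ℂ) (z : E) : ‖dbar e φ z‖ ≤ ‖fderiv ℝ φ z‖ * ‖e‖ := by
  have h1 := (fderiv ℝ φ z).le_opNorm e
  have h2 := (fderiv ℝ φ z).le_opNorm (Complex.I • e)
  rw [norm_smul, Complex.norm_I, one_mul] at h2
  rw [dbar, norm_mul]
  have h3 := norm_add_le (fderiv ℝ φ z e) (Complex.I * fderiv ℝ φ z (Complex.I • e))
  rw [norm_mul, Complex.norm_I, one_mul] at h3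
  have h4 : ‖(1 / 2 : ℂ)‖ = 1 / 2 := by simp
  rw [h4]
  linarith

variable {U : Set E} {s φ η : E → ℂ}

theorem IsTestFunction.cutoff_mul {η : ℂ → ℂ} (hU : IsOpen U) (hs : ContDiffOn ℝ ∞ s U)
    (hη : ContDiff ℝ ∞ η) (hη0 : ∀ t, ‖t‖ ≤ 1 → η t = 0) (hφ : IsTestFunction U φ) (κ : ℝ) :
    IsTestFunction {z | z ∈ U ∧ s z ≠ 0} fun z => η (κ * s z) * φ z := by
  have h1 : IsTestFunction U fun z => η (κ * s z) * φ z :=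
    hφ.mul_left_of_contDiffOn hU (hη.comp_contDiffOn (contDiffOn_const.mul hs)) hφ.2.2
  refine ⟨h1.1, h1.2.1, fun z hz => ⟨h1.2.2 hz, fun h0 => ?_⟩⟩
  refine notMem_tsupport_iff_eventuallyEq.2 ?_ hz
  have h2 : ContinuousAt (fun z => ‖(κ : ℂ) * s z‖) z :=
    (continuousAt_const.mul (hs.continuousOn.continuousAt (hU.mem_nhds (h1.2.2 hz)))).norm
  have h3 : ‖(κ : ℂ) * s z‖ < 1 := by rw [h0]; simp
  filter_upwards [h2.eventually_lt_const h3] with y hy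
  simp [hη0 _ hy.le]

/-- By the product rule the commutator is the derivative of `η (κ s)` times `φ`. It vanishes where
`κ ‖s‖ > 2`, since `η (κ s)` is locally 1 there, and the chain rule contributes one factor `κ`. -/
theorem exists_commutator_bound {η : ℂ → ℂ} {D : ℝ} (hU : IsOpen U) (hs : ContDiffOn ℝ ∞ s U)
    (hη : ContDiff ℝ ∞ η) (hη1 : ∀ t, 2 ≤ ‖t‖ → η t = 1) (hD : ∀ t, ‖fderiv ℝ η t‖ ≤ D)
    (hφ : IsTestFunction U φ) (e : E) :
    ∃ C : ℝ, 0 ≤ C ∧ ∀ κ : ℝ, 0 < κ → ∀ z,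
      ‖dbar e (fun z => η (κ * s z) * φ z) z - η (κ * s z) * dbar e φ z‖ ≤
        indicator {z | z ∈ U ∧ ‖s z‖ ≤ 2 / κ} (fun _ => C * κ) z := by
  have hsc : ContinuousOn (fderiv ℝ s) (tsupport φ) :=
    (hs.continuousOn_fderiv_of_isOpen hU (by simp)).mono hφ.2.2
  obtain ⟨S, hS⟩ := hφ.2.1.isCompact.exists_bound_of_continuousOn hsc
  obtain ⟨N, hN⟩ := hφ.continuous.bounded_above_of_compact_support hφ.2.1
  have hN0 : 0 ≤ N := (norm_nonneg _).trans (hN 0)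
  have hD0 : 0 ≤ D := (norm_nonneg _).trans (hD 0)
  refine ⟨D * |S| * ‖e‖ * N, by positivity, fun κ hκ z => ?_⟩
  have hnn : 0 ≤ indicator {z | z ∈ U ∧ ‖s z‖ ≤ 2 / κ} (fun _ => D * |S| * ‖e‖ * N * κ) z :=
    indicator_nonneg (fun _ _ => by positivity) z
  by_cases hz : z ∈ tsupport φ
  swap
  · have h1 : φ =ᶠ[𝓝 z] fun _ => 0 := notMem_tsupport_iff_eventuallyEq.1 hz
    have h2 : (fun z => η (κ * s z) * φ z) =ᶠ[𝓝 z] fun _ => 0 := by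
      filter_upwards [h1] with y hy; simp [hy]
    rw [dbar_congr h1, dbar_congr h2]
    simpa [dbar] using hnn
  have hzU := hφ.2.2 hz
  have hsd : DifferentiableAt ℝ s z :=
    (hs.contDiffAt (hU.mem_nhds hzU)).differentiableAt (by simp)
  by_cases hsz : ‖s z‖ ≤ 2 / κ
  · rw [indicator_of_mem (show z ∈ {z | z ∈ U ∧ ‖s z‖ ≤ 2 / κ} from ⟨hzU, hsz⟩)]
    have hηd : HasFDerivAt η (fderiv ℝ η (κ * s z)) (κ * s z) :=
      (hη.differentiable (by simp) _).hasFDerivAt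
    have hcs : HasFDerivAt (fun z => (κ : ℂ) * s z) ((κ : ℂ) • fderiv ℝ s z) z :=
      hsd.hasFDerivAt.const_mul (κ : ℂ)
    have hcomp : HasFDerivAt (fun z => η (κ * s z))
        ((fderiv ℝ η (κ * s z)).comp ((κ : ℂ) • fderiv ℝ s z)) z := hηd.comp z hcs
    rw [dbar_mul hcomp.differentiableAt (hφ.differentiable z), add_sub_cancel_left, norm_mul]
    have h3 : ‖fderiv ℝ (fun z => η (κ * s z)) z‖ ≤ D * (κ * |S|) := by
      rw [hcomp.fderiv]
      refine (ContinuousLinearMap.opNorm_comp_le _ _).trans ?_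
      rw [norm_smul, Complex.norm_real, Real.norm_of_nonneg hκ.le]
      have h4 := (hS z hz).trans (le_abs_self S)
      have h5 := hD (κ * s z)
      gcongr
    calc _ ≤ (D * (κ * |S|) * ‖e‖) * N := by
          have h6 := (norm_dbar_le e (fun z => η (κ * s z)) z).trans
            (mul_le_mul_of_nonneg_right h3 (norm_nonneg e))
          exact mul_le_mul h6 (hN z) (norm_nonneg _) (by positivity)
      _ = _ := by ring
  · have h1 : (fun z => η (κ * s z) * φ z) =ᶠ[𝓝 z] φ := by
      have h2 : ContinuousAt (fun z => ‖s z‖) z := hsd.continuousAt.norm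
      filter_upwards [h2.eventually_const_lt (not_le.1 hsz)] with y hy
      rw [hη1, one_mul]
      rw [norm_mul, Complex.norm_real, Real.norm_of_nonneg hκ.le]
      rw [div_lt_iff₀ hκ] at hy
      linarith
    have h2 : η (κ * s z) = 1 := by
      rw [hη1]
      rw [norm_mul, Complex.norm_real, Real.norm_of_nonneg hκ.le]
      rw [not_le, div_lt_iff₀ hκ] at hsz
      linarith
    rw [dbar_congr h1, h2, one_mul, sub_self, norm_zero]
    exact hnn

variable {n : ℕ}

/-- The main term converges by dominated convergence. By Cauchy–Schwarz the commutator term is at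
most `C κ` times the root of the tube volume, which is at most `(2 / κ) c^(1/2)`, times the `L²`
norm of `b` on the tube. The powers of `κ` cancel exactly and the last factor tends to zero. -/
theorem tendsto_integral_mul_dbar_cutoff {U : Set (Fin n → ℂ)} {s b φ : (Fin n → ℂ) → ℂ}
    {η : ℂ → ℂ} {D : ℝ} {c : ℝ≥0∞}
    (hU : IsOpen U) (hs : ContDiffOn ℝ ∞ s U) (hη : ContDiff ℝ ∞ η)
    (hη1 : ∀ t, 2 ≤ ‖t‖ → η t = 1) (hηb : ∀ t, ‖η t‖ ≤ 1) (hD : ∀ t, ‖fderiv ℝ η t‖ ≤ D)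
    (hc : c ≠ ⊤) (hvol : ∀ ε : ℝ, volume {z | z ∈ U ∧ ‖s z‖ ≤ ε} ≤ ENNReal.ofReal ε ^ 2 * c)
    (hb : MemLp b 2 (volume.restrict U)) (hφ : IsTestFunction U φ) (e : Fin n → ℂ) :
    Tendsto (fun κ : ℝ => ∫ z, b z * dbar e (fun z => η (κ * s z) * φ z) z) atTop
      (𝓝 (∫ z, b z * dbar e φ z)) := by
  have hbl := locallyIntegrableOn_of_memLp_two hU hb
  obtain ⟨C, hC, hbd⟩ := exists_commutator_bound hU hs hη hη1 hD hφ e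
  have htest : ∀ κ : ℝ, IsTestFunction U fun z => η (κ * s z) * φ z := fun κ =>
    hφ.mul_left_of_contDiffOn hU (hη.comp_contDiffOn (contDiffOn_const.mul hs)) hφ.2.2
  have htest' : ∀ κ : ℝ, IsTestFunction U fun z => η (κ * s z) * dbar e φ z := fun κ =>
    (hφ.dbar e).mul_left_of_contDiffOn hU (hη.comp_contDiffOn (contDiffOn_const.mul hs))
      (hφ.dbar e).2.2
  have hi : ∀ κ : ℝ, Integrable fun z => b z * dbar e (fun z => η (κ * s z) * φ z) z :=
    fun κ => ((htest κ).dbar e).integrable_mul hbl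
  have hi' : ∀ κ : ℝ, Integrable fun z => b z * (η (κ * s z) * dbar e φ z) :=
    fun κ => (htest' κ).integrable_mul hbl
  let R : ℝ → Set (Fin n → ℂ) := fun ε => {z | z ∈ U ∧ ‖s z‖ ≤ ε}
  have hRm : ∀ ε, MeasurableSet (R ε) := fun ε => by
    have h1 : IsOpen (U ∩ (fun z => ‖s z‖) ⁻¹' Ioi ε) :=
      hs.continuousOn.norm.isOpen_inter_preimage hU isOpen_Ioi
    have h2 : R ε = U \ (U ∩ (fun z => ‖s z‖) ⁻¹' Ioi ε) := by
      ext z; simp [R]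
    rw [h2]
    exact hU.measurableSet.diff h1.measurableSet
  -- The volume bound with `ε = 0` makes the zero set of `s` null.
  have hnull : ∀ᵐ z, z ∈ U → s z ≠ 0 := by
    have h1 : volume (R 0) = 0 := by simpa [R] using hvol 0
    filter_upwards [measure_eq_zero_iff_ae_notMem.1 h1] with z hz hzU h0
    exact hz ⟨hzU, by simp [h0]⟩
  have hmain : Tendsto (fun κ : ℝ => ∫ z, b z * (η (κ * s z) * dbar e φ z)) atTop
      (𝓝 (∫ z, b z * dbar e φ z)) := by
    refine tendsto_integral_filter_of_dominated_convergence (fun z => ‖b z * dbar e φ z‖)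
      (Eventually.of_forall fun κ => (hi' κ).aestronglyMeasurable) ?_
      ((hφ.dbar e).integrable_mul hbl).norm ?_
    · refine Eventually.of_forall fun κ => Eventually.of_forall fun z => ?_
      rw [norm_mul, norm_mul, norm_mul]
      exact mul_le_mul_of_nonneg_left (mul_le_of_le_one_left (norm_nonneg _) (hηb _))
        (norm_nonneg _)
    · filter_upwards [hnull] with z hz
      by_cases hzU : z ∈ U
      · refine tendsto_const_nhds.congr' ?_
        have hs0 : 0 < ‖s z‖ := norm_pos_iff.2 (hz hzU)
        filter_upwards [eventually_ge_atTop (2 / ‖s z‖), eventually_ge_atTop 0] with κ hκ hκ0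
        rw [hη1, one_mul]
        rw [norm_mul, Complex.norm_real, Real.norm_of_nonneg hκ0]
        rwa [div_le_iff₀ hs0] at hκ
      · have : dbar e φ z = 0 := image_eq_zero_of_notMem_tsupport fun h => hzU ((hφ.dbar e).2.2 h)
        simp [this]
  have hvol0 : Tendsto (fun κ : ℝ => volume.restrict U (R (2 / κ))) atTop (𝓝 0) := by
    have h1 : Tendsto (fun κ : ℝ => ENNReal.ofReal (2 / κ) ^ 2 * c) atTop (𝓝 0) := by
      have h2 : Tendsto (fun κ : ℝ => 2 / κ) atTop (𝓝 0) := tendsto_const_nhds.div_atTop tendsto_id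
      have h3 := ENNReal.Tendsto.pow (n := 2) (ENNReal.tendsto_ofReal h2)
      have h4 := ENNReal.Tendsto.mul_const (b := c) h3 (Or.inr hc)
      simpa using h4
    exact tendsto_of_tendsto_of_tendsto_of_le_of_le tendsto_const_nhds h1 (fun _ => zero_le)
      fun κ => (Measure.restrict_apply_le _ _).trans (hvol _)
  -- Absolute continuity of the `L²` norm, as the tubes shrink in volume.
  have hL2 : Tendsto (fun κ : ℝ => eLpNorm b 2 (volume.restrict (R (2 / κ)))) atTop (𝓝 0) := by
    rw [ENNReal.tendsto_nhds_zero]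
    intro ε hε
    obtain ⟨ε', hε', hε''⟩ := ENNReal.lt_iff_exists_real_btwn.1 hε
    have hε'0 : 0 < ε' := ENNReal.ofReal_pos.1 hε''.1
    obtain ⟨δ, hδ, h1⟩ := hb.eLpNorm_indicator_le one_le_two (by simp) hε'0
    filter_upwards [hvol0.eventually_le_const (ENNReal.ofReal_pos.2 hδ)] with κ hκ
    have h2 := h1 _ (hRm _) hκ
    rw [eLpNorm_indicator_eq_eLpNorm_restrict (hRm _), Measure.restrict_restrict (hRm _),
      inter_eq_left.2 (fun z hz => hz.1)] at h2
    exact h2.trans hε''.2.le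
  have herr : Tendsto (fun κ : ℝ => ∫ z, b z * (dbar e (fun z => η (κ * s z) * φ z) z -
      η (κ * s z) * dbar e φ z)) atTop (𝓝 0) := by
    rw [tendsto_zero_iff_enorm_tendsto_zero]
    have hlim : Tendsto (fun κ : ℝ => ENNReal.ofReal (2 * C) * c ^ (1 / 2 : ℝ) *
        eLpNorm b 2 (volume.restrict (R (2 / κ)))) atTop (𝓝 0) := by
      have := ENNReal.Tendsto.const_mul (a := ENNReal.ofReal (2 * C) * c ^ (1 / 2 : ℝ)) hL2
        (Or.inr (ENNReal.mul_ne_top ENNReal.ofReal_ne_top (ENNReal.rpow_ne_top_of_nonneg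
          (by norm_num) hc)))
      simpa using this
    refine tendsto_of_tendsto_of_tendsto_of_le_of_le' tendsto_const_nhds hlim
      (Eventually.of_forall fun _ => zero_le) ?_
    filter_upwards [eventually_gt_atTop 0] with κ hκ
    have hbR : AEStronglyMeasurable b (volume.restrict (R (2 / κ))) :=
      hb.aestronglyMeasurable.mono_measure (Measure.restrict_mono (fun z hz => hz.1) le_rfl)
    calc _ ≤ ∫⁻ z, ‖b z * (dbar e (fun z => η (κ * s z) * φ z) z -
          η (κ * s z) * dbar e φ z)‖ₑ := enorm_integral_le_lintegral_enorm _
      _ ≤ ∫⁻ z, indicator (R (2 / κ)) (fun z => ENNReal.ofReal (C * κ) * ‖b z‖ₑ) z := by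
          refine lintegral_mono fun z => ?_
          have h1 := hbd κ hκ z
          rw [enorm_mul]
          by_cases hz : z ∈ R (2 / κ)
          · rw [indicator_of_mem hz, mul_comm]
            rw [indicator_of_mem (show z ∈ {z | z ∈ U ∧ ‖s z‖ ≤ 2 / κ} from hz)] at h1
            gcongr
            rw [← ofReal_norm]
            exact ENNReal.ofReal_le_ofReal h1
          · rw [indicator_of_notMem (show z ∉ {z | z ∈ U ∧ ‖s z‖ ≤ 2 / κ} from hz)] at h1
            rw [norm_le_zero_iff.1 h1]
            simp
      _ = ENNReal.ofReal (C * κ) * eLpNorm b 1 (volume.restrict (R (2 / κ))) := by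
          rw [lintegral_indicator (hRm _), lintegral_const_mul' _ _ ENNReal.ofReal_ne_top,
            eLpNorm_one_eq_lintegral_enorm]
      _ ≤ ENNReal.ofReal (C * κ) * (eLpNorm b 2 (volume.restrict (R (2 / κ))) *
            (ENNReal.ofReal (2 / κ) * c ^ (1 / 2 : ℝ))) := by
          gcongr
          refine (eLpNorm_le_eLpNorm_mul_rpow_measure_univ one_le_two hbR).trans ?_
          gcongr
          rw [Measure.restrict_apply_univ]
          have h1 := ENNReal.rpow_le_rpow (z := 1 / 2) (hvol (2 / κ)) (by norm_num)
          rw [ENNReal.mul_rpow_of_nonneg _ _ (by norm_num), ← ENNReal.rpow_natCast,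
            ← ENNReal.rpow_mul] at h1
          norm_num at h1 ⊢
          exact h1
      _ = _ := by
          have h2 : ENNReal.ofReal (2 * C) = ENNReal.ofReal (C * κ) * ENNReal.ofReal (2 / κ) := by
            rw [← ENNReal.ofReal_mul (by positivity)]
            congr 1
            field_simp
          rw [h2]; ring
  have h := herr.add hmain
  rw [zero_add] at h
  refine h.congr fun κ => ?_
  rw [← integral_add ?_ (hi' κ)]
  · congr 1; ext z; ring
  · simp only [mul_sub]
    exact (hi κ).sub (hi' κ)

/-- A hypersurface `{s = 0}` whose tubular neighbourhoods have quadratically small volume is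
removable for square integrable solutions of `∂b'/∂z̄_e = ∂b/∂z̄_{e'}`. -/
theorem integral_mul_dbar_symm_of_removable {U : Set (Fin n → ℂ)} {s b b' φ : (Fin n → ℂ) → ℂ}
    {e e' : Fin n → ℂ} {c : ℝ≥0∞} (hU : IsOpen U) (hs : ContDiffOn ℝ ∞ s U)
    (hc : c ≠ ⊤) (hvol : ∀ ε : ℝ, volume {z | z ∈ U ∧ ‖s z‖ ≤ ε} ≤ ENNReal.ofReal ε ^ 2 * c)
    (hb : MemLp b 2 (volume.restrict U)) (hb' : MemLp b' 2 (volume.restrict U))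
    (h : ∀ ψ, IsTestFunction {z | z ∈ U ∧ s z ≠ 0} ψ →
      ∫ z, b' z * dbar e ψ z = ∫ z, b z * dbar e' ψ z)
    (hφ : IsTestFunction U φ) :
    ∫ z, b' z * dbar e φ z = ∫ z, b z * dbar e' φ z := by
  obtain ⟨η, hη, hη0, hη1, hηb, D, hD⟩ := exists_smooth_cutoff_away_from_zero
  refine tendsto_nhds_unique
    (tendsto_integral_mul_dbar_cutoff hU hs hη hη1 hηb hD hc hvol hb' hφ e) ?_
  refine (tendsto_integral_mul_dbar_cutoff hU hs hη hη1 hηb hD hc hvol hb hφ e').congr fun κ => ?_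
  exact (h _ (hφ.cutoff_mul hU hs hη hη0 κ)).symm

theorem contDiffOn_sub_zero {m : ℕ} {r : (Fin m → ℂ) → ℂ} (hr : ContDiffOn ℂ ∞ r (polydisc m)) :
    ContDiffOn ℝ ∞ (fun z : Fin (m + 1) → ℂ => z (Fin.last m) - r (Fin.init z))
      (polydisc (m + 1)) := by
  have h1 : ContDiff ℝ ∞ fun z : Fin (m + 1) → ℂ => (Fin.init z : Fin m → ℂ) :=
    contDiff_pi.2 fun i => contDiff_apply ℝ ℂ (Fin.castSucc i)
  have h2 : MapsTo (fun z : Fin (m + 1) → ℂ => (Fin.init z : Fin m → ℂ)) (polydisc (m + 1))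
      (polydisc m) := by
    intro z hz i
    exact hz i.castSucc
  exact (contDiff_apply ℝ ℂ (Fin.last m)).contDiffOn.sub
    ((hr.restrict_scalars ℝ).comp h1.contDiffOn h2)

/-- The volume of the part of the polydisc at vertical distance at most `ε` from a graph. -/
theorem volume_near_graph_le {m : ℕ} {r : (Fin m → ℂ) → ℂ} (hr : ContinuousOn r (polydisc m))
    (ε : ℝ) :
    volume {z : Fin (m + 1) → ℂ | z ∈ polydisc (m + 1) ∧ ‖z (Fin.last m) - r (Fin.init z)‖ ≤ ε} ≤
      ENNReal.ofReal ε ^ 2 * (NNReal.pi * volume (polydisc m)) := by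
  set S := {z : Fin (m + 1) → ℂ | z ∈ polydisc (m + 1) ∧ ‖z (Fin.last m) - r (Fin.init z)‖ ≤ ε}
    with hS
  have hinit : Continuous fun z : Fin (m + 1) → ℂ => (Fin.init z : Fin m → ℂ) :=
    continuous_pi fun i => continuous_apply (Fin.castSucc i)
  have hc : ContinuousOn (fun z : Fin (m + 1) → ℂ => ‖z (Fin.last m) - r (Fin.init z)‖)
      (polydisc (m + 1)) := by
    refine ((continuous_apply (Fin.last m)).continuousOn.sub
      (hr.comp hinit.continuousOn ?_)).norm
    intro z hz i
    exact hz i.castSucc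
  have hSm : MeasurableSet S := by
    have h2 : S = polydisc (m + 1) \ (polydisc (m + 1) ∩
        (fun z : Fin (m + 1) → ℂ => ‖z (Fin.last m) - r (Fin.init z)‖) ⁻¹' Ioi ε) := by
      ext z; simp [S]
    rw [h2]
    exact (isOpen_polydisc _).measurableSet.diff
      (hc.isOpen_inter_preimage (isOpen_polydisc _) isOpen_Ioi).measurableSet
  rw [← lintegral_indicator_one hSm, lintegral_eq_lintegral_slices (Fin.last m)
    (measurable_one.indicator hSm)]
  -- Each vertical slice of the tube lies in a closed disc of radius `ε` about `r y`, of area `π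
  -- ε²`; for negative `ε` both sides are zero.
  have hle : ∀ y : Fin m → ℂ, ∫⁻ w : ℂ, S.indicator (1 : (Fin (m + 1) → ℂ) → ℝ≥0∞)
      ((Fin.last m).insertNth (α := fun _ => ℂ) w y) ≤
      (polydisc m).indicator (fun _ => ENNReal.ofReal ε ^ 2 * NNReal.pi) y := by
    intro y
    have hmem : ∀ w, (Fin.last m).insertNth (α := fun _ => ℂ) w y ∈ S →
        y ∈ polydisc m ∧ w ∈ closedBall (r y) ε := fun w hw => by
      have h1 := (insertNth_mem_polydisc _).1 hw.1
      have h2 := hw.2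
      simp only [Fin.insertNth_last', Fin.snoc_last, Fin.init_snoc] at h2
      exact ⟨h1.2, by rwa [mem_closedBall, dist_eq_norm]⟩
    by_cases hy : y ∈ polydisc m
    · rw [indicator_of_mem hy, ← Complex.volume_closedBall (r y) ε,
        ← lintegral_indicator_one measurableSet_closedBall]
      refine lintegral_mono fun w => ?_
      by_cases hw : (Fin.last m).insertNth (α := fun _ => ℂ) w y ∈ S
      · rw [indicator_of_mem hw, indicator_of_mem (hmem w hw).2]
        simp
      · rw [indicator_of_notMem hw]; exact zero_le
    · have : ∀ w, S.indicator (1 : (Fin (m + 1) → ℂ) → ℝ≥0∞)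
          ((Fin.last m).insertNth (α := fun _ => ℂ) w y) = 0 := fun w =>
        indicator_of_notMem (fun hw => hy (hmem w hw).1) _
      simp only [this, lintegral_zero, zero_le]
  refine (lintegral_mono hle).trans ?_
  rw [lintegral_indicator (isOpen_polydisc m).measurableSet, setLIntegral_const, mul_assoc]

/-- Trivial extensions are `∂̄`-closed if the zero set is the graph of a holomorphic function. -/
theorem IsTrivialExtension.isDbarClosed {m : ℕ} {p : ℝ≥0∞} {f : (Fin (m + 1) → ℂ) → ℂ}
    {r : (Fin m → ℂ) → ℂ} {B : Fin (m + 1) → (Fin (m + 1) → ℂ) → ℂ}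
    (hp : 2 < p) (hf : ContinuousOn f (polydisc (m + 1))) (hL : ConditionL p f)
    (hr : ContDiffOn ℂ ∞ r (polydisc m))
    (hfr : ∀ z' ∈ polydisc m, ∀ w ∈ disc, f (Fin.snoc (α := fun _ => ℂ) z' w) = 0 ↔ w = r z')
    (hB : IsTrivialExtension f B) : IsDbarClosed B := by
  have hL2 := fun j => hB.memLp hp hf hL j
  refine ⟨fun j => locallyIntegrableOn_of_memLp_two (isOpen_polydisc _) (hL2 j),
    fun j k φ hφ => ?_⟩
  have hset : {z | z ∈ polydisc (m + 1) ∧ z (Fin.last m) - r (Fin.init z) ≠ 0} =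
      {z | z ∈ polydisc (m + 1) ∧ f z ≠ 0} := by
    ext z
    simp only [mem_ofPred_eq, ne_eq]
    refine and_congr_right fun hz => not_congr ?_
    have h1 := hfr (Fin.init z) (fun i => hz i.castSucc) (z (Fin.last m)) (hz _)
    rw [Fin.snoc_init_self] at h1
    rw [h1, sub_eq_zero]
  refine integral_mul_dbar_symm_of_removable (isOpen_polydisc _) (contDiffOn_sub_zero hr)
    (ENNReal.mul_ne_top ENNReal.coe_ne_top (volume_polydisc_lt_top m).ne)
    (volume_near_graph_le hr.continuousOn) (hL2 j) (hL2 k) (fun ψ hψ => ?_) hφ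
  rw [hset] at hψ
  exact integral_mul_dbar_symm (isOpen_nonvanishing hf) (hf.mono fun z hz => hz.1)
    (fun z hz => hz.2) (hB.1 j) (hB.1 k) hψ

end Removable

end DbarLog


/-! ### The lemma -/

theorem lemma3p3 (m : ℕ) (p : ℝ≥0∞) (hp : 2 < p)
    (f : (Fin (m + 1) → ℂ) → ℂ) (hf : ContinuousOn f (DbarLog.polydisc (m + 1)))
    (hL : DbarLog.ConditionL p f)
    (r : (Fin m → ℂ) → ℂ)
    (hr : ∀ z' ∈ DbarLog.polydisc m, r z' ∈ DbarLog.disc ∧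
      ∀ w ∈ DbarLog.disc, f (Fin.snoc (α := fun _ => ℂ) z' w) = 0 ↔ w = r z')
    (hmult : ∀ z' ∈ DbarLog.polydisc m,
      DbarLog.HasMultiplicity (fun w => f (Fin.snoc (α := fun _ => ℂ) z' w)) (r z') 1) :
    (∃ B : Fin (m + 1) → (Fin (m + 1) → ℂ) → ℂ, DbarLog.IsTrivialExtension f B) ∧
    (∀ B : Fin (m + 1) → (Fin (m + 1) → ℂ) → ℂ,
      DbarLog.IsTrivialExtension f B → DbarLog.IsDbarClosed B) ∧
    DifferentiableOn ℂ r (DbarLog.polydisc m) := by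
  have hsep := DbarLog.isSeparatelyHolomorphic_zero hp hf hL hr hmult
  exact ⟨DbarLog.exists_isTrivialExtension hp hf hL,
    fun B hB => hB.isDbarClosed hp hf hL hsep.contDiffOn fun z' hz' => (hr z' hz').2,
    hsep.differentiableOn⟩
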